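/- All algebras are associative unital over $\mathbb C$. Let $H$ be a Hopf algebra, $B$ an algebra, and $I$ a finite set. Let $\mathcal P$ be a locally trivial quantum principal fibre bundle with structure group $H$ and base $B$: $\mathcal P$ is a right $H$-comodule algebra with coaction $\Delta_{\mathcal P}$; $(J_i)_{i\in I}$ are two-sided ideals of $B$ forming a complete covering; with $B_i=B/J_i$, $\chi_i:\mathcal P\to B_i\otimes H$ are surjective homomorphisms with $(\mathrm{id}\otimes\Delta)\chi_i=(\chi_i\otimes \mathrm{id})\Delta_{\mathcal P}$ whose kernels form a complete covering of $\mathcal P$; and $\iota:B\to\mathcal P$ is an injective homomorphism with $\chi_i(\iota(b))=\pi_i(b)\otimes 1$ (where $\pi_i:B\to B_i$ is the projection) and $\iota(B)=\{p:\Delta_{\mathcal P}(p)=p\otimes 1\}$. (A family of ideals $K_i$ of an algebra $A$ is a complete covering if $\bigcap_i K_i=0$ and each family in $\prod_i A/K_i$ whose members agree in all $A/(K_i+K_j)$ comes from an element of $A$.) Put $B_{ij}=B/(J_i+J_j)$ and let $\tau_{ij}:H\to B_{ij}$ be the transition functions, $\tau_{ij}(h)=(\mathrm{id}\otimes\varepsilon)(\pi^j_i\otimes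 \mathrm{id})\chi_j(p)$ for any $p\in\mathcal P$ with $\chi_i(p)=1\otimes h$, where $\pi^j_i:B_j\to B_{ij}$ is the projection. A differential calculus over an algebra $A$ is a differential graded algebra $\Gamma(A)=\bigoplus_{n\ge 0}\Gamma^n(A)$ with $\Gamma^0(A)=A$, generated by $A$ and $dA$. Let differential calculi $\Gamma(B_i)$ and a right covariant differential calculus $\Gamma(H)$ be given, and let $\hat\otimes$ be the graded (skew) tensor product. Let $\Gamma(\mathcal P)$ (resp. $\Gamma(B)$) be the quotient of the universal differential calculus of $\mathcal P$ (resp. $B$) by the intersection of the kernels of the extensions of the $\chi_i$ to $\Gamma(B_i)\hat\otimes\Gamma(H)$ (resp. of the projections $B\to B_i$ to $\Gamma(B_i)$). Let $\Gamma_c(\mathcal P)\subset\prod_i\Gamma(B_i)\hat\otimes\Gamma(H)$ and $\Gamma_c(B)\subset\prod_i\Gamma(B_i)$ be their covering completions, i.e. the algebras of families whose $i$-th and $j$-th members agree in the quotient of $\Gamma(\mathcal P)$ (resp. $\Gamma(B)$) by the sum of the kernels $\ker_i+\ker_j$ of the $i$-th and $j$-th extension, for all $i,j$. Here $\Gamma_c(\mathcal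 P)$ carries the componentwise $d$ and the coaction $\Delta$ which is componentwise $\mathrm{id}\otimes\Delta^{\Gamma(H)}$; $\chi_i$ also denotes the $i$-th projection of $\Gamma_c(\mathcal P)$; and $\iota_c:\Gamma_c(B)\to\Gamma_c(\mathcal P)$ is $(\gamma_i)\mapsto(\gamma_i\hat\otimes 1)$. Let $\mathrm{hor}\,\Gamma_c(\mathcal P)$ be the subalgebra of the $\alpha\in\Gamma_c(\mathcal P)$ with $\chi_i(\alpha)\in\Gamma(B_i)\hat\otimes H$ for all $i$. A left (right) covariant derivative is a linear map $D:\mathrm{hor}\,\Gamma_c(\mathcal P)\to\mathrm{hor}\,\Gamma_c(\mathcal P)$ which raises the degree by one, satisfies $D(1)=0$, $(D\otimes \mathrm{id})\Delta=\Delta D$ and $D(\ker\chi_i|_{\mathrm{hor}})\subset\ker\chi_i|_{\mathrm{hor}}$ for all $i$, and, in the left case, $D(\iota_c(\gamma)\alpha)=d(\iota_c(\gamma))\,\alpha+(-1)^n\iota_c(\gamma)D(\alpha)$ for $\gamma\in\Gamma_c^n(B)$, $\alpha\in\mathrm{hor}\,\Gamma_c(\mathcal P)$; in the right case, $D(\alpha\,\iota_c(\gamma))=D(\alpha)\iota_c(\gamma)+(-1)^n\alpha\,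 d(\iota_c(\gamma))$ for $\alpha\in\mathrm{hor}\,\Gamma^n_c(\mathcal P)$, $\gamma\in\Gamma_c(B)$. Let $\Gamma_m(B_{ij})$ be the differential calculus over $B_{ij}$ induced on the subalgebra $B_{ij}=B_{ij}\otimes 1$ by the calculus $\Gamma(\mathcal P)/(\ker_i+\ker_j)$ over $B_{ij}\otimes H$, with the projections $\pi^i_j:\Gamma(B_i)\to\Gamma_m(B_{ij})$, $\pi^j_i:\Gamma(B_j)\to\Gamma_m(B_{ij})$ extending $B_i\to B_{ij}$, $B_j\to B_{ij}$. Then left covariant derivatives are in bijective correspondence with families of linear maps $A_i:H\to\Gamma^1(B_i)$, $i\in I$, such that $A_i(1)=0$ for all $i$ and, for all $i,j\in I$ and $h\in H$, $$\pi^i_j(A_i(h))=\sum\tau_{ij}(h_1)\,\pi^j_i(A_j(h_2))\,\tau_{ji}(h_3)+\sum\tau_{ij}(h_1)\,d\tau_{ji}(h_2)\quad\text{in }\Gamma_m(B_{ij}),$$ and so are right covariant derivatives. In both cases the correspondence is given by $A_i(h)=-(\mathrm{id}\otimes\varepsilon)(D_i(1\otimes h))$, where $D_i$ is the linear map of $\Gamma(B_i)\hat\otimes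 H$ with $D_i\circ\chi_i=\chi_i\circ D$ on $\mathrm{hor}\,\Gamma_c(\mathcal P)$; conversely, for $\gamma\in\Gamma^n(B_i)$, $h\in H$, $D_i(\gamma\hat\otimes h)=d\gamma\hat\otimes h+(-1)^{n+1}\sum\gamma A_i(h_1)\hat\otimes h_2$ in the left case and $D_i(\gamma\hat\otimes h)=d\gamma\hat\otimes h-\sum A_i(h_1)\gamma\hat\otimes h_2$ in the right case. -/

import Mathlib

open scoped TensorProduct

noncomputable section

namespace QuantumBundle

universe u v v' w uH uB uP

/-! ### Algebraic preliminaries -/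

/-- The sum of two two-sided ideals is two-sided. -/
instance isTwoSided_sup {A : Type*} [Ring A] (K L : Ideal A) [K.IsTwoSided] [L.IsTwoSided] :
    (K ⊔ L).IsTwoSided := by
  refine ⟨fun {a} b ha => ?_⟩
  obtain ⟨x, hx, y, hy, rfl⟩ := Submodule.mem_sup.1 ha
  rw [add_mul]
  exact Submodule.add_mem_sup (Ideal.mul_mem_right _ _ hx) (Ideal.mul_mem_right _ _ hy)

/-- The convolution product `h ↦ ∑ f(h₁) g(h₂)` of two linear maps from a coalgebra to an
algebra. -/
def conv {H A : Type*} [Ring H] [Bialgebra ℂ H] [Ring A] [Algebra ℂ A]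
    (f g : H →ₗ[ℂ] A) : H →ₗ[ℂ] A :=
  LinearMap.mul' ℂ A ∘ₗ TensorProduct.map f g ∘ₗ Coalgebra.comul

/-- A right coaction of `H` on `A`, compatible with the algebra structures
(i.e. `A` is a right `H`-comodule algebra). -/
structure IsComoduleAlgebra {A H : Type*} [Ring A] [Algebra ℂ A] [Ring H] [HopfAlgebra ℂ H]
    (δ : A →ₐ[ℂ] A ⊗[ℂ] H) : Prop where
  coassoc : ∀ a : A,
    TensorProduct.assoc ℂ A H H (δ.toLinearMap.rTensor H (δ a)) =
      (Coalgebra.comul : H →ₗ[ℂ] H ⊗[ℂ] H).lTensor A (δ a)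
  counit : ∀ a : A,
    TensorProduct.rid ℂ A ((Coalgebra.counit : H →ₗ[ℂ] ℂ).lTensor A (δ a)) = a

/-- A complete covering of an algebra: the ideals have zero intersection, and every family of
classes which agree in all the quotients `A / (K i + K j)` comes from an element of `A`. -/
def IsCompleteCovering {A I : Type*} [Ring A] (K : I → Ideal A) [∀ i, (K i).IsTwoSided] : Prop :=
  (⨅ i, K i) = ⊥ ∧
    ∀ a : ∀ i, A ⧸ K i,
      (∀ i j, Ideal.Quotient.factor (le_sup_left : K i ≤ K i ⊔ K j) (a i) =
        Ideal.Quotient.factor (le_sup_right : K j ≤ K i ⊔ K j) (a j)) →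
      ∃ x : A, ∀ i, Ideal.Quotient.mk (K i) x = a i

/-- A family of linear maps `χ i : P → C i ⊗ H` is colinear for the coaction `δ` of `H` on `P`:
`(id ⊗ Δ) ∘ χ i = (χ i ⊗ id) ∘ δ`. -/
def IsColinear {P I H : Type*} {C : I → Type*} [Ring P] [Algebra ℂ P] [Ring H] [HopfAlgebra ℂ H]
    [∀ i, Ring (C i)] [∀ i, Algebra ℂ (C i)] (δ : P →ₐ[ℂ] P ⊗[ℂ] H)
    (χ : ∀ i, P →ₐ[ℂ] C i ⊗[ℂ] H) : Prop :=
  ∀ i p, (Coalgebra.comul : H →ₗ[ℂ] H ⊗[ℂ] H).lTensor (C i) (χ i p) =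
    TensorProduct.assoc ℂ (C i) H H ((χ i).toLinearMap.rTensor H (δ p))

/-- The kernels of the maps `χ i` form a complete covering of `P`. -/
def KernelsCover {P I : Type*} {C : I → Type*} [Ring P] [Algebra ℂ P]
    [∀ i, Ring (C i)] [∀ i, Algebra ℂ (C i)] (χ : ∀ i, P →ₐ[ℂ] C i) : Prop :=
  IsCompleteCovering fun i => RingHom.ker (χ i)

/-! ### Differential calculi -/

/-- A differential calculus over an algebra `A`: a differential graded algebra, graded by `ℕ`,
with `A` as degree zero part, and generated as an algebra by `A` and `dA`. -/
structure DiffCalculus (A : Type u) [Ring A] [Algebra ℂ A] where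
  /-- the underlying space of forms -/
  Form : Type v
  [ring : Ring Form]
  [algebra : Algebra ℂ Form]
  /-- the forms of degree `n` -/
  gr : ℕ → Submodule ℂ Form
  [graded : GradedAlgebra gr]
  /-- the identification of `A` with the forms of degree zero -/
  emb : A →ₐ[ℂ] Form
  emb_injective : Function.Injective emb
  range_emb : LinearMap.range emb.toLinearMap = gr 0
  /-- the differential -/
  d : Form →ₗ[ℂ] Form
  d_mem : ∀ {n : ℕ} {x : Form}, x ∈ gr n → d x ∈ gr (n + 1)
  d_d : ∀ x : Form, d (d x) = 0
  leibniz : ∀ {n : ℕ} {x : Form}, x ∈ gr n → ∀ y : Form,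
    d (x * y) = d x * y + (-1 : ℂ) ^ n • (x * d y)
  generated : Algebra.adjoin ℂ (Set.range emb ∪ Set.range fun a => d (emb a)) = ⊤

attribute [instance] DiffCalculus.ring DiffCalculus.algebra DiffCalculus.graded

namespace DiffCalculus

variable {A : Type u} [Ring A] [Algebra ℂ A] (Γ : DiffCalculus.{u, v} A)

/-- The linear map which is multiplication by `(-1)ⁿ` on forms of degree `n`. -/
def parity : Γ.Form →ₗ[ℂ] Γ.Form :=
  DirectSum.toModule ℂ ℕ Γ.Form (fun n => (-1 : ℂ) ^ n • (Γ.gr n).subtype) ∘ₗ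
    (DirectSum.decomposeLinearEquiv Γ.gr).toLinearMap

theorem parity_apply {n : ℕ} {x : Γ.Form} (hx : x ∈ Γ.gr n) :
    Γ.parity x = (-1 : ℂ) ^ n • x := by
  lift x to Γ.gr n using hx
  simp [parity]

theorem emb_mem (a : A) : Γ.emb a ∈ Γ.gr 0 := by
  rw [← Γ.range_emb]; exact ⟨a, rfl⟩

theorem d_one : Γ.d 1 = 0 := by
  have h := Γ.leibniz (n := 0) (x := 1) (by rw [← map_one Γ.emb]; exact Γ.emb_mem 1) 1
  simpa using h

end DiffCalculus

/-- A right covariant differential calculus over a Hopf algebra `H`: the algebra of forms is a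
right `H`-comodule algebra, the coaction being
`h₀ dh₁ ⋯ dhₙ ↦ Δ(h₀) (d ⊗ id)Δ(h₁) ⋯ (d ⊗ id)Δ(hₙ)`
(the coaction is multiplicative, so this is determined by its values on `h` and `dh`). -/
structure RightCovariantCalculus (H : Type u) [Ring H] [HopfAlgebra ℂ H] extends
    DiffCalculus.{u, v} H where
  /-- the coaction -/
  coaction : Form →ₐ[ℂ] Form ⊗[ℂ] H
  isComoduleAlgebra : IsComoduleAlgebra coaction
  coaction_emb : ∀ h : H, coaction (emb h) = emb.toLinearMap.rTensor H (Coalgebra.comul h)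
  coaction_d : ∀ h : H,
    coaction (d (emb h)) = (d ∘ₗ emb.toLinearMap).rTensor H (Coalgebra.comul h)

/-! ### Skew tensor product of differential calculi -/

section Skew

open GradedTensorProduct

variable {A : Type u} [Ring A] [Algebra ℂ A] (Γ : DiffCalculus.{u, v} A)
variable {H : Type uH} [Ring H] [Algebra ℂ H] (Θ : DiffCalculus.{uH, v'} H)

/-- The skew tensor product `Γ ⊗̂ Θ`, with the product
`(γ ⊗ ρ)(ω ⊗ τ) = (-1)^{deg ρ deg ω} γω ⊗ ρτ`. -/
abbrev Skew : Type (max v v') := Γ.gr ᵍ⊗[ℂ] Θ.gr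

/-- The differential `d(γ ⊗ ρ) = dγ ⊗ ρ + (-1)^{deg γ} γ ⊗ dρ`. -/
def skewD : Skew Γ Θ →ₗ[ℂ] Skew Γ Θ :=
  (of ℂ Γ.gr Θ.gr).toLinearMap ∘ₗ
    (TensorProduct.map Γ.d LinearMap.id + TensorProduct.map Γ.parity Θ.d) ∘ₗ
      (of ℂ Γ.gr Θ.gr).symm.toLinearMap

/-- The forms of total degree `n` in `Γ ⊗̂ Θ`. -/
def skewDegree (n : ℕ) : Submodule ℂ (Skew Γ Θ) :=
  ⨆ p ∈ Finset.HasAntidiagonal.antidiagonal n,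
    (Submodule.map₂ (TensorProduct.mk ℂ Γ.Form Θ.Form) (Γ.gr p.1) (Θ.gr p.2)).map
      (of ℂ Γ.gr Θ.gr).toLinearMap

theorem commute_horizontal (γ : Γ.Form) (h : H) :
    Commute (includeLeft Γ.gr Θ.gr γ) (includeRight Γ.gr Θ.gr (Θ.emb h)) := by
  induction γ using DirectSum.Decomposition.inductionOn Γ.gr with
  | zero => rw [map_zero]; exact Commute.zero_left _
  | homogeneous m =>
    have h1 := tmul_zero_coe_mul_coe_tmul (R := ℂ) Γ.gr Θ.gr 1 ⟨Θ.emb h, Θ.emb_mem h⟩ m 1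
    have h2 := tmul_one_mul_one_tmul (R := ℂ) Γ.gr Θ.gr (m : Γ.Form) (Θ.emb h)
    simp only [one_mul, mul_one] at h1
    exact h2.trans h1.symm
  | add a b ha hb => rw [map_add]; exact ha.add_left hb

/-- The inclusion `Γ ⊗ H → Γ ⊗̂ Θ`, where `H` is the degree zero part of `Θ`. The factor `H`
being of degree zero, it is multiplicative for the usual product of `Γ ⊗ H`. -/
def horIncl : Γ.Form ⊗[ℂ] H →ₐ[ℂ] Skew Γ Θ :=
  Algebra.TensorProduct.lift (includeLeft Γ.gr Θ.gr) ((includeRight Γ.gr Θ.gr).comp Θ.emb)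
    (commute_horizontal Γ Θ)

theorem horIncl_tmul (γ : Γ.Form) (h : H) :
    horIncl Γ Θ (γ ⊗ₜ h) = γ ᵍ⊗ₜ[ℂ] Θ.emb h :=
  (Algebra.TensorProduct.lift_tmul _ _ _ γ h).trans
    (tmul_one_mul_one_tmul (R := ℂ) Γ.gr Θ.gr γ (Θ.emb h))

/-- The inclusion `A ⊗ H → Γ ⊗̂ Θ` of the elements of degree zero. -/
def zeroIncl : A ⊗[ℂ] H →ₐ[ℂ] Skew Γ Θ :=
  (horIncl Γ Θ).comp (Algebra.TensorProduct.map Γ.emb (AlgHom.id ℂ H))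

theorem zeroIncl_tmul (a : A) (h : H) :
    zeroIncl Γ Θ (a ⊗ₜ h) = Γ.emb a ᵍ⊗ₜ[ℂ] Θ.emb h := by
  simp [zeroIncl, horIncl_tmul]

theorem skewD_tmul_one (γ : Γ.Form) : skewD Γ Θ (γ ᵍ⊗ₜ[ℂ] 1) = Γ.d γ ᵍ⊗ₜ[ℂ] 1 := by
  simp [skewD, Θ.d_one]

theorem skewD_one_tmul (ρ : Θ.Form) : skewD Γ Θ (1 ᵍ⊗ₜ[ℂ] ρ) = 1 ᵍ⊗ₜ[ℂ] Θ.d ρ := by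
  have h1 : (1 : Γ.Form) ∈ Γ.gr 0 := by rw [← map_one Γ.emb]; exact Γ.emb_mem 1
  simp [skewD, Γ.d_one, Γ.parity_apply h1]

/-- `Γ ⊗̂ Θ` is generated by its elements of degree zero and their differentials. -/
theorem skew_generated :
    Algebra.adjoin ℂ (Set.range (zeroIncl Γ Θ) ∪
      Set.range fun x => skewD Γ Θ (zeroIncl Γ Θ x)) = ⊤ := by
  set S := Algebra.adjoin ℂ (Set.range (zeroIncl Γ Θ) ∪
      Set.range fun x => skewD Γ Θ (zeroIncl Γ Θ x)) with hS
  have hL : ∀ γ : Γ.Form, includeLeft Γ.gr Θ.gr γ ∈ S := by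
    have : (⊤ : Subalgebra ℂ Γ.Form) ≤ S.comap (includeLeft Γ.gr Θ.gr) := by
      rw [← Γ.generated]
      refine Algebra.adjoin_le ?_
      rintro _ (⟨a, rfl⟩ | ⟨a, rfl⟩)
      · refine Algebra.subset_adjoin (Or.inl ⟨a ⊗ₜ 1, ?_⟩)
        simp [zeroIncl_tmul]
      · refine Algebra.subset_adjoin (Or.inr ⟨a ⊗ₜ 1, ?_⟩)
        simp [zeroIncl_tmul, skewD_tmul_one]
    exact fun γ => this trivial
  have hR : ∀ ρ : Θ.Form, includeRight Γ.gr Θ.gr ρ ∈ S := by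
    have : (⊤ : Subalgebra ℂ Θ.Form) ≤ S.comap (includeRight Γ.gr Θ.gr) := by
      rw [← Θ.generated]
      refine Algebra.adjoin_le ?_
      rintro _ (⟨a, rfl⟩ | ⟨a, rfl⟩)
      · refine Algebra.subset_adjoin (Or.inl ⟨1 ⊗ₜ a, ?_⟩)
        simp [zeroIncl_tmul]
      · refine Algebra.subset_adjoin (Or.inr ⟨1 ⊗ₜ a, ?_⟩)
        simp [zeroIncl_tmul, skewD_one_tmul]
    exact fun ρ => this trivial
  refine eq_top_iff.2 fun x _ => ?_
  obtain ⟨t, rfl⟩ := (of ℂ Γ.gr Θ.gr).surjective x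
  induction t using TensorProduct.induction_on with
  | zero => simp
  | tmul γ ρ =>
    have h := S.mul_mem (hL γ) (hR ρ)
    rwa [includeLeft_apply, includeRight_apply, tmul_one_mul_one_tmul] at h
  | add a b ha hb => rw [map_add]; exact S.add_mem (ha trivial) (hb trivial)

end Skew

/-! ### The adapted differential calculus and its covering completion

Given an algebra `A`, algebras of forms `C i` with differentials `d i` and homomorphisms
`f i : A → C i` into the degree zero parts, let `Ω` be the universal differential calculus of `A`
and `Ω → C i` the extension of `f i`. -/

section Adapted

variable {I : Type w} {A : Type u} [Ring A] [Algebra ℂ A] {C : I → Type v}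
  [∀ i, Ring (C i)] [∀ i, Algebra ℂ (C i)] (f : ∀ i, A →ₐ[ℂ] C i) (d : ∀ i, C i →ₗ[ℂ] C i)

/-- The differential calculus `Ω / ⋂ i, ker (Ω → C i)`, realized as the image of `Ω` in the product
of the `C i`: the subalgebra generated by the elements `(f i a)_i` and `(d (f i a))_i`. -/
def adapted : Subalgebra ℂ (∀ i, C i) :=
  Algebra.adjoin ℂ ((Set.range fun (a : A) (i : I) => f i a) ∪
    Set.range fun (a : A) (i : I) => d i (f i a))

/-- An element of `A`, as an element of degree zero of the calculus. -/
def adaptedOf (a : A) : adapted f d :=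
  ⟨fun i => f i a, Algebra.subset_adjoin (Or.inl ⟨a, rfl⟩)⟩

/-- The differential of an element of `A`, as an element of the calculus. -/
def adaptedD (a : A) : adapted f d :=
  ⟨fun i => d i (f i a), Algebra.subset_adjoin (Or.inr ⟨a, rfl⟩)⟩

/-- The differential extension of `f i` to the calculus. -/
def adaptedProj (i : I) : adapted f d →ₐ[ℂ] C i :=
  (Pi.evalAlgHom ℂ C i).comp (adapted f d).val

/-- The ideals covering the calculus: the kernels of the extensions of the `f i`. -/
abbrev locKer (i : I) : Ideal (adapted f d) := RingHom.ker (adaptedProj f d i)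

theorem adaptedProj_surjective
    (hgen : ∀ i, Algebra.adjoin ℂ (Set.range (f i) ∪ Set.range fun a => d i (f i a)) = ⊤) (i : I) :
    Function.Surjective (adaptedProj f d i) := by
  rw [← AlgHom.range_eq_top, eq_top_iff, ← hgen i]
  refine Algebra.adjoin_le ?_
  rintro _ (⟨a, rfl⟩ | ⟨a, rfl⟩)
  · exact ⟨adaptedOf f d a, rfl⟩
  · exact ⟨adaptedD f d a, rfl⟩

/-- The quotient of the calculus by the sum of the `i`-th and the `j`-th kernels. -/
def Overlap (i j : I) : Type (max v w) := adapted f d ⧸ (locKer f d i ⊔ locKer f d j)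

instance (i j : I) : Ring (Overlap f d i j) :=
  inferInstanceAs (Ring (adapted f d ⧸ (locKer f d i ⊔ locKer f d j)))

instance (i j : I) : Algebra ℂ (Overlap f d i j) :=
  inferInstanceAs (Algebra ℂ (adapted f d ⧸ (locKer f d i ⊔ locKer f d j)))

/-- The quotient map. -/
def toOverlap (i j : I) : adapted f d →ₐ[ℂ] Overlap f d i j :=
  Ideal.Quotient.mkₐ ℂ (locKer f d i ⊔ locKer f d j)

theorem toOverlap_surjective (i j : I) : Function.Surjective (toOverlap f d i j) :=
  Ideal.Quotient.mkₐ_surjective ℂ (locKer f d i ⊔ locKer f d j)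

theorem toOverlap_eq_zero_iff (i j : I) (x : adapted f d) :
    toOverlap f d i j x = 0 ↔ ∃ a b, adaptedProj f d i a = 0 ∧ adaptedProj f d j b = 0 ∧
      a + b = x := by
  have h : toOverlap f d i j x = 0 ↔ x ∈ locKer f d i ⊔ locKer f d j :=
    Ideal.Quotient.eq_zero_iff_mem
  rw [h, Submodule.mem_sup]
  constructor
  · rintro ⟨a, ha, b, hb, hx⟩
    exact ⟨a, b, ha, hb, hx⟩
  · rintro ⟨a, b, ha, hb, hx⟩
    exact ⟨a, ha, b, hb, hx⟩

variable {f d} (hs : ∀ i, Function.Surjective (adaptedProj f d i))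

/-- The natural projection from `C i` (which is the quotient of the calculus by the `i`-th kernel)
to the quotient of the calculus by the sum of the `i`-th and the `j`-th kernels. -/
def overlapLeft (i j : I) : C i →ₐ[ℂ] Overlap f d i j :=
  AlgHom.comp (Ideal.Quotient.factorₐ ℂ (le_sup_left : locKer f d i ≤ locKer f d i ⊔ locKer f d j))
    (Ideal.quotientKerAlgEquivOfSurjective (hs i)).symm.toAlgHom

/-- The natural projection from `C j` to the quotient of the calculus by the sum of the `i`-th and
the `j`-th kernels. -/
def overlapRight (i j : I) : C j →ₐ[ℂ] Overlap f d i j :=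
  AlgHom.comp (Ideal.Quotient.factorₐ ℂ (le_sup_right : locKer f d j ≤ locKer f d i ⊔ locKer f d j))
    (Ideal.quotientKerAlgEquivOfSurjective (hs j)).symm.toAlgHom

theorem overlapLeft_apply (i j : I) (x : adapted f d) :
    overlapLeft hs i j (adaptedProj f d i x) = toOverlap f d i j x :=
  congrArg (Ideal.Quotient.factorₐ ℂ (le_sup_left : locKer f d i ≤ locKer f d i ⊔ locKer f d j))
    (Ideal.quotientKerAlgEquivOfSurjective_symm_apply (hs i) x)

theorem overlapRight_apply (i j : I) (x : adapted f d) :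
    overlapRight hs i j (adaptedProj f d j x) = toOverlap f d i j x :=
  congrArg (Ideal.Quotient.factorₐ ℂ (le_sup_right : locKer f d j ≤ locKer f d i ⊔ locKer f d j))
    (Ideal.quotientKerAlgEquivOfSurjective_symm_apply (hs j) x)

/-- The covering completion of the calculus: the families in the product of the `C i` whose
`i`-th and `j`-th members have the same class in the quotient of the calculus by
the sum of the `i`-th and the `j`-th kernels. -/
def completion : Subalgebra ℂ (∀ i, C i) :=
  ⨅ i, ⨅ j, AlgHom.equalizer ((overlapLeft hs i j).comp (Pi.evalAlgHom ℂ C i))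
    ((overlapRight hs i j).comp (Pi.evalAlgHom ℂ C j))

theorem mem_completion_iff {c : ∀ i, C i} : c ∈ completion hs ↔ ∀ i j,
    overlapLeft hs i j (c i) = overlapRight hs i j (c j) := by
  simp [completion, Algebra.mem_iInf, AlgHom.mem_equalizer]

/-- Two members of a compatible family have a common lift. -/
theorem mem_completion_iff_exists {c : ∀ i, C i} : c ∈ completion hs ↔ ∀ i j,
    ∃ x : adapted f d, adaptedProj f d i x = c i ∧ adaptedProj f d j x = c j := by
  rw [mem_completion_iff]
  refine forall_congr' fun i => forall_congr' fun j => ⟨fun h => ?_, ?_⟩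
  · obtain ⟨x, hx⟩ := hs i (c i)
    obtain ⟨y, hy⟩ := hs j (c j)
    rw [← hx, ← hy, overlapLeft_apply, overlapRight_apply, ← sub_eq_zero, ← map_sub,
      toOverlap_eq_zero_iff] at h
    obtain ⟨a, b, ha, hb, hab⟩ := h
    refine ⟨x - a, by rw [map_sub, ha, hx, sub_zero], ?_⟩
    have : x - a = y + b := by rw [sub_eq_iff_eq_add, add_assoc, add_comm b a, hab]; abel
    rw [this, map_add, hb, hy, add_zero]
  · rintro ⟨x, hx, hy⟩
    rw [← hx, ← hy, overlapLeft_apply, overlapRight_apply]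

end Adapted

/-! ### Locally trivial quantum principal fibre bundles -/

/-- A locally trivial quantum principal fibre bundle with structure group `H`, base `B`, total
space `P`, and local trivializations `χ i : P → (B / J i) ⊗ H`. -/
structure Bundle (H : Type uH) (B : Type uB) (P : Type uP) (I : Type w) [Ring H] [HopfAlgebra ℂ H] [Ring B] [Algebra ℂ B]
    [Ring P] [Algebra ℂ P] where
  /-- the right coaction of `H` on `P` -/
  coaction : P →ₐ[ℂ] P ⊗[ℂ] H
  isComoduleAlgebra : IsComoduleAlgebra coaction
  /-- the covering of the base -/
  J : I → Ideal B
  [twoSided : ∀ i, (J i).IsTwoSided]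
  complete_base : IsCompleteCovering J
  /-- the local trivializations -/
  χ : ∀ i, P →ₐ[ℂ] (B ⧸ J i) ⊗[ℂ] H
  χ_surjective : ∀ i, Function.Surjective (χ i)
  /-- `(id ⊗ Δ) ∘ χ i = (χ i ⊗ id) ∘ Δ_P` -/
  χ_colinear : IsColinear coaction χ
  /-- the embedding of the base -/
  ι : B →ₐ[ℂ] P
  ι_injective : Function.Injective ι
  χ_ι : ∀ i b, χ i (ι b) = Ideal.Quotient.mk (J i) b ⊗ₜ 1
  complete_total : KernelsCover χ
  range_ι : ∀ p, p ∈ Set.range ι ↔ coaction p = p ⊗ₜ 1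

attribute [instance] Bundle.twoSided

section Bundles

variable {H : Type uH} {B : Type uB} {P : Type uP} {I : Type w} [Ring H] [HopfAlgebra ℂ H] [Ring B] [Algebra ℂ B]
  [Ring P] [Algebra ℂ P]

namespace Bundle

variable (X : Bundle H B P I)

/-- The algebra `B i = B / J i`. -/
abbrev Loc (i : I) : Type uB := B ⧸ X.J i

/-- The algebra `B ij = B / (J i + J j)`. -/
abbrev Loc₂ (i j : I) : Type uB := B ⧸ (X.J i ⊔ X.J j)

/-- A linear right inverse of `χ k`. -/
def sect (k : I) : X.Loc k ⊗[ℂ] H →ₗ[ℂ] P :=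
  ((X.χ k).toLinearMap.exists_rightInverse_of_surjective
    (LinearMap.range_eq_top.2 (X.χ_surjective k))).choose

theorem χ_sect (k : I) (x : X.Loc k ⊗[ℂ] H) : X.χ k (X.sect k x) = x :=
  LinearMap.congr_fun ((X.χ k).toLinearMap.exists_rightInverse_of_surjective
    (LinearMap.range_eq_top.2 (X.χ_surjective k))).choose_spec x

/-- The map `(π ⊗ id) ∘ χ k` from `P` to `(B / L) ⊗ H`, where `L` contains `J k`. -/
def χRestrict {k : I} (L : Ideal B) [L.IsTwoSided] (hk : X.J k ≤ L) :
    P →ₗ[ℂ] (B ⧸ L) ⊗[ℂ] H :=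
  (Ideal.Quotient.factorₐ ℂ hk).toLinearMap.rTensor H ∘ₗ (X.χ k).toLinearMap

/-- The transition function `τ_kl`, with values in `B / L`, where `L = J k + J l`:
`τ_kl(h) = (id ⊗ ε)(φ_lk (1 ⊗ h))`, where `φ_lk` is the automorphism of `(B / L) ⊗ H` such that
`(π ⊗ id) ∘ χ l = φ_lk ∘ (π ⊗ id) ∘ χ k`. In other words, `τ_kl(h)` is the value of
`(id ⊗ ε) ∘ (π ⊗ id) ∘ χ l` at any element `p` of `P` with `χ k p = 1 ⊗ h`; it does not depend
on the choice of `p`. -/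
def transition (k l : I) (L : Ideal B) [L.IsTwoSided] (hl : X.J l ≤ L) :
    H →ₗ[ℂ] B ⧸ L :=
  (TensorProduct.rid ℂ (B ⧸ L)).toLinearMap ∘ₗ
    (Coalgebra.counit : H →ₗ[ℂ] ℂ).lTensor (B ⧸ L) ∘ₗ
      X.χRestrict L hl ∘ₗ X.sect k ∘ₗ TensorProduct.mk ℂ (X.Loc k) H 1

end Bundle

/-- The data determining a differential structure on a bundle: differential calculi over the
algebras `B i = B / J i`, and a right covariant differential calculus over `H`. -/
structure DiffStructure (X : Bundle H B P I) where
  /-- the calculus `Γ(B i)` -/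
  base : ∀ i, DiffCalculus.{uB, v} (X.Loc i)
  /-- the calculus `Γ(H)` -/
  fibre : RightCovariantCalculus.{uH, v'} H

namespace DiffStructure

open GradedTensorProduct

variable {X : Bundle H B P I} (S : DiffStructure.{v, v'} X)

/-- The forms on the local piece `B i`. -/
abbrev BForm (i : I) : Type v := (S.base i).Form

/-- The local differential calculus `Γ(B i) ⊗̂ Γ(H)`. -/
abbrev E (i : I) : Type (max v v') := Skew (S.base i) S.fibre.toDiffCalculus

/-- The differential of `Γ(B i) ⊗̂ Γ(H)`. -/
def dE (i : I) : S.E i →ₗ[ℂ] S.E i := skewD (S.base i) S.fibre.toDiffCalculus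

/-- The map `γ ↦ γ ⊗̂ 1`. -/
def left (i : I) : S.BForm i →ₐ[ℂ] S.E i := includeLeft (S.base i).gr S.fibre.gr

/-- The inclusion `Γ(B i) ⊗ H → Γ(B i) ⊗̂ Γ(H)`. -/
def hIncl (i : I) : S.BForm i ⊗[ℂ] H →ₐ[ℂ] S.E i :=
  horIncl (S.base i) S.fibre.toDiffCalculus

/-- The coaction `id ⊗ Δ^Γ` of `H` on `Γ(B i) ⊗̂ Γ(H)`. -/
def coE (i : I) : S.E i →ₗ[ℂ] S.E i ⊗[ℂ] H :=
  (of ℂ (S.base i).gr S.fibre.gr).toLinearMap.rTensor H ∘ₗ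
    (TensorProduct.assoc ℂ (S.BForm i) S.fibre.Form H).symm.toLinearMap ∘ₗ
      S.fibre.coaction.toLinearMap.lTensor (S.BForm i) ∘ₗ
        (of ℂ (S.base i).gr S.fibre.gr).symm.toLinearMap

/-! #### The calculi `Γ(B)` and `Γ(P)` and their covering completions -/

/-- The projection `B → B i`, with values in the calculus `Γ(B i)`. -/
def baseMap (i : I) : B →ₐ[ℂ] S.BForm i :=
  (S.base i).emb.comp (Ideal.Quotient.mkₐ ℂ (X.J i))

/-- The differential of `Γ(B i)`. -/
def dB (i : I) : S.BForm i →ₗ[ℂ] S.BForm i := (S.base i).d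

/-- The trivialization `χ i`, with values in the calculus `Γ(B i) ⊗̂ Γ(H)`. -/
def totalMap (i : I) : P →ₐ[ℂ] S.E i :=
  (zeroIncl (S.base i) S.fibre.toDiffCalculus).comp (X.χ i)

/-- The differential calculus `Γ(B)` over `B`, adapted to the covering of `B`. -/
abbrev ΓB : Subalgebra ℂ (∀ i, S.BForm i) := adapted S.baseMap S.dB

/-- The differential calculus `Γ(P)` over `P`, adapted to the covering of `P`. -/
abbrev ΓP : Subalgebra ℂ (∀ i, S.E i) := adapted S.totalMap S.dE

theorem base_surjective (i : I) : Function.Surjective (adaptedProj S.baseMap S.dB i) := by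
  refine adaptedProj_surjective _ _ (fun i => ?_) i
  rw [← (S.base i).generated]
  congr 2
  · exact (Ideal.Quotient.mk_surjective (I := X.J i)).range_comp (S.base i).emb
  · exact (Ideal.Quotient.mk_surjective (I := X.J i)).range_comp
      fun a => (S.base i).d ((S.base i).emb a)

theorem total_surjective (i : I) : Function.Surjective (adaptedProj S.totalMap S.dE i) := by
  refine adaptedProj_surjective _ _ (fun i => ?_) i
  rw [← skew_generated (S.base i) S.fibre.toDiffCalculus]
  congr 2
  · exact (X.χ_surjective i).range_comp (zeroIncl (S.base i) S.fibre.toDiffCalculus)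
  · exact (X.χ_surjective i).range_comp fun x => skewD (S.base i) S.fibre.toDiffCalculus
      (zeroIncl (S.base i) S.fibre.toDiffCalculus x)

/-- The covering completion `Γ_c(B)`. -/
abbrev ΓcB : Subalgebra ℂ (∀ i, S.BForm i) := completion S.base_surjective

/-- The covering completion `Γ_c(P)`. The extension of `χ i` to `Γ_c(P)` is the projection to the
`i`-th component. -/
abbrev ΓcP : Subalgebra ℂ (∀ i, S.E i) := completion S.total_surjective

/-- The differential of `Γ_c(P)`, which is componentwise, on the ambient product. -/
def dPi : (∀ i, S.E i) →ₗ[ℂ] (∀ i, S.E i) :=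
  LinearMap.pi fun i => S.dE i ∘ₗ LinearMap.proj i

/-- The algebra `hor Γ_c(P)` of horizontal forms: the elements of `Γ_c(P)` with all components
in `Γ(B i) ⊗̂ H`. -/
def hor : Subalgebra ℂ (∀ i, S.E i) :=
  S.ΓcP ⊓ ⨅ i, (S.hIncl i).range.comap (Pi.evalAlgHom ℂ S.E i)

theorem mem_hor {c : ∀ i, S.E i} :
    c ∈ S.hor ↔ c ∈ S.ΓcP ∧ ∀ i, ∃ x, S.hIncl i x = c i := by
  simp [hor, Algebra.mem_inf, Algebra.mem_iInf]

/-- The restriction of `χ i` to the horizontal forms. -/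
def horProj (i : I) : S.hor →ₗ[ℂ] S.E i := LinearMap.proj i ∘ₗ S.hor.val.toLinearMap

/-- The map `(γ i)_i ↦ (γ i ⊗̂ 1)_i`. -/
def leftPi : (∀ i, S.BForm i) →ₐ[ℂ] (∀ i, S.E i) :=
  AlgHom.pi fun i => (S.left i).comp (Pi.evalAlgHom ℂ S.BForm i)

theorem left_baseMap (i : I) (b : B) : S.left i (S.baseMap i b) = S.totalMap i (X.ι b) := by
  simp [left, baseMap, totalMap, X.χ_ι, zeroIncl_tmul]

theorem left_dB (i : I) (b : B) :
    S.left i (S.dB i (S.baseMap i b)) = S.dE i (S.totalMap i (X.ι b)) := by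
  rw [← left_baseMap]
  simp [left, dB, dE, skewD_tmul_one]

theorem leftPi_mem_ΓP {γ : ∀ i, S.BForm i} (hγ : γ ∈ S.ΓB) : S.leftPi γ ∈ S.ΓP := by
  have : S.ΓB ≤ S.ΓP.comap S.leftPi := by
    refine Algebra.adjoin_le ?_
    rintro _ (⟨b, rfl⟩ | ⟨b, rfl⟩)
    · exact Algebra.subset_adjoin (Or.inl ⟨X.ι b, funext fun i => (S.left_baseMap i b).symm⟩)
    · exact Algebra.subset_adjoin (Or.inr ⟨X.ι b, funext fun i => (S.left_dB i b).symm⟩)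
  exact this hγ

theorem leftPi_mem_hor {γ : ∀ i, S.BForm i} (hγ : γ ∈ S.ΓcB) : S.leftPi γ ∈ S.hor := by
  rw [mem_hor]
  refine ⟨?_, fun i => ⟨γ i ⊗ₜ 1, ?_⟩⟩
  · rw [mem_completion_iff_exists] at hγ ⊢
    intro i j
    obtain ⟨x, hi, hj⟩ := hγ i j
    exact ⟨⟨S.leftPi x, S.leftPi_mem_ΓP x.2⟩, congrArg (S.left i) hi, congrArg (S.left j) hj⟩
  · simp [hIncl, horIncl_tmul, leftPi, left]

/-- The embedding `Γ_c(B) → Γ_c(P)`, whose image is contained in `hor Γ_c(P)`. -/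
def ιc : S.ΓcB →ₐ[ℂ] S.hor :=
  (S.leftPi.comp S.ΓcB.val).codRestrict S.hor fun γ => S.leftPi_mem_hor γ.2

/-! #### The calculus `Γ_m` on the overlaps -/

/-- The quotient of `Γ(P)` by the sum of the kernels of the extensions of `χ i` and `χ j`.
By means of the extensions of `χ i` and `χ j` it is identified with each of the two calculi over
`B ij ⊗ H` obtained as quotients of `Γ(B i) ⊗̂ Γ(H)` and of `Γ(B j) ⊗̂ Γ(H)`, and then the
isomorphism between these two (the differential extension of `φ_ij`) becomes the identity. -/
abbrev Q (i j : I) : Type (max v v' w) := Overlap S.totalMap S.dE i j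

/-- The natural projection from `Γ(B i) ⊗̂ Γ(H)`. -/
def projLeft (i j : I) : S.E i →ₐ[ℂ] S.Q i j := overlapLeft S.total_surjective i j

/-- The natural projection from `Γ(B j) ⊗̂ Γ(H)`. -/
def projRight (i j : I) : S.E j →ₐ[ℂ] S.Q i j := overlapRight S.total_surjective i j

/-- The class of an element `b` of the base. -/
def classOf (i j : I) (b : B) : S.Q i j :=
  toOverlap S.totalMap S.dE i j (adaptedOf S.totalMap S.dE (X.ι b))

/-- The class of the differential of an element `b` of the base. -/
def classD (i j : I) (b : B) : S.Q i j :=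
  toOverlap S.totalMap S.dE i j (adaptedD S.totalMap S.dE (X.ι b))

/-- The differential calculus `Γ_m(B ij)` induced on the subalgebra `B ij = B ij ⊗ 1` by the
calculus over `B ij ⊗ H`: it consists of the sums of elements `a₀ da₁ ⋯ daₙ`, with the `aₖ`
in `B ij`. -/
def Γm (i j : I) : Subalgebra ℂ (S.Q i j) :=
  Algebra.adjoin ℂ (Set.range (S.classOf i j) ∪ Set.range (S.classD i j))

theorem projLeft_classOf (i j : I) (b : B) :
    S.projLeft i j (S.left i (S.baseMap i b)) = S.classOf i j b := by
  rw [left_baseMap]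
  exact overlapLeft_apply S.total_surjective i j (adaptedOf S.totalMap S.dE (X.ι b))

theorem projLeft_classD (i j : I) (b : B) :
    S.projLeft i j (S.left i (S.dB i (S.baseMap i b))) = S.classD i j b := by
  rw [left_dB]
  exact overlapLeft_apply S.total_surjective i j (adaptedD S.totalMap S.dE (X.ι b))

theorem projRight_classOf (i j : I) (b : B) :
    S.projRight i j (S.left j (S.baseMap j b)) = S.classOf i j b := by
  rw [left_baseMap]
  exact overlapRight_apply S.total_surjective i j (adaptedOf S.totalMap S.dE (X.ι b))

theorem projRight_classD (i j : I) (b : B) :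
    S.projRight i j (S.left j (S.dB j (S.baseMap j b))) = S.classD i j b := by
  rw [left_dB]
  exact overlapRight_apply S.total_surjective i j (adaptedD S.totalMap S.dE (X.ι b))

theorem baseMap_generated (i : I) : Algebra.adjoin ℂ (Set.range (S.baseMap i) ∪
    Set.range fun b => S.dB i (S.baseMap i b)) = ⊤ := by
  rw [← (S.base i).generated]
  congr 2
  · exact (Ideal.Quotient.mk_surjective (I := X.J i)).range_comp (S.base i).emb
  · exact (Ideal.Quotient.mk_surjective (I := X.J i)).range_comp
      fun a => (S.base i).d ((S.base i).emb a)

theorem projLeft_mem (i j : I) (γ : S.BForm i) : S.projLeft i j (S.left i γ) ∈ S.Γm i j := by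
  have : (⊤ : Subalgebra ℂ (S.BForm i)) ≤ (S.Γm i j).comap ((S.projLeft i j).comp (S.left i)) := by
    rw [← S.baseMap_generated i]
    refine Algebra.adjoin_le ?_
    rintro _ (⟨b, rfl⟩ | ⟨b, rfl⟩)
    · exact Algebra.subset_adjoin (Or.inl ⟨b, (S.projLeft_classOf i j b).symm⟩)
    · exact Algebra.subset_adjoin (Or.inr ⟨b, (S.projLeft_classD i j b).symm⟩)
  exact this trivial

theorem projRight_mem (i j : I) (γ : S.BForm j) : S.projRight i j (S.left j γ) ∈ S.Γm i j := by
  have : (⊤ : Subalgebra ℂ (S.BForm j)) ≤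
      (S.Γm i j).comap ((S.projRight i j).comp (S.left j)) := by
    rw [← S.baseMap_generated j]
    refine Algebra.adjoin_le ?_
    rintro _ (⟨b, rfl⟩ | ⟨b, rfl⟩)
    · exact Algebra.subset_adjoin (Or.inl ⟨b, (S.projRight_classOf i j b).symm⟩)
    · exact Algebra.subset_adjoin (Or.inr ⟨b, (S.projRight_classD i j b).symm⟩)
  exact this trivial

/-- The projection `Γ(B i) → Γ_m(B ij)`. -/
def πLeft (i j : I) : S.BForm i →ₐ[ℂ] S.Γm i j :=
  ((S.projLeft i j).comp (S.left i)).codRestrict _ (S.projLeft_mem i j)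

/-- The projection `Γ(B j) → Γ_m(B ij)`. -/
def πRight (i j : I) : S.BForm j →ₐ[ℂ] S.Γm i j :=
  ((S.projRight i j).comp (S.left j)).codRestrict _ (S.projRight_mem i j)

/-- The map `b ↦ [b]` from `B` to `Γ_m(B ij)`. -/
def mOf (i j : I) : B →ₗ[ℂ] S.Γm i j := (S.πLeft i j).toLinearMap ∘ₗ (S.baseMap i).toLinearMap

/-- The map `b ↦ [db]` from `B` to `Γ_m(B ij)`. -/
def mD (i j : I) : B →ₗ[ℂ] S.Γm i j :=
  (S.πLeft i j).toLinearMap ∘ₗ S.dB i ∘ₗ (S.baseMap i).toLinearMap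

theorem baseMap_eq_zero {i : I} {b : B} (hb : b ∈ X.J i) : S.baseMap i b = 0 := by
  simp [baseMap, Ideal.Quotient.eq_zero_iff_mem.2 hb]

theorem mOf_eq_zero (i j : I) {b : B} (hb : b ∈ X.J i ⊔ X.J j) : S.mOf i j b = 0 := by
  obtain ⟨x, hx, y, hy, rfl⟩ := Submodule.mem_sup.1 hb
  have h1 : S.mOf i j x = 0 := by simp [mOf, S.baseMap_eq_zero hx]
  have h2 : S.mOf i j y = 0 := Subtype.ext <| by
    change S.projLeft i j (S.left i (S.baseMap i y)) = 0
    rw [projLeft_classOf, ← projRight_classOf, S.baseMap_eq_zero hy, map_zero, map_zero]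
  rw [map_add, h1, h2, add_zero]

theorem mD_eq_zero (i j : I) {b : B} (hb : b ∈ X.J i ⊔ X.J j) : S.mD i j b = 0 := by
  obtain ⟨x, hx, y, hy, rfl⟩ := Submodule.mem_sup.1 hb
  have h1 : S.mD i j x = 0 := by simp [mD, S.baseMap_eq_zero hx]
  have h2 : S.mD i j y = 0 := Subtype.ext <| by
    change S.projLeft i j (S.left i (S.dB i (S.baseMap i y))) = 0
    rw [projLeft_classD, ← projRight_classD, S.baseMap_eq_zero hy, map_zero, map_zero, map_zero]
  rw [map_add, h1, h2, add_zero]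

/-- The inclusion of `B ij` into `Γ_m(B ij)` as the forms of degree zero. -/
def embM (i j : I) : X.Loc₂ i j →ₗ[ℂ] S.Γm i j :=
  Submodule.liftQ ((X.J i ⊔ X.J j).restrictScalars ℂ) (S.mOf i j) fun _ hb => S.mOf_eq_zero i j hb

/-- The differential `B ij → Γ_m(B ij)`. -/
def dM (i j : I) : X.Loc₂ i j →ₗ[ℂ] S.Γm i j :=
  Submodule.liftQ ((X.J i ⊔ X.J j).restrictScalars ℂ) (S.mD i j) fun _ hb => S.mD_eq_zero i j hb

/-! #### Covariant derivatives -/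

/-- The horizontal form `α` is homogeneous of degree `n`. -/
def HorDegree (n : ℕ) (α : S.hor) : Prop :=
  ∀ i, S.horProj i α ∈ skewDegree (S.base i) S.fibre.toDiffCalculus n

/-- The element `γ` of `Γ_c(B)` is homogeneous of degree `n`. -/
def BaseDegree (n : ℕ) (γ : S.ΓcB) : Prop := ∀ i, γ.1 i ∈ (S.base i).gr n

/-- `t = Δ(α)`, where `Δ` is the coaction of `H` on the horizontal forms, which is determined by
`(χ i ⊗ id) ∘ Δ = (id ⊗ Δ^Γ) ∘ χ i` for all `i`. -/
def IsCoactionOf (α : S.hor) (t : S.hor ⊗[ℂ] H) : Prop :=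
  ∀ i, (S.horProj i).rTensor H t = S.coE i (S.horProj i α)

/-- `(D ⊗ id) ∘ Δ = Δ ∘ D` -/
def IsCovariant (D : S.hor →ₗ[ℂ] S.hor) : Prop :=
  ∀ α, ∃ t, S.IsCoactionOf α t ∧ S.IsCoactionOf (D α) (D.rTensor H t)

/-- `D(hor Γⁿ_c(P)) ⊆ hor Γⁿ⁺¹_c(P)` -/
def RaisesDegree (D : S.hor →ₗ[ℂ] S.hor) : Prop :=
  ∀ n α, S.HorDegree n α → S.HorDegree (n + 1) (D α)

/-- `D(1) = 0` -/
def KillsOne (D : S.hor →ₗ[ℂ] S.hor) : Prop := D 1 = 0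

/-- `D` preserves the kernel of the restriction of `χ i` to the horizontal forms, for all `i`. -/
def PreservesKernels (D : S.hor →ₗ[ℂ] S.hor) : Prop :=
  ∀ i α, S.horProj i α = 0 → S.horProj i (D α) = 0

/-- `D(γ α) = (dγ) α + (-1)ⁿ γ D(α)` for `γ ∈ Γⁿ_c(B)` and `α ∈ hor Γ_c(P)` -/
def LeftLeibniz (D : S.hor →ₗ[ℂ] S.hor) : Prop :=
  ∀ n (γ : S.ΓcB), S.BaseDegree n γ → ∀ α : S.hor,
    (D (S.ιc γ * α) : ∀ i, S.E i) =
      S.dPi (S.ιc γ) * α + (-1 : ℂ) ^ n • ((S.ιc γ : ∀ i, S.E i) * D α)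

/-- `D(α γ) = D(α) γ + (-1)ⁿ α dγ` for `α ∈ hor Γⁿ_c(P)` and `γ ∈ Γ_c(B)` -/
def RightLeibniz (D : S.hor →ₗ[ℂ] S.hor) : Prop :=
  ∀ n (α : S.hor), S.HorDegree n α → ∀ γ : S.ΓcB,
    (D (α * S.ιc γ) : ∀ i, S.E i) =
      (D α : ∀ i, S.E i) * S.ιc γ + (-1 : ℂ) ^ n • ((α : ∀ i, S.E i) * S.dPi (S.ιc γ))

/-- Left covariant derivatives. -/
structure IsLeftCovDer (D : S.hor →ₗ[ℂ] S.hor) : Prop where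
  degree : S.RaisesDegree D
  map_one : S.KillsOne D
  leibniz : S.LeftLeibniz D
  covariant : S.IsCovariant D
  map_ker : S.PreservesKernels D

/-- Right covariant derivatives. -/
structure IsRightCovDer (D : S.hor →ₗ[ℂ] S.hor) : Prop where
  degree : S.RaisesDegree D
  map_one : S.KillsOne D
  leibniz : S.RightLeibniz D
  covariant : S.IsCovariant D
  map_ker : S.PreservesKernels D

/-! #### Families of local one-forms -/

/-- Families of linear maps `A i : H → Γ¹(B i)`. -/
abbrev LocalFamily : Type (max uH v w) := ∀ i, H →ₗ[ℂ] (S.base i).gr 1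

/-- The map `A i`, as a map to `Γ(B i)`. -/
def formOf (A : S.LocalFamily) (i : I) : H →ₗ[ℂ] S.BForm i := ((S.base i).gr 1).subtype ∘ₗ A i

/-- The transition function `τ_ij`, with values in `B ij`. -/
def τ (_ : DiffStructure.{v, v'} X) (i j : I) : H →ₗ[ℂ] X.Loc₂ i j :=
  X.transition i j _ le_sup_right

/-- The transition function `τ_ji`, with values in `B ij`. -/
def τ' (_ : DiffStructure.{v, v'} X) (i j : I) : H →ₗ[ℂ] X.Loc₂ i j :=
  X.transition j i _ le_sup_left

/-- The conditions `A i (1) = 0` and, in `Γ_m(B ij)`,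
`π(A i (h)) = ∑ τ_ij(h₁) π(A j (h₂)) τ_ji(h₃) + ∑ τ_ij(h₁) dτ_ji(h₂)`. -/
structure IsCompatible (A : S.LocalFamily) : Prop where
  map_one : ∀ i, A i 1 = 0
  gauge : ∀ i j, (S.πLeft i j).toLinearMap ∘ₗ S.formOf A i =
    conv (conv (S.embM i j ∘ₗ S.τ i j) ((S.πRight i j).toLinearMap ∘ₗ S.formOf A j))
      (S.embM i j ∘ₗ S.τ' i j) +
    conv (S.embM i j ∘ₗ S.τ i j) (S.dM i j ∘ₗ S.τ' i j)

/-- The linear map `Γ(B i) ⊗ H → Γ(B i) ⊗ H` given on forms `γ` of degree `n` by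
`γ ⊗ h ↦ dγ ⊗ h + (-1)^(n+1) ∑ γ a(h₁) ⊗ h₂`. -/
def localLeft {i : I} (a : H →ₗ[ℂ] S.BForm i) :
    S.BForm i ⊗[ℂ] H →ₗ[ℂ] S.BForm i ⊗[ℂ] H :=
  (S.base i).d.rTensor H -
    (LinearMap.mul' ℂ (S.BForm i)).rTensor H ∘ₗ
      (TensorProduct.assoc ℂ (S.BForm i) (S.BForm i) H).symm.toLinearMap ∘ₗ
        TensorProduct.map (S.base i).parity (a.rTensor H ∘ₗ Coalgebra.comul)

/-- The linear map `Γ(B i) ⊗ H → Γ(B i) ⊗ H` given by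
`γ ⊗ h ↦ dγ ⊗ h - ∑ a(h₁) γ ⊗ h₂`. -/
def localRight {i : I} (a : H →ₗ[ℂ] S.BForm i) :
    S.BForm i ⊗[ℂ] H →ₗ[ℂ] S.BForm i ⊗[ℂ] H :=
  (S.base i).d.rTensor H -
    (LinearMap.mul' ℂ (S.BForm i) ∘ₗ
        (TensorProduct.comm ℂ (S.BForm i) (S.BForm i)).toLinearMap).rTensor H ∘ₗ
      (TensorProduct.assoc ℂ (S.BForm i) (S.BForm i) H).symm.toLinearMap ∘ₗ
        (a.rTensor H ∘ₗ Coalgebra.comul).lTensor (S.BForm i)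

/-- The map `id ⊗ ε : Γ(B i) ⊗ H → Γ(B i)`. -/
def evalCounit (i : I) : S.BForm i ⊗[ℂ] H →ₗ[ℂ] S.BForm i :=
  (TensorProduct.rid ℂ (S.BForm i)).toLinearMap ∘ₗ
    (Coalgebra.counit : H →ₗ[ℂ] ℂ).lTensor (S.BForm i)

/-- `A i (h) = -(id ⊗ ε)(D i (1 ⊗ h))`, where `D i` is the map with `D i ∘ χ i = χ i ∘ D`. -/
def IsFamilyOf (D : S.hor →ₗ[ℂ] S.hor) (A : S.LocalFamily) : Prop :=
  ∀ i (h : H) (α : S.hor) (y : S.BForm i ⊗[ℂ] H),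
    S.horProj i α = S.hIncl i (1 ⊗ₜ h) → S.horProj i (D α) = S.hIncl i y →
      S.formOf A i h = -S.evalCounit i y

/-- `χ i ∘ D = D i ∘ χ i` on horizontal forms, for given maps `D i` of `Γ(B i) ⊗ H`. -/
def IsGluedFrom (D : S.hor →ₗ[ℂ] S.hor)
    (Dloc : ∀ i, S.BForm i ⊗[ℂ] H →ₗ[ℂ] S.BForm i ⊗[ℂ] H) : Prop :=
  ∀ i (α : S.hor) (x : S.BForm i ⊗[ℂ] H),
    S.horProj i α = S.hIncl i x → S.horProj i (D α) = S.hIncl i (Dloc i x)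

end DiffStructure

end Bundles

end QuantumBundle

end

noncomputable section

namespace QuantumBundle

universe u v v' w uH uB uP

/-! ### Parity and the Leibniz rule -/

/-! A horizontal form is a family of elements x_i of Γ(B_i) ⊗ H whose classes agree in the overlap
calculi `Q i j`, and every element of Γ(B_i) ⊗ H occurs as a component of such a form
(`exists_of_comp`, `comp_surjective`). As D preserves the kernels of the component maps, it amounts
to a family of maps D_i compatible on the overlaps. The axioms fix the shape of D_i: the Leibniz
rule, applied to global lifts of γ and of 1 ⊗ h, reduces D_i to its values on 1 ⊗ h, and covariance
together with the counit axiom gives D_i(1 ⊗ h) = -∑ A_i(h₁) ⊗ h₂ with A_i of degree one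
(`exists_local`). It remains to see that the D_i are compatible exactly when the A_i obey the gauge
rule.

Let w_i, w_j : H → `Q i j` send h to the class of 1 ⊗ h in the two charts (`fibreLeft`,
`fibreRight`). They are algebra homomorphisms, so w_i ∘ S and w_j ∘ S are convolution right
inverses, and w_i = τ_ij * w_j, w_j = τ_ji * w_i (`fibreLeft_eq`, `fibreRight_eq`). Hence τ_ij and
τ_ji are convolution inverse, and τ_ij = w_i * (w_j ∘ S) commutes with Γ_m(B_ij), because w_i and
w_j do. Comparing D_i and D_j on 1 ⊗ h gives A_i * w_i = τ_ij * A_j * w_j - dτ_ij * w_j. Cancelling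
w_i and using -dτ_ij * τ_ji = τ_ij * dτ_ji turns this into the gauge rule (`gauge_iff`).

Conversely, this identity must give compatibility for all x, y with the same class. The point is
that the class of y determines the image of y in Γ_m(B_ij) ⊗ H: the coaction descends to the
overlap, and multiplying its legs by w_j ∘ S strips off w_j (`changeChart_eq`). So the class of D_j
y can be computed from x. In the right-handed case the commutation of τ_ij with forms also enters.

The relation w_i = τ_ij * w_j rests on a fact about the bundle: χ_i p = 0 forces χ_j p to vanish
over B_ij (`χRestrict_eq_zero`). The antipode reduces this to p coinvariant in charts i and j. Such
a p is corrected, one chart after another, to an element that is coinvariant in all the finitely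
many charts, hence comes from B (`exists_base_lift`), and there the claim is membership in J_i +
J_j. -/

/-- A linear map preserving `1` and compatible with left multiplication by generators is
multiplicative. -/
theorem map_mul_of_generators {A C : Type*} [Ring A] [Algebra ℂ A] [Ring C] [Algebra ℂ C]
    (T : A →ₗ[ℂ] C) {s : Set A} (hs : Algebra.adjoin ℂ s = ⊤) (h1 : T 1 = 1)
    (h : ∀ g ∈ s, ∀ y, T (g * y) = T g * T y) (x y : A) : T (x * y) = T x * T y := by
  have hx : x ∈ Algebra.adjoin ℂ s := hs ▸ trivial
  induction hx using Algebra.adjoin_induction generalizing y with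
  | mem g hg => exact h g hg y
  | algebraMap r => rw [Algebra.algebraMap_eq_smul_one]; simp [h1]
  | add a b _ _ ha hb => simp [add_mul, ha, hb]
  | mul a b _ _ ha hb => rw [mul_assoc, ha, hb, ha, mul_assoc]

/-- A twisted Leibniz rule may be checked on generators for the first factor. -/
theorem leibniz_of_generators {A : Type*} [Ring A] [Algebra ℂ A]
    (P d : A →ₗ[ℂ] A) (hP1 : P 1 = 1) (hP : ∀ x y, P (x * y) = P x * P y) {s : Set A}
    (hs : Algebra.adjoin ℂ s = ⊤) (h1 : d 1 = 0)
    (h : ∀ g ∈ s, ∀ y, d (g * y) = d g * y + P g * d y) (x y : A) :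
    d (x * y) = d x * y + P x * d y := by
  have hx : x ∈ Algebra.adjoin ℂ s := hs ▸ trivial
  induction hx using Algebra.adjoin_induction generalizing y with
  | mem g hg => exact h g hg y
  | algebraMap r => rw [Algebra.algebraMap_eq_smul_one]; simp [h1, hP1]
  | add a b _ _ ha hb => rw [add_mul, map_add, ha, hb, map_add, map_add, add_mul, add_mul]; abel
  | mul a b _ _ ha hb =>
    rw [mul_assoc, ha, hb, ha b, hP]
    simp only [mul_add, add_mul, mul_assoc, add_assoc]

namespace DiffCalculus

variable {A : Type u} [Ring A] [Algebra ℂ A] (Γ : DiffCalculus.{u, v} A)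

theorem one_mem : (1 : Γ.Form) ∈ Γ.gr 0 := by
  rw [← map_one Γ.emb]; exact Γ.emb_mem 1

theorem parity_emb (a : A) : Γ.parity (Γ.emb a) = Γ.emb a := by
  rw [Γ.parity_apply (Γ.emb_mem a), pow_zero, one_smul]

theorem parity_d_emb (a : A) : Γ.parity (Γ.d (Γ.emb a)) = -Γ.d (Γ.emb a) := by
  rw [Γ.parity_apply (Γ.d_mem (Γ.emb_mem a))]; simp

theorem parity_one : Γ.parity 1 = 1 := by
  rw [Γ.parity_apply Γ.one_mem, pow_zero, one_smul]

theorem parity_mem {n : ℕ} {x : Γ.Form} (hx : x ∈ Γ.gr n) : Γ.parity x ∈ Γ.gr n := by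
  rw [Γ.parity_apply hx]; exact Submodule.smul_mem _ _ hx

theorem d_parity (x : Γ.Form) : Γ.d (Γ.parity x) = -Γ.parity (Γ.d x) := by
  induction x using DirectSum.Decomposition.inductionOn Γ.gr with
  | zero => simp
  | homogeneous m =>
    rw [Γ.parity_apply m.2, map_smul, Γ.parity_apply (Γ.d_mem m.2), pow_succ]; simp
  | add a b ha hb => rw [map_add, map_add, ha, hb, map_add, map_add]; abel

theorem parity_mul (x y : Γ.Form) : Γ.parity (x * y) = Γ.parity x * Γ.parity y := by
  induction x using DirectSum.Decomposition.inductionOn Γ.gr with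
  | zero => simp
  | @homogeneous k a =>
    induction y using DirectSum.Decomposition.inductionOn Γ.gr with
    | zero => simp
    | @homogeneous l b =>
      rw [Γ.parity_apply a.2, Γ.parity_apply b.2, Γ.parity_apply (SetLike.mul_mem_graded a.2 b.2),
        smul_mul_smul_comm, pow_add]
    | add a b ha hb => rw [mul_add, map_add, ha, hb, map_add, mul_add]
  | add a b ha hb => rw [add_mul, map_add, ha, hb, map_add, add_mul]

/-- Encoding the sign (-1)ⁿ in the linear operator `parity` removes the homogeneity hypothesis, so
that the Leibniz rule can be used inside tensors and convolutions. -/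
theorem d_mul (x y : Γ.Form) : Γ.d (x * y) = Γ.d x * y + Γ.parity x * Γ.d y := by
  induction x using DirectSum.Decomposition.inductionOn Γ.gr with
  | zero => simp
  | homogeneous a => rw [Γ.leibniz a.2, Γ.parity_apply a.2, smul_mul_assoc]
  | add a b ha hb => rw [add_mul, map_add, ha, hb, map_add, map_add, add_mul, add_mul]; abel

end DiffCalculus

/-! ### Products and operators on the skew tensor product -/

section Skew

open GradedTensorProduct

variable {A : Type u} [Ring A] [Algebra ℂ A] (Γ : DiffCalculus.{u, v} A)
variable {H : Type uH} [Ring H]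

section Plain

variable [Algebra ℂ H] (Θ : DiffCalculus.{uH, v'} H)

theorem skew_induction {p : Skew Γ Θ → Prop} (h0 : p 0) (ht : ∀ γ ρ, p (γ ᵍ⊗ₜ[ℂ] ρ))
    (ha : ∀ x y, p x → p y → p (x + y)) (x : Skew Γ Θ) : p x := by
  obtain ⟨t, rfl⟩ := (of ℂ Γ.gr Θ.gr).surjective x
  induction t using TensorProduct.induction_on with
  | zero => simpa using h0
  | tmul γ ρ => exact ht γ ρ
  | add a b ha' hb' => rw [map_add]; exact ha _ _ ha' hb'

/-- The generators `γ ⊗ 1`, `1 ⊗ h` and `1 ⊗ dh` of the skew tensor product. -/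
def skewGenerators : Set (Skew Γ Θ) :=
  Set.range (includeLeft Γ.gr Θ.gr) ∪
    (Set.range (fun h => includeRight Γ.gr Θ.gr (Θ.emb h)) ∪
      Set.range fun h => includeRight Γ.gr Θ.gr (Θ.d (Θ.emb h)))

theorem adjoin_skewGenerators : Algebra.adjoin ℂ (skewGenerators Γ Θ) = ⊤ := by
  set S := Algebra.adjoin ℂ (skewGenerators Γ Θ) with hS
  have hR : ∀ ρ : Θ.Form, includeRight Γ.gr Θ.gr ρ ∈ S := by
    have : (⊤ : Subalgebra ℂ Θ.Form) ≤ S.comap (includeRight Γ.gr Θ.gr) := by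
      rw [← Θ.generated]
      refine Algebra.adjoin_le ?_
      rintro _ (⟨a, rfl⟩ | ⟨a, rfl⟩)
      · exact Algebra.subset_adjoin (Or.inr (Or.inl ⟨a, rfl⟩))
      · exact Algebra.subset_adjoin (Or.inr (Or.inr ⟨a, rfl⟩))
    exact fun ρ => this trivial
  refine eq_top_iff.2 fun x _ => ?_
  induction x using skew_induction with
  | h0 => exact S.zero_mem
  | ht γ ρ =>
    have h := S.mul_mem (Algebra.subset_adjoin (Or.inl ⟨γ, rfl⟩)) (hR ρ)
    rwa [includeLeft_apply, includeRight_apply, tmul_one_mul_one_tmul] at h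
  | ha x y hx hy => exact S.add_mem (hx trivial) (hy trivial)

theorem includeLeft_mul_tmul (γ ω : Γ.Form) (τ : Θ.Form) :
    includeLeft Γ.gr Θ.gr γ * ω ᵍ⊗ₜ[ℂ] τ = (γ * ω) ᵍ⊗ₜ[ℂ] τ := by
  rw [← tmul_one_mul_one_tmul, ← mul_assoc, ← includeLeft_apply, ← map_mul, includeLeft_apply,
    tmul_one_mul_one_tmul]

theorem includeRight_emb_mul_tmul (h : H) (ω : Γ.Form) (τ : Θ.Form) :
    includeRight Γ.gr Θ.gr (Θ.emb h) * ω ᵍ⊗ₜ[ℂ] τ = ω ᵍ⊗ₜ[ℂ] (Θ.emb h * τ) := by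
  rw [← tmul_one_mul_one_tmul Γ.gr Θ.gr ω τ, ← mul_assoc, ← includeLeft_apply,
    ← (commute_horizontal Γ Θ ω h).eq, mul_assoc, ← includeRight_apply, ← map_mul,
    includeLeft_apply, includeRight_apply, tmul_one_mul_one_tmul]

/-- Passing a fibre one-form across ω costs (-1) to the degree of ω. This is the only sign of the
skew product that has to be known, since the generators have fibre degree at most one. -/
theorem includeRight_one_mul_tmul {ρ : Θ.Form} (hρ : ρ ∈ Θ.gr 1) (ω : Γ.Form) (τ : Θ.Form) :
    includeRight Γ.gr Θ.gr ρ * ω ᵍ⊗ₜ[ℂ] τ = Γ.parity ω ᵍ⊗ₜ[ℂ] (ρ * τ) := by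
  rw [includeRight_apply]
  induction ω using DirectSum.Decomposition.inductionOn Γ.gr with
  | zero => simp [tmul]
  | @homogeneous k m =>
    have := tmul_coe_mul_coe_tmul (R := ℂ) Γ.gr Θ.gr 1 ⟨ρ, hρ⟩ m τ
    rw [this, Γ.parity_apply m.2, one_mul, one_mul]
    -- One sign is a unit of ℤ, the other a complex number; they are compared according to the
    -- parity of k.
    rcases Nat.even_or_odd k with hk | hk
    · rw [hk.neg_one_pow, hk.neg_one_pow]; simp
    · rw [hk.neg_one_pow, hk.neg_one_pow]; simp [tmul, TensorProduct.neg_tmul]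
  | add a b ha hb =>
    simp only [tmul, map_add, TensorProduct.add_tmul, mul_add] at ha hb ⊢
    rw [ha, hb]

/-- The linear map which is multiplication by `(-1)ⁿ` in total degree `n`. -/
def skewParity : Skew Γ Θ →ₗ[ℂ] Skew Γ Θ :=
  (of ℂ Γ.gr Θ.gr).toLinearMap ∘ₗ TensorProduct.map Γ.parity Θ.parity ∘ₗ
      (of ℂ Γ.gr Θ.gr).symm.toLinearMap

theorem skewParity_tmul (γ : Γ.Form) (ρ : Θ.Form) :
    skewParity Γ Θ (γ ᵍ⊗ₜ[ℂ] ρ) = Γ.parity γ ᵍ⊗ₜ[ℂ] Θ.parity ρ := rfl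

theorem skewD_tmul (γ : Γ.Form) (ρ : Θ.Form) :
    skewD Γ Θ (γ ᵍ⊗ₜ[ℂ] ρ) = Γ.d γ ᵍ⊗ₜ[ℂ] ρ + Γ.parity γ ᵍ⊗ₜ[ℂ] Θ.d ρ := rfl

theorem skewParity_one : skewParity Γ Θ 1 = 1 := by
  have : (1 : Skew Γ Θ) = 1 ᵍ⊗ₜ[ℂ] 1 := rfl
  rw [this, skewParity_tmul, Γ.parity_one, Θ.parity_one]

theorem neg_gtmul (γ : Γ.Form) (ρ : Θ.Form) : (-γ) ᵍ⊗ₜ[ℂ] ρ = -(γ ᵍ⊗ₜ[ℂ] ρ : Skew Γ Θ) := by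
  simp [tmul, TensorProduct.neg_tmul]

theorem gtmul_neg (γ : Γ.Form) (ρ : Θ.Form) : γ ᵍ⊗ₜ[ℂ] (-ρ) = -(γ ᵍ⊗ₜ[ℂ] ρ : Skew Γ Θ) := by
  simp [tmul, TensorProduct.tmul_neg]

theorem add_gtmul (γ γ' : Γ.Form) (ρ : Θ.Form) :
    (γ + γ') ᵍ⊗ₜ[ℂ] ρ = (γ ᵍ⊗ₜ[ℂ] ρ + γ' ᵍ⊗ₜ[ℂ] ρ : Skew Γ Θ) := by
  simp [tmul, TensorProduct.add_tmul]

theorem gtmul_add (γ : Γ.Form) (ρ ρ' : Θ.Form) :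
    γ ᵍ⊗ₜ[ℂ] (ρ + ρ') = (γ ᵍ⊗ₜ[ℂ] ρ + γ ᵍ⊗ₜ[ℂ] ρ' : Skew Γ Θ) := by
  simp [tmul, TensorProduct.tmul_add]

theorem skewParity_mul (x y : Skew Γ Θ) :
    skewParity Γ Θ (x * y) = skewParity Γ Θ x * skewParity Γ Θ y := by
  refine map_mul_of_generators _ (adjoin_skewGenerators Γ Θ) (skewParity_one Γ Θ) ?_ x y
  rintro _ (⟨γ, rfl⟩ | ⟨h, rfl⟩ | ⟨h, rfl⟩) y <;> try dsimp only
  · have : skewParity Γ Θ (includeLeft Γ.gr Θ.gr γ) = includeLeft Γ.gr Θ.gr (Γ.parity γ) := by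
      rw [includeLeft_apply, skewParity_tmul, Θ.parity_one, includeLeft_apply]
    rw [this]
    induction y using skew_induction with
    | h0 => simp
    | ht ω τ =>
      rw [includeLeft_mul_tmul, skewParity_tmul, skewParity_tmul, includeLeft_mul_tmul,
        Γ.parity_mul]
    | ha x y hx hy => rw [mul_add, map_add, hx, hy, map_add, mul_add]
  · have : skewParity Γ Θ (includeRight Γ.gr Θ.gr (Θ.emb h)) =
        includeRight Γ.gr Θ.gr (Θ.emb h) := by
      rw [includeRight_apply, skewParity_tmul, Γ.parity_one, Θ.parity_emb]
    rw [this]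
    induction y using skew_induction with
    | h0 => simp
    | ht ω τ =>
      rw [includeRight_emb_mul_tmul, skewParity_tmul, skewParity_tmul, includeRight_emb_mul_tmul,
        Θ.parity_mul, Θ.parity_emb]
    | ha x y hx hy => rw [mul_add, map_add, hx, hy, map_add, mul_add]
  · have : skewParity Γ Θ (includeRight Γ.gr Θ.gr (Θ.d (Θ.emb h))) =
        -includeRight Γ.gr Θ.gr (Θ.d (Θ.emb h)) := by
      rw [includeRight_apply, skewParity_tmul, Γ.parity_one, Θ.parity_d_emb, gtmul_neg]
    have h1 := Θ.d_mem (Θ.emb_mem h)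
    rw [this]
    induction y using skew_induction with
    | h0 => simp
    | ht ω τ =>
      rw [includeRight_one_mul_tmul Γ Θ h1, skewParity_tmul, skewParity_tmul, neg_mul,
        includeRight_one_mul_tmul Γ Θ h1, Θ.parity_mul, Θ.parity_d_emb, neg_mul, gtmul_neg]
    | ha x y hx hy => rw [mul_add, map_add, hx, hy, map_add, mul_add]

theorem skewD_one : skewD Γ Θ 1 = 0 := by
  have : (1 : Skew Γ Θ) = 1 ᵍ⊗ₜ[ℂ] 1 := rfl
  rw [this, skewD_tmul_one, Γ.d_one]; simp

/-- It suffices to take the left factor among γ ⊗ 1, 1 ⊗ h and 1 ⊗ dh. In the last case the signs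
match because d anticommutes with parity and d² = 0. -/
theorem skewD_mul (x y : Skew Γ Θ) :
    skewD Γ Θ (x * y) = skewD Γ Θ x * y + skewParity Γ Θ x * skewD Γ Θ y := by
  refine leibniz_of_generators _ _ (skewParity_one Γ Θ) (skewParity_mul Γ Θ)
    (adjoin_skewGenerators Γ Θ) (skewD_one Γ Θ) ?_ x y
  rintro _ (⟨γ, rfl⟩ | ⟨h, rfl⟩ | ⟨h, rfl⟩) y <;> try dsimp only
  · have h1 : skewParity Γ Θ (includeLeft Γ.gr Θ.gr γ) = includeLeft Γ.gr Θ.gr (Γ.parity γ) := by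
      rw [includeLeft_apply, skewParity_tmul, Θ.parity_one, includeLeft_apply]
    have h2 : skewD Γ Θ (includeLeft Γ.gr Θ.gr γ) = includeLeft Γ.gr Θ.gr (Γ.d γ) := by
      rw [includeLeft_apply, skewD_tmul_one, includeLeft_apply]
    rw [h1, h2]
    induction y using skew_induction with
    | h0 => simp
    | ht ω τ =>
      simp only [includeLeft_mul_tmul, skewD_tmul, mul_add, Γ.d_mul, Γ.parity_mul, add_gtmul,
        add_assoc]
    | ha x y hx hy => rw [mul_add, map_add, hx, hy, map_add, mul_add, mul_add]; abel
  · have h1 : skewParity Γ Θ (includeRight Γ.gr Θ.gr (Θ.emb h)) =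
        includeRight Γ.gr Θ.gr (Θ.emb h) := by
      rw [includeRight_apply, skewParity_tmul, Γ.parity_one, Θ.parity_emb]
    have h2 : skewD Γ Θ (includeRight Γ.gr Θ.gr (Θ.emb h)) =
        includeRight Γ.gr Θ.gr (Θ.d (Θ.emb h)) := by
      rw [includeRight_apply, skewD_one_tmul, includeRight_apply]
    rw [h1, h2]
    induction y using skew_induction with
    | h0 => simp
    | ht ω τ =>
      rw [includeRight_emb_mul_tmul, skewD_tmul, skewD_tmul, mul_add, includeRight_emb_mul_tmul,
        includeRight_emb_mul_tmul, includeRight_one_mul_tmul Γ Θ (Θ.d_mem (Θ.emb_mem h)),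
        Θ.d_mul, Θ.parity_emb, gtmul_add]
      abel
    | ha x y hx hy => rw [mul_add, map_add, hx, hy, map_add, mul_add, mul_add]; abel
  · have h0 := Θ.d_mem (Θ.emb_mem h)
    have h1 : skewParity Γ Θ (includeRight Γ.gr Θ.gr (Θ.d (Θ.emb h))) =
        -includeRight Γ.gr Θ.gr (Θ.d (Θ.emb h)) := by
      rw [includeRight_apply, skewParity_tmul, Γ.parity_one, Θ.parity_d_emb, gtmul_neg]
    have h2 : skewD Γ Θ (includeRight Γ.gr Θ.gr (Θ.d (Θ.emb h))) = 0 := by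
      rw [includeRight_apply, skewD_one_tmul, Θ.d_d]; simp
    rw [h1, h2]
    induction y using skew_induction with
    | h0 => simp
    | ht ω τ =>
      rw [includeRight_one_mul_tmul Γ Θ h0, skewD_tmul, skewD_tmul, mul_add, neg_mul, neg_mul,
        includeRight_one_mul_tmul Γ Θ h0, includeRight_one_mul_tmul Γ Θ h0, Γ.d_parity,
        Θ.d_mul, Θ.d_d, Θ.parity_d_emb, zero_mul, zero_add, neg_mul, gtmul_neg, neg_gtmul,
        zero_mul, zero_add]
    | ha x y hx hy => rw [mul_add, map_add, hx, hy, map_add, mul_add, mul_add]; abel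

theorem skewD_skewD (x : Skew Γ Θ) : skewD Γ Θ (skewD Γ Θ x) = 0 := by
  induction x using skew_induction with
  | h0 => simp
  | ht ω τ =>
    rw [skewD_tmul, map_add, skewD_tmul, skewD_tmul, Γ.d_parity, Γ.d_d, Θ.d_d, neg_gtmul]
    simp [tmul]
  | ha x y hx hy => rw [map_add, map_add, hx, hy, add_zero]

theorem skewParity_skewD (x : Skew Γ Θ) :
    skewParity Γ Θ (skewD Γ Θ x) = -skewD Γ Θ (skewParity Γ Θ x) := by
  induction x using skew_induction with
  | h0 => simp
  | ht ω τ =>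
    rw [skewD_tmul, map_add, skewParity_tmul, skewParity_tmul, skewParity_tmul, skewD_tmul,
      Γ.d_parity, Θ.d_parity, neg_gtmul, gtmul_neg]
    abel
  | ha x y hx hy => rw [map_add, map_add, hx, hy, map_add, map_add]; abel

theorem skewParity_zeroIncl (x : A ⊗[ℂ] H) :
    skewParity Γ Θ (zeroIncl Γ Θ x) = zeroIncl Γ Θ x := by
  induction x using TensorProduct.induction_on with
  | zero => simp
  | tmul a h => rw [zeroIncl_tmul, skewParity_tmul, Γ.parity_emb, Θ.parity_emb]
  | add x y hx hy => rw [map_add, map_add, hx, hy]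

/-- H embeds in its forms and tensoring over a field preserves injectivity; so a horizontal form has
a unique representative in Γ ⊗ H. -/
theorem horIncl_injective : Function.Injective (horIncl Γ Θ) := by
  have h : (horIncl Γ Θ).toLinearMap =
      (of ℂ Γ.gr Θ.gr).toLinearMap ∘ₗ Θ.emb.toLinearMap.lTensor Γ.Form :=
    TensorProduct.ext' fun γ h => horIncl_tmul Γ Θ γ h
  intro x y hxy
  have h1 : (horIncl Γ Θ).toLinearMap x = (horIncl Γ Θ).toLinearMap y := hxy
  rw [h] at h1
  exact Module.Flat.lTensor_preserves_injective_linearMap (M := Γ.Form) Θ.emb.toLinearMap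
    Θ.emb_injective ((of ℂ Γ.gr Θ.gr).injective h1)

end Plain

/-! ### The coaction on the skew tensor product -/

variable [HopfAlgebra ℂ H] (Θ : RightCovariantCalculus.{uH, v'} H)

/-- The coaction `id ⊗ Δ` on the skew tensor product. -/
def skewCoaction : Skew Γ Θ.toDiffCalculus →ₗ[ℂ] Skew Γ Θ.toDiffCalculus ⊗[ℂ] H :=
  (of ℂ Γ.gr Θ.gr).toLinearMap.rTensor H ∘ₗ
    (TensorProduct.assoc ℂ Γ.Form Θ.Form H).symm.toLinearMap ∘ₗ
      Θ.coaction.toLinearMap.lTensor Γ.Form ∘ₗ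
        (of ℂ Γ.gr Θ.gr).symm.toLinearMap

/-- The map `ρ ⊗ h ↦ (γ ⊗ ρ) ⊗ h`. -/
def tmulRight (γ : Γ.Form) : Θ.Form ⊗[ℂ] H →ₗ[ℂ] Skew Γ Θ.toDiffCalculus ⊗[ℂ] H :=
  ((of ℂ Γ.gr Θ.gr).toLinearMap ∘ₗ TensorProduct.mk ℂ Γ.Form Θ.Form γ).rTensor H

theorem tmulRight_tmul (γ : Γ.Form) (ρ : Θ.Form) (h : H) :
    tmulRight Γ Θ γ (ρ ⊗ₜ h) = (γ ᵍ⊗ₜ[ℂ] ρ) ⊗ₜ h := rfl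

theorem skewCoaction_tmul (γ : Γ.Form) (ρ : Θ.Form) :
    skewCoaction Γ Θ (γ ᵍ⊗ₜ[ℂ] ρ) = tmulRight Γ Θ γ (Θ.coaction ρ) := by
  have : ∀ t : Θ.Form ⊗[ℂ] H, (of ℂ Γ.gr Θ.gr).toLinearMap.rTensor H
      ((TensorProduct.assoc ℂ Γ.Form Θ.Form H).symm (γ ⊗ₜ t)) = tmulRight Γ Θ γ t := by
    intro t
    induction t using TensorProduct.induction_on with
    | zero => simp
    | tmul ρ h => rfl
    | add x y hx hy => rw [TensorProduct.tmul_add, map_add, map_add, hx, hy, map_add]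
  exact this _

theorem skewCoaction_one : skewCoaction Γ Θ 1 = 1 := by
  have : (1 : Skew Γ Θ.toDiffCalculus) = 1 ᵍ⊗ₜ[ℂ] 1 := rfl
  rw [this, skewCoaction_tmul, map_one, Algebra.TensorProduct.one_def, tmulRight_tmul]
  rfl

/-- The coaction sends h and dh to sums of h₁ ⊗ h₂ and dh₁ ⊗ h₂, so it keeps the fibre degree of
each generator and with it the sign in the skew product. -/
theorem skewCoaction_mul (x y : Skew Γ Θ.toDiffCalculus) :
    skewCoaction Γ Θ (x * y) = skewCoaction Γ Θ x * skewCoaction Γ Θ y := by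
  refine map_mul_of_generators _ (adjoin_skewGenerators Γ Θ.toDiffCalculus)
    (skewCoaction_one Γ Θ) ?_ x y
  intro g hg y
  induction y using skew_induction with
  | h0 => simp
  | ha x y hx hy => rw [mul_add, map_add, hx, hy, map_add, mul_add]
  | ht ω τ => ?_
  obtain (⟨γ, rfl⟩ | ⟨h, rfl⟩ | ⟨h, rfl⟩) := hg <;> try dsimp only
  · rw [includeLeft_mul_tmul, skewCoaction_tmul, skewCoaction_tmul, includeLeft_apply,
      skewCoaction_tmul, map_one, Algebra.TensorProduct.one_def, tmulRight_tmul]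
    generalize Θ.coaction τ = t
    induction t using TensorProduct.induction_on with
    | zero => simp
    | tmul ρ h =>
      rw [tmulRight_tmul, tmulRight_tmul, Algebra.TensorProduct.tmul_mul_tmul, one_mul,
        ← includeLeft_apply, includeLeft_mul_tmul]
    | add x y hx hy => rw [map_add, hx, hy, map_add, mul_add]
  · rw [includeRight_emb_mul_tmul, skewCoaction_tmul, skewCoaction_tmul, includeRight_apply,
      skewCoaction_tmul, map_mul, Θ.coaction_emb]
    generalize Θ.coaction τ = t
    generalize (Coalgebra.comul h : H ⊗[ℂ] H) = s
    induction t using TensorProduct.induction_on with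
    | zero => simp
    | tmul ρ k =>
      induction s using TensorProduct.induction_on with
      | zero => simp
      | tmul a b =>
        rw [LinearMap.rTensor_tmul, tmulRight_tmul, tmulRight_tmul,
          Algebra.TensorProduct.tmul_mul_tmul, Algebra.TensorProduct.tmul_mul_tmul, tmulRight_tmul,
          ← includeRight_apply, AlgHom.toLinearMap_apply, includeRight_emb_mul_tmul]
      | add x y hx hy => simp only [map_add, add_mul, hx, hy]
    | add x y hx hy => rw [map_add, mul_add, map_add, hx, hy, mul_add]
  · rw [includeRight_one_mul_tmul Γ Θ.toDiffCalculus (Θ.d_mem (Θ.emb_mem h)), skewCoaction_tmul,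
      skewCoaction_tmul, includeRight_apply, skewCoaction_tmul, map_mul, Θ.coaction_d]
    generalize Θ.coaction τ = t
    generalize (Coalgebra.comul h : H ⊗[ℂ] H) = s
    induction t using TensorProduct.induction_on with
    | zero => simp
    | tmul ρ k =>
      induction s using TensorProduct.induction_on with
      | zero => simp
      | tmul a b =>
        rw [LinearMap.rTensor_tmul, tmulRight_tmul, tmulRight_tmul,
          Algebra.TensorProduct.tmul_mul_tmul, Algebra.TensorProduct.tmul_mul_tmul, tmulRight_tmul,
          ← includeRight_apply, LinearMap.comp_apply, AlgHom.toLinearMap_apply,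
          includeRight_one_mul_tmul Γ Θ.toDiffCalculus (Θ.d_mem (Θ.emb_mem a))]
      | add x y hx hy => simp only [map_add, add_mul, hx, hy]
    | add x y hx hy => rw [map_add, mul_add, map_add, hx, hy, mul_add]

theorem skewCoaction_horIncl (γ : Γ.Form) (h : H) :
    skewCoaction Γ Θ (horIncl Γ Θ.toDiffCalculus (γ ⊗ₜ h)) =
      (((horIncl Γ Θ.toDiffCalculus).toLinearMap ∘ₗ TensorProduct.mk ℂ Γ.Form H γ).rTensor H)
        (Coalgebra.comul h) := by
  rw [horIncl_tmul, skewCoaction_tmul, Θ.coaction_emb]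
  generalize (Coalgebra.comul h : H ⊗[ℂ] H) = s
  induction s using TensorProduct.induction_on with
  | zero => simp
  | tmul a b =>
    rw [LinearMap.rTensor_tmul, LinearMap.rTensor_tmul, tmulRight_tmul, LinearMap.comp_apply,
      TensorProduct.mk_apply, AlgHom.toLinearMap_apply, AlgHom.toLinearMap_apply, horIncl_tmul]
  | add x y hx hy => rw [map_add, map_add, hx, hy, map_add]

/-- Compatibility of coaction and differential is needed only on elements of degree zero, because
these and their differentials generate the calculus. -/
theorem skewCoaction_skewD_zeroIncl (x : A ⊗[ℂ] H) :
    skewCoaction Γ Θ (skewD Γ Θ.toDiffCalculus (zeroIncl Γ Θ.toDiffCalculus x)) =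
      (skewD Γ Θ.toDiffCalculus).rTensor H
        (skewCoaction Γ Θ (zeroIncl Γ Θ.toDiffCalculus x)) := by
  induction x using TensorProduct.induction_on with
  | zero => simp
  | tmul a h =>
    rw [zeroIncl_tmul, skewD_tmul, map_add, skewCoaction_tmul, skewCoaction_tmul,
      skewCoaction_tmul, Θ.coaction_d, Θ.coaction_emb]
    generalize (Coalgebra.comul h : H ⊗[ℂ] H) = s
    induction s using TensorProduct.induction_on with
    | zero => simp
    | tmul a b =>
      simp only [LinearMap.rTensor_tmul, tmulRight_tmul, skewD_tmul, TensorProduct.add_tmul,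
        LinearMap.comp_apply]
    | add x y hx hy =>
      simp only [map_add]
      rw [← hx, ← hy]; abel
  | add x y hx hy => simp only [map_add, hx, hy]

end Skew

/-! ### Operators on the overlaps -/

/-- A linear map which vanishes on the kernel of a surjective linear map factors through it. -/
theorem exists_factor {M N R : Type*} [AddCommGroup M] [Module ℂ M] [AddCommGroup N] [Module ℂ N]
    [AddCommGroup R] [Module ℂ R] (f : M →ₗ[ℂ] N) (hf : Function.Surjective f) (g : M →ₗ[ℂ] R)
    (h : ∀ x, f x = 0 → g x = 0) : ∃ k : N →ₗ[ℂ] R, ∀ x, k (f x) = g x := by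
  obtain ⟨s, hs⟩ := f.exists_rightInverse_of_surjective (LinearMap.range_eq_top.2 hf)
  refine ⟨g ∘ₗ s, fun x => ?_⟩
  have h1 : f (s (f x) - x) = 0 := by
    rw [map_sub, sub_eq_zero]; exact LinearMap.congr_fun hs (f x)
  have h2 := h _ h1
  rwa [map_sub, sub_eq_zero] at h2

section Adapted

variable {I : Type w} {A : Type u} [Ring A] [Algebra ℂ A] {C : I → Type v}
  [∀ i, Ring (C i)] [∀ i, Algebra ℂ (C i)] {f : ∀ i, A →ₐ[ℂ] C i} {d : ∀ i, C i →ₗ[ℂ] C i}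
  (hs : ∀ i, Function.Surjective (adaptedProj f d i))

/-- Lifts of a and b differ by a sum of an element of the i-th kernel and one of the j-th;
subtracting the first part from the lift of a makes the two lifts coincide. -/
theorem exists_common_lift {i j : I} {a : C i} {b : C j}
    (h : overlapLeft hs i j a = overlapRight hs i j b) :
    ∃ x : adapted f d, adaptedProj f d i x = a ∧ adaptedProj f d j x = b := by
  obtain ⟨x, hx⟩ := hs i a
  obtain ⟨y, hy⟩ := hs j b
  rw [← hx, ← hy, overlapLeft_apply, overlapRight_apply, ← sub_eq_zero, ← map_sub,
    toOverlap_eq_zero_iff] at h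
  obtain ⟨k, l, hk, hl, hkl⟩ := h
  refine ⟨x - k, by rw [map_sub, hk, hx, sub_zero], ?_⟩
  have : x - k = y + l := by rw [sub_eq_iff_eq_add, add_assoc, add_comm l k, hkl]; abel
  rw [this, map_add, hl, hy, add_zero]

theorem overlapLeft_surjective (i j : I) : Function.Surjective (overlapLeft hs i j) := by
  intro q
  obtain ⟨x, rfl⟩ := toOverlap_surjective f d i j q
  exact ⟨_, overlapLeft_apply hs i j x⟩

/-- A componentwise operator that preserves the calculus preserves each kernel, hence their sum, and
so descends to the quotient. -/
theorem exists_overlap_operator (T : ∀ i, C i →ₗ[ℂ] C i)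
    (hT : ∀ x ∈ adapted f d, (fun i => T i (x i)) ∈ adapted f d) (i j : I) :
    ∃ T' : Overlap f d i j →ₗ[ℂ] Overlap f d i j,
      (∀ a, T' (overlapLeft hs i j a) = overlapLeft hs i j (T i a)) ∧
        ∀ b, T' (overlapRight hs i j b) = overlapRight hs i j (T j b) := by
  let TA : adapted f d →ₗ[ℂ] adapted f d :=
    { toFun := fun x => ⟨fun i => T i (x.1 i), hT x.1 x.2⟩
      map_add' := fun x y => Subtype.ext (funext fun i => map_add (T i) (x.1 i) (y.1 i))
      map_smul' := fun c x => Subtype.ext (funext fun i => map_smul (T i) c (x.1 i)) }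
  have hTA : ∀ k x, adaptedProj f d k (TA x) = T k (adaptedProj f d k x) := fun k x => rfl
  obtain ⟨T', hT'⟩ := exists_factor (toOverlap f d i j).toLinearMap
    (toOverlap_surjective f d i j) ((toOverlap f d i j).toLinearMap ∘ₗ TA) (by
      intro x hx
      obtain ⟨a, b, ha, hb, rfl⟩ := (toOverlap_eq_zero_iff f d i j x).1 hx
      refine (toOverlap_eq_zero_iff f d i j _).2 ⟨TA a, TA b, ?_, ?_, (map_add TA a b).symm⟩
      · rw [hTA, ha, map_zero]
      · rw [hTA, hb, map_zero])
  refine ⟨T', fun a => ?_, fun b => ?_⟩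
  · obtain ⟨x, rfl⟩ := hs i a
    rw [overlapLeft_apply, ← hTA, overlapLeft_apply]
    exact hT' x
  · obtain ⟨x, rfl⟩ := hs j b
    rw [overlapRight_apply, ← hTA, overlapRight_apply]
    exact hT' x

end Adapted

/-! ### Parity, differential and coaction on the overlap calculus. -/

section Bundles

variable {H : Type uH} {B : Type uB} {P : Type uP} {I : Type w} [Ring H] [HopfAlgebra ℂ H] [Ring B]
  [Algebra ℂ B] [Ring P] [Algebra ℂ P]

namespace DiffStructure

open GradedTensorProduct

variable {X : Bundle H B P I} (S : DiffStructure.{v, v'} X)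

/-- The parity operator of `Γ(B i) ⊗̂ Γ(H)`. -/
def parE (i : I) : S.E i →ₗ[ℂ] S.E i := skewParity (S.base i) S.fibre.toDiffCalculus

theorem parE_totalMap (i : I) (p : P) : S.parE i (S.totalMap i p) = S.totalMap i p :=
  skewParity_zeroIncl _ _ _

theorem parE_dE (i : I) (x : S.E i) : S.parE i (S.dE i x) = -S.dE i (S.parE i x) :=
  skewParity_skewD _ _ _

theorem parE_mul (i : I) (x y : S.E i) : S.parE i (x * y) = S.parE i x * S.parE i y :=
  skewParity_mul _ _ _ _

theorem dE_mul (i : I) (x y : S.E i) :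
    S.dE i (x * y) = S.dE i x * y + S.parE i x * S.dE i y :=
  skewD_mul _ _ _ _

/-- Both operators are treated in one induction, because the differential of a product involves the
parity of its first factor. -/
theorem ΓP_stable {x : ∀ i, S.E i} (hx : x ∈ S.ΓP) :
    (fun i => S.parE i (x i)) ∈ S.ΓP ∧ (fun i => S.dE i (x i)) ∈ S.ΓP := by
  induction hx using Algebra.adjoin_induction with
  | mem x hx =>
    obtain (⟨p, rfl⟩ | ⟨p, rfl⟩) := hx <;> dsimp only
    · simp only [parE_totalMap]
      exact ⟨(adaptedOf S.totalMap S.dE p).2, (adaptedD S.totalMap S.dE p).2⟩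
    · have h1 : (fun i => S.parE i (S.dE i (S.totalMap i p))) =
          -(adaptedD S.totalMap S.dE p : ∀ i, S.E i) :=
        funext fun i => by rw [parE_dE, parE_totalMap]; rfl
      have h2 : (fun i => S.dE i (S.dE i (S.totalMap i p))) = 0 :=
        funext fun i => skewD_skewD _ _ _
      rw [h1, h2]
      exact ⟨neg_mem (adaptedD S.totalMap S.dE p).2, S.ΓP.zero_mem⟩
  | algebraMap r =>
    have h1 : (fun i => S.parE i (algebraMap ℂ (∀ i, S.E i) r i)) =
        algebraMap ℂ (∀ i, S.E i) r := funext fun i => by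
      rw [Pi.algebraMap_apply, Algebra.algebraMap_eq_smul_one, map_smul]
      exact congrArg _ (skewParity_one _ _)
    have h2 : (fun i => S.dE i (algebraMap ℂ (∀ i, S.E i) r i)) = 0 := funext fun i => by
      rw [Pi.algebraMap_apply, Algebra.algebraMap_eq_smul_one, map_smul]
      exact (congrArg _ (skewD_one _ _)).trans (smul_zero _)
    rw [h1, h2]
    exact ⟨S.ΓP.algebraMap_mem r, S.ΓP.zero_mem⟩
  | add x y _ _ hx hy =>
    simp only [Pi.add_apply, map_add]
    exact ⟨add_mem hx.1 hy.1, add_mem hx.2 hy.2⟩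
  | mul x y hx' hy' hx hy =>
    simp only [Pi.mul_apply, parE_mul, dE_mul]
    exact ⟨mul_mem hx.1 hy.1, add_mem (mul_mem hx.2 hy') (mul_mem hx.1 hy.2)⟩

/-- The parity operator on the overlap. -/
def parQ (i j : I) : S.Q i j →ₗ[ℂ] S.Q i j :=
  (exists_overlap_operator S.total_surjective S.parE (fun _ hx => (S.ΓP_stable hx).1) i j).choose

theorem parQ_projLeft (i j : I) (a : S.E i) :
    S.parQ i j (S.projLeft i j a) = S.projLeft i j (S.parE i a) :=
  (exists_overlap_operator S.total_surjective S.parE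
    (fun _ hx => (S.ΓP_stable hx).1) i j).choose_spec.1 a

theorem parQ_projRight (i j : I) (b : S.E j) :
    S.parQ i j (S.projRight i j b) = S.projRight i j (S.parE j b) :=
  (exists_overlap_operator S.total_surjective S.parE
    (fun _ hx => (S.ΓP_stable hx).1) i j).choose_spec.2 b

/-- The differential on the overlap. -/
def dQ (i j : I) : S.Q i j →ₗ[ℂ] S.Q i j :=
  (exists_overlap_operator S.total_surjective S.dE (fun _ hx => (S.ΓP_stable hx).2) i j).choose

theorem dQ_projLeft (i j : I) (a : S.E i) :
    S.dQ i j (S.projLeft i j a) = S.projLeft i j (S.dE i a) :=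
  (exists_overlap_operator S.total_surjective S.dE
    (fun _ hx => (S.ΓP_stable hx).2) i j).choose_spec.1 a

theorem dQ_projRight (i j : I) (b : S.E j) :
    S.dQ i j (S.projRight i j b) = S.projRight i j (S.dE j b) :=
  (exists_overlap_operator S.total_surjective S.dE
    (fun _ hx => (S.ΓP_stable hx).2) i j).choose_spec.2 b

theorem projLeft_surjective (i j : I) : Function.Surjective (S.projLeft i j) :=
  overlapLeft_surjective S.total_surjective i j

theorem dQ_mul (i j : I) (x y : S.Q i j) :
    S.dQ i j (x * y) = S.dQ i j x * y + S.parQ i j x * S.dQ i j y := by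
  obtain ⟨a, rfl⟩ := S.projLeft_surjective i j x
  obtain ⟨b, rfl⟩ := S.projLeft_surjective i j y
  rw [← map_mul, dQ_projLeft, dE_mul, map_add, map_mul, map_mul, dQ_projLeft, dQ_projLeft,
    parQ_projLeft]

theorem parQ_mul (i j : I) (x y : S.Q i j) :
    S.parQ i j (x * y) = S.parQ i j x * S.parQ i j y := by
  obtain ⟨a, rfl⟩ := S.projLeft_surjective i j x
  obtain ⟨b, rfl⟩ := S.projLeft_surjective i j y
  rw [← map_mul, parQ_projLeft, parE_mul, map_mul, parQ_projLeft, parQ_projLeft]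

theorem dQ_one (i j : I) : S.dQ i j 1 = 0 := by
  rw [← map_one (S.projLeft i j), dQ_projLeft]
  exact (congrArg _ (skewD_one _ _)).trans (map_zero _)

/-- The coaction on `Γ(B i) ⊗̂ Γ(H)` is multiplicative. -/
def coEHom (i : I) : S.E i →ₐ[ℂ] S.E i ⊗[ℂ] H :=
  AlgHom.ofLinearMap (S.coE i) (skewCoaction_one (S.base i) S.fibre)
    (skewCoaction_mul (S.base i) S.fibre)

theorem coEHom_totalMap (i : I) (p : P) :
    S.coEHom i (S.totalMap i p) = (S.totalMap i).toLinearMap.rTensor H (X.coaction p) := by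
  have h1 : ∀ y : X.Loc i ⊗[ℂ] H, S.coE i (zeroIncl (S.base i) S.fibre.toDiffCalculus y) =
      (zeroIncl (S.base i) S.fibre.toDiffCalculus).toLinearMap.rTensor H
        ((TensorProduct.assoc ℂ (X.Loc i) H H).symm
          ((Coalgebra.comul : H →ₗ[ℂ] H ⊗[ℂ] H).lTensor (X.Loc i) y)) := by
    intro y
    induction y using TensorProduct.induction_on with
    | zero => simp
    | tmul a h =>
      rw [zeroIncl_tmul]
      refine (skewCoaction_tmul (S.base i) S.fibre _ _).trans ?_
      rw [S.fibre.coaction_emb, LinearMap.lTensor_tmul]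
      generalize (Coalgebra.comul h : H ⊗[ℂ] H) = s
      induction s using TensorProduct.induction_on with
      | zero => simp
      | tmul k l =>
        rw [LinearMap.rTensor_tmul, TensorProduct.assoc_symm_tmul, LinearMap.rTensor_tmul,
          tmulRight_tmul, AlgHom.toLinearMap_apply, AlgHom.toLinearMap_apply, zeroIncl_tmul]
      | add x y hx hy => rw [map_add, map_add, hx, hy, TensorProduct.tmul_add, map_add, map_add]
    | add x y hx hy => simp only [map_add, hx, hy]
  refine (h1 (X.χ i p)).trans ?_
  rw [X.χ_colinear i p, LinearEquiv.symm_apply_apply, ← LinearMap.comp_apply,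
    ← LinearMap.rTensor_comp]
  rfl

theorem coEHom_dE_totalMap (i : I) (p : P) :
    S.coEHom i (S.dE i (S.totalMap i p)) =
      (S.dE i ∘ₗ (S.totalMap i).toLinearMap).rTensor H (X.coaction p) := by
  refine (skewCoaction_skewD_zeroIncl (S.base i) S.fibre (X.χ i p)).trans ?_
  rw [LinearMap.rTensor_comp, LinearMap.comp_apply, ← coEHom_totalMap]
  rfl

/-- The coaction descends to the overlaps. -/
theorem coE_overlap {i j : I} {a : S.E i} {b : S.E j}
    (h : S.projLeft i j a = S.projRight i j b) :
    (S.projLeft i j).toLinearMap.rTensor H (S.coE i a) =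
      (S.projRight i j).toLinearMap.rTensor H (S.coE j b) := by
  obtain ⟨⟨x, hx⟩, rfl, rfl⟩ := exists_common_lift S.total_surjective h
  let l : (∀ i, S.E i) →ₐ[ℂ] S.Q i j ⊗[ℂ] H :=
    ((Algebra.TensorProduct.map (S.projLeft i j) (AlgHom.id ℂ H)).comp (S.coEHom i)).comp
      (Pi.evalAlgHom ℂ S.E i)
  let r : (∀ i, S.E i) →ₐ[ℂ] S.Q i j ⊗[ℂ] H :=
    ((Algebra.TensorProduct.map (S.projRight i j) (AlgHom.id ℂ H)).comp (S.coEHom j)).comp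
      (Pi.evalAlgHom ℂ S.E j)
  -- As functions of the common lift both sides are algebra homomorphisms, so it is enough to
  -- compare them on p and dp. There each is the coaction of P followed by a map from P to the
  -- overlap, and this map is the same through either chart.
  have key : S.ΓP ≤ AlgHom.equalizer l r := by
    refine Algebra.adjoin_le ?_
    rintro _ (⟨p, rfl⟩ | ⟨p, rfl⟩)
    · have h1 : (S.projLeft i j).toLinearMap ∘ₗ (S.totalMap i).toLinearMap =
          (S.projRight i j).toLinearMap ∘ₗ (S.totalMap j).toLinearMap :=
        LinearMap.ext fun p => (overlapLeft_apply S.total_surjective i j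
          (adaptedOf S.totalMap S.dE p)).trans (overlapRight_apply S.total_surjective i j
          (adaptedOf S.totalMap S.dE p)).symm
      change (S.projLeft i j).toLinearMap.rTensor H (S.coEHom i (S.totalMap i p)) =
        (S.projRight i j).toLinearMap.rTensor H (S.coEHom j (S.totalMap j p))
      rw [coEHom_totalMap, coEHom_totalMap, ← LinearMap.comp_apply, ← LinearMap.comp_apply,
        ← LinearMap.rTensor_comp, ← LinearMap.rTensor_comp, h1]
    · have h1 : (S.projLeft i j).toLinearMap ∘ₗ S.dE i ∘ₗ (S.totalMap i).toLinearMap =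
          (S.projRight i j).toLinearMap ∘ₗ S.dE j ∘ₗ (S.totalMap j).toLinearMap :=
        LinearMap.ext fun p => (overlapLeft_apply S.total_surjective i j
          (adaptedD S.totalMap S.dE p)).trans (overlapRight_apply S.total_surjective i j
          (adaptedD S.totalMap S.dE p)).symm
      change (S.projLeft i j).toLinearMap.rTensor H (S.coEHom i (S.dE i (S.totalMap i p))) =
        (S.projRight i j).toLinearMap.rTensor H (S.coEHom j (S.dE j (S.totalMap j p)))
      rw [coEHom_dE_totalMap, coEHom_dE_totalMap, ← LinearMap.comp_apply, ← LinearMap.comp_apply,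
        ← LinearMap.rTensor_comp, ← LinearMap.rTensor_comp, h1]
  exact key hx

end DiffStructure

end Bundles

/-! ### Slices of tensors -/

section Slice

variable {H : Type uH} [Ring H] [Algebra ℂ H]
variable {V W : Type*} [AddCommGroup V] [Module ℂ V] [AddCommGroup W] [Module ℂ W]

/-- The map `id ⊗ φ : V ⊗ H → V` for a linear functional `φ` on `H`. -/
def slice (V : Type*) [AddCommGroup V] [Module ℂ V] (φ : H →ₗ[ℂ] ℂ) : V ⊗[ℂ] H →ₗ[ℂ] V :=
  (TensorProduct.rid ℂ V).toLinearMap ∘ₗ φ.lTensor V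

theorem slice_tmul (φ : H →ₗ[ℂ] ℂ) (x : V) (h : H) : slice V φ (x ⊗ₜ h) = φ h • x := rfl

theorem slice_rTensor (φ : H →ₗ[ℂ] ℂ) (f : V →ₗ[ℂ] W) (t : V ⊗[ℂ] H) :
    slice W φ (f.rTensor H t) = f (slice V φ t) := by
  induction t using TensorProduct.induction_on with
  | zero => simp
  | tmul x h => simp [slice_tmul]
  | add x y hx hy => simp only [map_add, hx, hy]

/-- Expand t along a basis of H: the coefficients are the slices by the coordinate functionals. -/
theorem exists_sum_slice (t : V ⊗[ℂ] H) : ∃ (κ : Type uH) (s : Finset κ)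
    (b : κ → H) (φ : κ → H →ₗ[ℂ] ℂ), t = ∑ k ∈ s, slice V (φ k) t ⊗ₜ b k := by
  classical
  let 𝒞 := Module.Basis.ofVectorSpace ℂ H
  refine ⟨_, (TensorProduct.equivFinsuppOfBasisRight 𝒞 t).support, 𝒞, 𝒞.coord, ?_⟩
  apply (TensorProduct.equivFinsuppOfBasisRight 𝒞).injective
  conv_lhs => rw [← (TensorProduct.equivFinsuppOfBasisRight 𝒞).apply_symm_apply
    (TensorProduct.equivFinsuppOfBasisRight 𝒞 t)]
  rw [TensorProduct.equivFinsuppOfBasisRight_symm_apply, Finsupp.sum]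
  simp only [TensorProduct.equivFinsuppOfBasisRight_apply]
  rfl

theorem slice_ext {t t' : V ⊗[ℂ] H} (h : ∀ φ : H →ₗ[ℂ] ℂ, slice V φ t = slice V φ t') :
    t = t' := by
  obtain ⟨κ, s, b, φ, hs⟩ := exists_sum_slice (t - t')
  rw [← sub_eq_zero, hs]
  refine Finset.sum_eq_zero fun k _ => ?_
  rw [map_sub, h, sub_self, TensorProduct.zero_tmul]

end Slice

/-! ### The action of functionals on H. -/

section Hit

variable {H : Type uH} [Ring H] [HopfAlgebra ℂ H]
variable {V W : Type*} [AddCommGroup V] [Module ℂ V] [AddCommGroup W] [Module ℂ W]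

/-- The map `h ↦ ∑ φ(h₂) h₁`. -/
def hit (φ : H →ₗ[ℂ] ℂ) : H →ₗ[ℂ] H := slice H φ ∘ₗ Coalgebra.comul

theorem slice_assoc_symm_lTensor_comul (φ : H →ₗ[ℂ] ℂ) (y : V ⊗[ℂ] H) :
    slice (V ⊗[ℂ] H) φ ((TensorProduct.assoc ℂ V H H).symm
      ((Coalgebra.comul : H →ₗ[ℂ] H ⊗[ℂ] H).lTensor V y)) = (hit φ).lTensor V y := by
  induction y using TensorProduct.induction_on with
  | zero => simp
  | tmul x h =>
    rw [LinearMap.lTensor_tmul, LinearMap.lTensor_tmul, hit, LinearMap.comp_apply]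
    generalize (Coalgebra.comul h : H ⊗[ℂ] H) = s
    induction s using TensorProduct.induction_on with
    | zero => simp
    | tmul k l =>
      rw [TensorProduct.assoc_symm_tmul, slice_tmul, slice_tmul, TensorProduct.tmul_smul]
    | add x y hx hy => simp only [TensorProduct.tmul_add, map_add, hx, hy]
  | add x y hx hy => simp only [map_add, hx, hy]

theorem counit_hit (φ : H →ₗ[ℂ] ℂ) (h : H) : Coalgebra.counit (R := ℂ) (hit φ h) = φ h := by
  rw [hit, LinearMap.comp_apply, ← slice_rTensor, Coalgebra.rTensor_counit_comul, slice_tmul]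
  simp

/-- Acting by φ and then applying the counit recovers the slice by φ. So for subspaces stable under
this action, the counit slice carries all the information. -/
theorem slice_counit_hit (φ : H →ₗ[ℂ] ℂ) (y : V ⊗[ℂ] H) :
    slice V Coalgebra.counit ((hit φ).lTensor V y) = slice V φ y := by
  induction y using TensorProduct.induction_on with
  | zero => simp
  | tmul x h => rw [LinearMap.lTensor_tmul, slice_tmul, slice_tmul, counit_hit]
  | add x y hx hy => simp only [map_add, hx, hy]

end Hit

/-! ### Transition functions -/

section Bundles

variable {H : Type uH} {B : Type uB} {P : Type uP} {I : Type w} [Ring H] [HopfAlgebra ℂ H] [Ring B]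
  [Algebra ℂ B] [Ring P] [Algebra ℂ P]

namespace Bundle

variable (X : Bundle H B P I)

/-- The action of a functional `φ` on `P`, `p ↦ ∑ φ(p₁) p₀`. -/
def act (φ : H →ₗ[ℂ] ℂ) : P →ₗ[ℂ] P := slice P φ ∘ₗ X.coaction.toLinearMap

theorem χ_act (k : I) (φ : H →ₗ[ℂ] ℂ) (p : P) :
    X.χ k (X.act φ p) = (hit φ).lTensor (X.Loc k) (X.χ k p) := by
  rw [← slice_assoc_symm_lTensor_comul, X.χ_colinear k p, LinearEquiv.symm_apply_apply,
    slice_rTensor]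
  rfl

theorem slice_counit_χ_act (k : I) (φ : H →ₗ[ℂ] ℂ) (p : P) :
    slice _ Coalgebra.counit (X.χ k (X.act φ p)) = slice _ φ (X.χ k p) := by
  rw [χ_act, slice_counit_hit]

theorem χ_act_eq_zero {k : I} (φ : H →ₗ[ℂ] ℂ) {p : P} (hp : X.χ k p = 0) :
    X.χ k (X.act φ p) = 0 := by
  rw [χ_act, hp, map_zero]

/-- The elements of `P` which vanish in the local trivializations over `T`. -/
def vanish (T : Set I) : Submodule ℂ P where
  carrier := {p | ∀ l ∈ T, X.χ l p = 0}
  add_mem' hp hq l hl := by rw [map_add, hp l hl, hq l hl, add_zero]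
  zero_mem' l _ := map_zero _
  smul_mem' c p hp l hl := by rw [map_smul, hp l hl, smul_zero]

theorem mem_vanish {T : Set I} {p : P} : p ∈ X.vanish T ↔ ∀ l ∈ T, X.χ l p = 0 := Iff.rfl

/-- The map `p ↦ ∑ p₀ s(S(p₁))`, where `s h` is a lift of `1 ⊗ h` from the `k`-th trivialization. -/
def trace (k : I) : P →ₗ[ℂ] P :=
  LinearMap.mul' ℂ P ∘ₗ
    (X.sect k ∘ₗ TensorProduct.mk ℂ (X.Loc k) H 1 ∘ₗ HopfAlgebra.antipode ℂ).lTensor P ∘ₗ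
      X.coaction.toLinearMap

/-- By colinearity the image of ∑ p₀ s(p₁) in chart l depends on χ_l p alone; in particular it
vanishes where χ_l p does. -/
theorem χ_trace_aux (l : I) (s : H →ₗ[ℂ] P) (p : P) :
    X.χ l (LinearMap.mul' ℂ P (s.lTensor P (X.coaction p))) =
      LinearMap.mul' ℂ _ (((X.χ l).toLinearMap ∘ₗ s).lTensor _
        ((TensorProduct.assoc ℂ (X.Loc l) H H).symm
          ((Coalgebra.comul : H →ₗ[ℂ] H ⊗[ℂ] H).lTensor _ (X.χ l p)))) := by
  rw [X.χ_colinear l p, LinearEquiv.symm_apply_apply]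
  generalize X.coaction p = t
  induction t using TensorProduct.induction_on with
  | zero => simp
  | tmul a b => simp
  | add x y hx hy => simp only [map_add, hx, hy]

theorem trace_mem_vanish (k : I) {T : Set I} {p : P} (hp : p ∈ X.vanish T) :
    X.trace k p ∈ X.vanish T := fun l hl => by
  refine (X.χ_trace_aux l _ p).trans ?_
  rw [hp l hl]; simp

/-- In chart k the trace sends b ⊗ h to b ⊗ ∑ h₁S(h₂), which the antipode axiom collapses. It
produces elements of P that are coinvariant in chart k. -/
theorem χ_trace (k : I) (p : P) :
    X.χ k (X.trace k p) = slice _ Coalgebra.counit (X.χ k p) ⊗ₜ 1 := by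
  refine (X.χ_trace_aux k _ p).trans ?_
  generalize X.χ k p = y
  induction y using TensorProduct.induction_on with
  | zero => simp
  | tmul b h =>
    have : ∀ s : H ⊗[ℂ] H, LinearMap.mul' ℂ (X.Loc k ⊗[ℂ] H)
        (((X.χ k).toLinearMap ∘ₗ X.sect k ∘ₗ TensorProduct.mk ℂ (X.Loc k) H 1 ∘ₗ
          HopfAlgebra.antipode ℂ).lTensor _ ((TensorProduct.assoc ℂ (X.Loc k) H H).symm
            (b ⊗ₜ s))) =
        b ⊗ₜ LinearMap.mul' ℂ H ((HopfAlgebra.antipode ℂ).lTensor H s) := by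
      intro s
      induction s using TensorProduct.induction_on with
      | zero => simp
      | tmul a c => simp [χ_sect]
      | add x y hx hy => simp only [TensorProduct.tmul_add, map_add, hx, hy]
    rw [LinearMap.lTensor_tmul, this, HopfAlgebra.mul_antipode_lTensor_comul_apply, slice_tmul,
      Algebra.algebraMap_eq_smul_one, TensorProduct.tmul_smul, TensorProduct.smul_tmul']
  | add x y hx hy => simp only [map_add, hx, hy, TensorProduct.add_tmul]

theorem mul_mem_vanish {T : Set I} {p : P} (hp : p ∈ X.vanish T) (q : P) :
    p * q ∈ X.vanish T := fun l hl => by rw [map_mul, hp l hl, zero_mul]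

theorem act_mem_vanish {T : Set I} {p : P} (hp : p ∈ X.vanish T) (φ : H →ₗ[ℂ] ℂ) :
    X.act φ p ∈ X.vanish T := fun l hl => X.χ_act_eq_zero φ (hp l hl)

/-- The image of `X.vanish T` under `χ k` is determined by its image under `(id ⊗ ε) ∘ χ k`. -/
theorem exists_mem_vanish (k : I) {T : Set I} {t : X.Loc k ⊗[ℂ] H}
    (h : ∀ φ, ∃ n ∈ X.vanish T, slice (X.Loc k) (Coalgebra.counit : H →ₗ[ℂ] ℂ) (X.χ k n) = slice (X.Loc k) φ t) :
    ∃ n ∈ X.vanish T, X.χ k n = t := by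
  obtain ⟨κ, s, b, φ, hs⟩ := exists_sum_slice t
  choose n hn hn' using fun i => h (φ i)
  -- The trace turns n i into its counit slice tensored with 1, still vanishing over T;
  -- multiplication by a lift of 1 ⊗ b i then gives the i-th term of the expansion of t.
  refine ⟨∑ i ∈ s, X.trace k (n i) * X.sect k (1 ⊗ₜ b i), Submodule.sum_mem _ fun i _ =>
    X.mul_mem_vanish (X.trace_mem_vanish k (hn i)) _, ?_⟩
  refine Eq.trans ?_ hs.symm
  rw [map_sum]
  refine Finset.sum_congr rfl fun i _ => ?_
  rw [map_mul, χ_trace, χ_sect, hn', Algebra.TensorProduct.tmul_mul_tmul, one_mul, mul_one]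

/-- Where p is coinvariant, φ·p - φ(1)p vanishes. The counit slices in chart k of these elements are
the slices of the defect of coinvariance of χ_k p, so by `exists_mem_vanish` the defect is the image
of some n that vanishes over T. -/
theorem exists_coinvariant_correction {T : Set I} (k : I) {p : P}
    (h : ∀ l ∈ T, ∃ c, X.χ l p = c ⊗ₜ 1) :
    ∃ n ∈ X.vanish T, ∃ c, X.χ k (p - n) = c ⊗ₜ 1 := by
  obtain ⟨n, hn, hn'⟩ := X.exists_mem_vanish k (T := T)
    (t := X.χ k p - slice (X.Loc k) Coalgebra.counit (X.χ k p) ⊗ₜ 1) (fun φ => by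
      refine ⟨X.act φ p - φ 1 • p, fun l hl => ?_, ?_⟩
      · obtain ⟨c, hc⟩ := h l hl
        rw [map_sub, map_smul, χ_act, hc, LinearMap.lTensor_tmul, hit, LinearMap.comp_apply,
          Bialgebra.comul_one, Algebra.TensorProduct.one_def, slice_tmul,
          TensorProduct.tmul_smul, sub_self]
      · rw [map_sub, map_sub, slice_counit_χ_act, map_sub, slice_tmul, map_smul, map_smul])
  exact ⟨n, hn, slice _ Coalgebra.counit (X.χ k p), by rw [map_sub, hn', sub_sub_cancel]⟩

theorem slice_χRestrict {l : I} (L : Ideal B) [L.IsTwoSided] (hl : X.J l ≤ L) (φ : H →ₗ[ℂ] ℂ)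
    (p : P) : slice _ φ (X.χRestrict L hl p) =
      Ideal.Quotient.factorₐ ℂ hl (slice (X.Loc l) φ (X.χ l p)) :=
  slice_rTensor φ _ _

variable [Finite I]

/-- An element of `P` over the `i`-th and `j`-th charts which is coinvariant there agrees there with
an element of the base. -/
theorem exists_base_lift (T : Set I) {p : P} (h : ∀ l ∈ T, ∃ c, X.χ l p = c ⊗ₜ 1) :
    ∃ b : B, ∀ l ∈ T, X.χ l p = X.χ l (X.ι b) := by
  obtain ⟨q, hq, hq'⟩ : ∃ q, (∀ l ∈ T, X.χ l p = X.χ l q) ∧ ∀ l, ∃ c, X.χ l q = c ⊗ₜ 1 := by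
    have := Fintype.ofFinite I
    classical
    -- Coinvariance is achieved for one more chart at a time, by corrections vanishing over T and
    -- over the charts already treated; finiteness of I lets this reach all charts.
    have key : ∀ s : Finset I, ∃ q, (∀ l ∈ T, X.χ l p = X.χ l q) ∧
        ∀ l ∈ T ∪ s, ∃ c, X.χ l q = c ⊗ₜ 1 := by
      intro s
      induction s using Finset.induction_on with
      | empty => exact ⟨p, fun _ _ => rfl, by simpa using h⟩
      | insert k s _ ih =>
        obtain ⟨q, hq, hq'⟩ := ih
        obtain ⟨n, hn, c, hc⟩ := X.exists_coinvariant_correction k hq'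
        refine ⟨q - n, fun l hl => ?_, fun l hl => ?_⟩
        · rw [map_sub, hn l (Or.inl hl), sub_zero, hq l hl]
        · by_cases hlk : l = k
          · subst hlk; exact ⟨c, hc⟩
          · have hl' : l ∈ T ∪ s := by
              rcases hl with hl | hl
              · exact Or.inl hl
              · rw [Finset.coe_insert] at hl
                exact Or.inr (hl.resolve_left hlk)
            rw [map_sub, hn l hl', sub_zero]
            exact hq' l hl'
    obtain ⟨q, hq, hq'⟩ := key Finset.univ
    exact ⟨q, hq, fun l => hq' l (Or.inr (Finset.mem_coe.2 (Finset.mem_univ l)))⟩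
  have hco : X.coaction q = q ⊗ₜ 1 := by
    refine slice_ext fun φ => ?_
    rw [slice_tmul, ← sub_eq_zero]
    -- Coinvariance in each chart puts this difference in every kernel, and the kernels have zero
    -- intersection.
    have hmem : X.act φ q - φ 1 • q ∈ (⨅ i, RingHom.ker (X.χ i) : Ideal P) := by
      refine Submodule.mem_iInf _ |>.2 fun l => ?_
      obtain ⟨c, hc⟩ := hq' l
      rw [RingHom.mem_ker, map_sub, map_smul, χ_act, hc, LinearMap.lTensor_tmul, hit,
        LinearMap.comp_apply, Bialgebra.comul_one, Algebra.TensorProduct.one_def, slice_tmul,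
        TensorProduct.tmul_smul, sub_self]
    rw [X.complete_total.1] at hmem
    exact hmem
  obtain ⟨b, rfl⟩ := (X.range_ι q).2 hco
  exact ⟨b, hq⟩

/-- Over the two charts p is coinvariant, so it agrees there with some c in B. Chart k puts c in J k
and chart l puts b - c in J l. -/
theorem mem_sup_of_χ {k l : I} {p : P} (hp : X.χ k p = 0) {b : B}
    (hb : X.χ l p = Ideal.Quotient.mk (X.J l) b ⊗ₜ 1) : b ∈ X.J k ⊔ X.J l := by
  obtain ⟨c, hc⟩ := X.exists_base_lift {k, l} (p := p) (by
    rintro m (rfl | rfl)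
    · exact ⟨0, by rw [hp, TensorProduct.zero_tmul]⟩
    · exact ⟨_, hb⟩)
  have hε : ∀ (m : I) (b : B), slice (X.Loc m) (Coalgebra.counit : H →ₗ[ℂ] ℂ)
      (Ideal.Quotient.mk (X.J m) b ⊗ₜ 1) = Ideal.Quotient.mk (X.J m) b := fun m b => by
    rw [slice_tmul, Bialgebra.counit_one, one_smul]
  have h1 : c ∈ X.J k := by
    have := hc k (by simp)
    rw [hp, X.χ_ι] at this
    have := congrArg (slice (X.Loc k) (Coalgebra.counit : H →ₗ[ℂ] ℂ)) this
    rw [hε, map_zero] at this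
    exact Ideal.Quotient.eq_zero_iff_mem.1 this.symm
  have h2 : b - c ∈ X.J l := by
    have := hc l (by simp)
    rw [hb, X.χ_ι] at this
    have := congrArg (slice (X.Loc l) (Coalgebra.counit : H →ₗ[ℂ] ℂ)) this
    rw [hε, hε] at this
    exact Ideal.Quotient.eq.1 this
  rw [← add_sub_cancel c b]
  exact Submodule.add_mem_sup h1 h2

/-- The restriction of `χ l p` to the overlap depends only on `χ k p`. -/
theorem χRestrict_eq_zero {k l : I} (L : Ideal B) [L.IsTwoSided] (hk : X.J k ≤ L)
    (hl : X.J l ≤ L) {p : P} (hp : X.χ k p = 0) : X.χRestrict L hl p = 0 := by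
  refine slice_ext fun φ => ?_
  rw [map_zero, slice_χRestrict, ← slice_counit_χ_act]
  obtain ⟨b, hb⟩ := Ideal.Quotient.mk_surjective
    (slice _ (Coalgebra.counit : H →ₗ[ℂ] ℂ) (X.χ l (X.act φ p)))
  -- Taking the trace makes the element coinvariant in chart l without losing its vanishing in chart
  -- k, which is the situation of `mem_sup_of_χ`.
  have h1 : X.trace l (X.act φ p) ∈ X.vanish {k} :=
    X.trace_mem_vanish l (X.act_mem_vanish (by simpa [mem_vanish] using hp) φ)
  have h2 := X.mem_sup_of_χ (h1 k rfl) (b := b) (by rw [χ_trace, hb])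
  rw [← hb]
  exact Ideal.Quotient.eq_zero_iff_mem.2 (sup_le hk hl h2)

theorem χRestrict_congr {k l : I} (L : Ideal B) [L.IsTwoSided] (hk : X.J k ≤ L)
    (hl : X.J l ≤ L) {p q : P} (h : X.χ k p = X.χ k q) :
    X.χRestrict L hl p = X.χRestrict L hl q := by
  rw [← sub_eq_zero, ← map_sub]
  exact X.χRestrict_eq_zero L hk hl (by rw [map_sub, h, sub_self])

/-- Acting by φ on a lift of 1 ⊗ h gives a lift of 1 ⊗ ∑ φ(h₂)h₁, and the restriction does not
depend on the lift. So each slice of the left side is a value of the transition function. -/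
theorem χRestrict_sect {k l : I} (L : Ideal B) [L.IsTwoSided] (hk : X.J k ≤ L)
    (hl : X.J l ≤ L) (h : H) :
    X.χRestrict L hl (X.sect k (1 ⊗ₜ h)) =
      (X.transition k l L hl).rTensor H (Coalgebra.comul h) := by
  refine slice_ext fun φ => ?_
  have h1 : X.χ k (X.act φ (X.sect k (1 ⊗ₜ h))) = X.χ k (X.sect k (1 ⊗ₜ hit φ h)) := by
    rw [χ_act, χ_sect, χ_sect, LinearMap.lTensor_tmul]
  have h2 := X.χRestrict_congr L hk hl h1
  have h3 : slice _ φ (X.χRestrict L hl (X.sect k (1 ⊗ₜ h))) =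
      slice _ Coalgebra.counit (X.χRestrict L hl (X.act φ (X.sect k (1 ⊗ₜ h)))) := by
    rw [slice_χRestrict, slice_χRestrict, slice_counit_χ_act]
  rw [h3, h2, slice_rTensor]
  rfl

end Bundle

end Bundles

/-! ### Convolution -/

section Convolution

open WithConv

variable {H : Type*} [Ring H] [HopfAlgebra ℂ H] {R R' : Type*} [Ring R] [Algebra ℂ R]
  [Ring R'] [Algebra ℂ R']

theorem toConv_conv (f g : H →ₗ[ℂ] R) : toConv (conv f g) = toConv f * toConv g := rfl

theorem comp_conv (k : R →ₐ[ℂ] R') (f g : H →ₗ[ℂ] R) :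
    k.toLinearMap ∘ₗ conv f g = conv (k.toLinearMap ∘ₗ f) (k.toLinearMap ∘ₗ g) :=
  LinearMap.algHom_comp_convMul_distrib k (toConv f) (toConv g)

theorem conv_apply (f g : H →ₗ[ℂ] R) (h : H) :
    conv f g h = LinearMap.mul' ℂ R (TensorProduct.map f g (Coalgebra.comul h)) := rfl

theorem mul'_map_rTensor_comul {V : Type*} [AddCommGroup V] [Module ℂ V] (f : V →ₗ[ℂ] R)
    (g : H →ₗ[ℂ] R) (t : H →ₗ[ℂ] V) (h : H) :
    LinearMap.mul' ℂ R (TensorProduct.map f g (t.rTensor H (Coalgebra.comul h))) =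
      conv (f ∘ₗ t) g h := by
  rw [conv_apply]
  generalize (Coalgebra.comul h : H ⊗[ℂ] H) = s
  induction s using TensorProduct.induction_on with
  | zero => simp
  | tmul a b => rfl
  | add x y hx hy => simp only [map_add, hx, hy]

theorem mulLeft_conv (c : R) (f g : H →ₗ[ℂ] R) (h : H) :
    conv (LinearMap.mulLeft ℂ c ∘ₗ f) g h = c * conv f g h := by
  rw [conv_apply, conv_apply]
  generalize (Coalgebra.comul h : H ⊗[ℂ] H) = s
  induction s using TensorProduct.induction_on with
  | zero => simp
  | tmul a b => simp [mul_assoc]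
  | add x y hx hy => simp only [map_add, hx, hy, mul_add]

/-- The image under k of the antipode identity. It provides the convolution right inverse by which
the classes of 1 ⊗ h are cancelled on the overlaps. -/
theorem algHom_mul_antipode (k : H →ₐ[ℂ] R) :
    toConv k.toLinearMap * toConv (k.toLinearMap ∘ₗ HopfAlgebra.antipode ℂ) = 1 := by
  have := LinearMap.algHom_comp_convMul_distrib k
    (toConv (LinearMap.id : H →ₗ[ℂ] H)) (toConv (HopfAlgebra.antipode ℂ))
  rw [LinearMap.id_mul_antipode] at this
  refine (congrArg toConv this).symm.trans ?_
  ext h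
  simp

theorem leibniz_conv (P d : R →ₗ[ℂ] R) (hd : ∀ x y, d (x * y) = d x * y + P x * d y)
    (f g : H →ₗ[ℂ] R) : d ∘ₗ conv f g = conv (d ∘ₗ f) g + conv (P ∘ₗ f) (d ∘ₗ g) := by
  ext h
  rw [LinearMap.add_apply, LinearMap.comp_apply, conv_apply, conv_apply, conv_apply]
  generalize (Coalgebra.comul h : H ⊗[ℂ] H) = s
  induction s using TensorProduct.induction_on with
  | zero => simp
  | tmul a b => simp [hd]
  | add x y hx hy => simp only [map_add, hx, hy]; abel

end Convolution

section Bundles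

variable {H : Type uH} {B : Type uB} {P : Type uP} {I : Type w} [Ring H] [HopfAlgebra ℂ H] [Ring B]
  [Algebra ℂ B] [Ring P] [Algebra ℂ P]

namespace DiffStructure

open GradedTensorProduct WithConv

variable {X : Bundle H B P I} (S : DiffStructure.{v, v'} X)

/-! ### Horizontal forms on the overlaps -/

theorem hIncl_tmul_one (i : I) (γ : S.BForm i) : S.hIncl i (γ ⊗ₜ 1) = S.left i γ := by
  refine (horIncl_tmul _ _ γ 1).trans ?_
  rw [map_one]; rfl

theorem hIncl_tmul (i : I) (γ : S.BForm i) (h : H) :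
    S.hIncl i (γ ⊗ₜ h) = S.left i γ * S.hIncl i (1 ⊗ₜ h) := by
  rw [← hIncl_tmul_one, ← map_mul, Algebra.TensorProduct.tmul_mul_tmul, mul_one, one_mul]

theorem hIncl_tmul' (i : I) (γ : S.BForm i) (h : H) :
    S.hIncl i (γ ⊗ₜ h) = S.hIncl i (1 ⊗ₜ h) * S.left i γ := by
  rw [← hIncl_tmul_one, ← map_mul, Algebra.TensorProduct.tmul_mul_tmul, mul_one, one_mul]

/-- The class on the overlap of a horizontal form over the `i`-th chart. -/
def horLeft (i j : I) : S.BForm i ⊗[ℂ] H →ₐ[ℂ] S.Q i j := (S.projLeft i j).comp (S.hIncl i)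

/-- The class on the overlap of a horizontal form over the `j`-th chart. -/
def horRight (i j : I) : S.BForm j ⊗[ℂ] H →ₐ[ℂ] S.Q i j := (S.projRight i j).comp (S.hIncl j)

/-- The class on the overlap of a form on `B i`. -/
def baseLeft (i j : I) : S.BForm i →ₐ[ℂ] S.Q i j := (S.projLeft i j).comp (S.left i)

/-- The class on the overlap of a form on `B j`. -/
def baseRight (i j : I) : S.BForm j →ₐ[ℂ] S.Q i j := (S.projRight i j).comp (S.left j)

/-- The class on the overlap of `1 ⊗ h` over the `i`-th chart. -/
def fibreLeft (i j : I) : H →ₐ[ℂ] S.Q i j :=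
  (S.horLeft i j).comp Algebra.TensorProduct.includeRight

/-- The class on the overlap of `1 ⊗ h` over the `j`-th chart. -/
def fibreRight (i j : I) : H →ₐ[ℂ] S.Q i j :=
  (S.horRight i j).comp Algebra.TensorProduct.includeRight

variable (i j : I)

theorem horLeft_tmul (γ : S.BForm i) (h : H) :
    S.horLeft i j (γ ⊗ₜ h) = S.baseLeft i j γ * S.fibreLeft i j h :=
  (congrArg (S.projLeft i j) (S.hIncl_tmul i γ h)).trans (map_mul _ _ _)

theorem horRight_tmul (γ : S.BForm j) (h : H) :
    S.horRight i j (γ ⊗ₜ h) = S.baseRight i j γ * S.fibreRight i j h :=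
  (congrArg (S.projRight i j) (S.hIncl_tmul j γ h)).trans (map_mul _ _ _)

theorem commute_baseLeft (γ : S.BForm i) (h : H) :
    Commute (S.baseLeft i j γ) (S.fibreLeft i j h) :=
  (S.horLeft_tmul i j γ h).symm.trans
    ((congrArg (S.projLeft i j) (S.hIncl_tmul' i γ h)).trans (map_mul _ _ _))

theorem commute_baseRight (γ : S.BForm j) (h : H) :
    Commute (S.baseRight i j γ) (S.fibreRight i j h) :=
  (S.horRight_tmul i j γ h).symm.trans
    ((congrArg (S.projRight i j) (S.hIncl_tmul' j γ h)).trans (map_mul _ _ _))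

/-- The generators [b] and [db] of Γ_m come from either chart, so Γ(B_i) and Γ(B_j) both map onto
it. Consequently Γ_m commutes with the classes of 1 ⊗ h of both charts. -/
theorem exists_baseLeft {x : S.Q i j} (hx : x ∈ S.Γm i j) : ∃ γ, S.baseLeft i j γ = x := by
  have : S.Γm i j ≤ (S.baseLeft i j).range := by
    refine Algebra.adjoin_le ?_
    rintro _ (⟨b, rfl⟩ | ⟨b, rfl⟩)
    · exact ⟨_, S.projLeft_classOf i j b⟩
    · exact ⟨_, S.projLeft_classD i j b⟩
  exact this hx

theorem exists_baseRight {x : S.Q i j} (hx : x ∈ S.Γm i j) : ∃ γ, S.baseRight i j γ = x := by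
  have : S.Γm i j ≤ (S.baseRight i j).range := by
    refine Algebra.adjoin_le ?_
    rintro _ (⟨b, rfl⟩ | ⟨b, rfl⟩)
    · exact ⟨_, S.projRight_classOf i j b⟩
    · exact ⟨_, S.projRight_classD i j b⟩
  exact this hx

theorem commute_fibreLeft {x : S.Q i j} (hx : x ∈ S.Γm i j) (h : H) :
    Commute x (S.fibreLeft i j h) := by
  obtain ⟨γ, rfl⟩ := S.exists_baseLeft i j hx
  exact S.commute_baseLeft i j γ h

theorem commute_fibreRight {x : S.Q i j} (hx : x ∈ S.Γm i j) (h : H) :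
    Commute x (S.fibreRight i j h) := by
  obtain ⟨γ, rfl⟩ := S.exists_baseRight i j hx
  exact S.commute_baseRight i j γ h

theorem dE_left (i : I) (γ : S.BForm i) : S.dE i (S.left i γ) = S.left i ((S.base i).d γ) :=
  skewD_tmul_one _ _ γ

theorem parE_left (i : I) (γ : S.BForm i) :
    S.parE i (S.left i γ) = S.left i ((S.base i).parity γ) := by
  refine (skewParity_tmul _ _ γ 1).trans ?_
  rw [DiffCalculus.parity_one]; rfl

theorem dQ_baseLeft (γ : S.BForm i) :
    S.dQ i j (S.baseLeft i j γ) = S.baseLeft i j ((S.base i).d γ) :=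
  (S.dQ_projLeft i j _).trans (congrArg _ (S.dE_left i γ))

theorem dQ_baseRight (γ : S.BForm j) :
    S.dQ i j (S.baseRight i j γ) = S.baseRight i j ((S.base j).d γ) :=
  (S.dQ_projRight i j _).trans (congrArg _ (S.dE_left j γ))

theorem parQ_baseLeft (γ : S.BForm i) :
    S.parQ i j (S.baseLeft i j γ) = S.baseLeft i j ((S.base i).parity γ) :=
  (S.parQ_projLeft i j _).trans (congrArg _ (S.parE_left i γ))

theorem parQ_baseRight (γ : S.BForm j) :
    S.parQ i j (S.baseRight i j γ) = S.baseRight i j ((S.base j).parity γ) :=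
  (S.parQ_projRight i j _).trans (congrArg _ (S.parE_left j γ))

/-! ### Transition functions in the calculus on the overlaps -/

/-- The inclusion of `B ij` into the calculus on the overlap. -/
def embQ : X.Loc₂ i j →ₗ[ℂ] S.Q i j := (S.Γm i j).val.toLinearMap ∘ₗ S.embM i j

theorem embQ_mk (b : B) : S.embQ i j (Ideal.Quotient.mk _ b) = S.classOf i j b :=
  S.projLeft_classOf i j b

theorem embQ_mem (x : X.Loc₂ i j) : S.embQ i j x ∈ S.Γm i j := (S.embM i j x).2

theorem dQ_embQ (x : X.Loc₂ i j) : S.dQ i j (S.embQ i j x) = S.dM i j x := by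
  obtain ⟨b, rfl⟩ := Ideal.Quotient.mk_surjective x
  rw [embQ_mk, ← projLeft_classOf, dQ_projLeft, dE_left]
  rfl

theorem parQ_embQ (x : X.Loc₂ i j) : S.parQ i j (S.embQ i j x) = S.embQ i j x := by
  obtain ⟨b, rfl⟩ := Ideal.Quotient.mk_surjective x
  rw [embQ_mk, ← projLeft_classOf, parQ_projLeft, parE_left]
  exact congrArg (fun y => S.projLeft i j (S.left i y)) (DiffCalculus.parity_emb _ _)

theorem projLeft_totalMap (p : P) :
    S.projLeft i j (S.totalMap i p) = S.projRight i j (S.totalMap j p) :=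
  (overlapLeft_apply S.total_surjective i j (adaptedOf S.totalMap S.dE p)).trans
    (overlapRight_apply S.total_surjective i j (adaptedOf S.totalMap S.dE p)).symm

/-- On the overlap, an element of P is seen through chart j only by way of its restriction to B_ij ⊗
H. -/
theorem projRight_totalMap (p : P) : S.projRight i j (S.totalMap j p) =
    LinearMap.mul' ℂ _ (TensorProduct.map (S.embQ i j) (S.fibreRight i j).toLinearMap
      (X.χRestrict (X.J i ⊔ X.J j) le_sup_right p)) := by
  change S.horRight i j (Algebra.TensorProduct.map (S.base j).emb (AlgHom.id ℂ H) (X.χ j p)) =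
    LinearMap.mul' ℂ _ (TensorProduct.map (S.embQ i j) (S.fibreRight i j).toLinearMap
      ((Ideal.Quotient.factorₐ ℂ _).toLinearMap.rTensor H (X.χ j p)))
  generalize X.χ j p = y
  induction y using TensorProduct.induction_on with
  | zero => simp
  | tmul x h =>
    obtain ⟨b, rfl⟩ := Ideal.Quotient.mk_surjective x
    have h1 : S.embQ i j (Ideal.Quotient.factorₐ ℂ (le_sup_right : X.J j ≤ X.J i ⊔ X.J j)
        (Ideal.Quotient.mk _ b)) = S.baseRight i j ((S.base j).emb (Ideal.Quotient.mk _ b)) :=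
      (S.embQ_mk i j b).trans (S.projRight_classOf i j b).symm
    rw [LinearMap.rTensor_tmul, TensorProduct.map_tmul, LinearMap.mul'_apply,
      AlgHom.toLinearMap_apply, h1, Algebra.TensorProduct.map_tmul, horRight_tmul]
    rfl
  | add x y hx hy => simp only [map_add, hx, hy]

theorem projLeft_totalMap' (p : P) : S.projLeft i j (S.totalMap i p) =
    LinearMap.mul' ℂ _ (TensorProduct.map (S.embQ i j) (S.fibreLeft i j).toLinearMap
      (X.χRestrict (X.J i ⊔ X.J j) le_sup_left p)) := by
  change S.horLeft i j (Algebra.TensorProduct.map (S.base i).emb (AlgHom.id ℂ H) (X.χ i p)) =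
    LinearMap.mul' ℂ _ (TensorProduct.map (S.embQ i j) (S.fibreLeft i j).toLinearMap
      ((Ideal.Quotient.factorₐ ℂ _).toLinearMap.rTensor H (X.χ i p)))
  generalize X.χ i p = y
  induction y using TensorProduct.induction_on with
  | zero => simp
  | tmul x h =>
    obtain ⟨b, rfl⟩ := Ideal.Quotient.mk_surjective x
    have h1 : S.embQ i j (Ideal.Quotient.factorₐ ℂ (le_sup_left : X.J i ≤ X.J i ⊔ X.J j)
        (Ideal.Quotient.mk _ b)) = S.baseLeft i j ((S.base i).emb (Ideal.Quotient.mk _ b)) :=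
      (S.embQ_mk i j b).trans (S.projLeft_classOf i j b).symm
    rw [LinearMap.rTensor_tmul, TensorProduct.map_tmul, LinearMap.mul'_apply,
      AlgHom.toLinearMap_apply, h1, Algebra.TensorProduct.map_tmul, horLeft_tmul]
    rfl
  | add x y hx hy => simp only [map_add, hx, hy]

theorem totalMap_sect (k : I) (h : H) :
    S.totalMap k (X.sect k (1 ⊗ₜ h)) = S.hIncl k (1 ⊗ₜ h) := by
  change zeroIncl _ _ (X.χ k _) = _
  rw [X.χ_sect, zeroIncl]
  simp [hIncl]

/-- The transition function `τ_ij` with values in the calculus on the overlap. -/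
def transQ : H →ₗ[ℂ] S.Q i j := S.embQ i j ∘ₗ S.τ i j

/-- The transition function `τ_ji` with values in the calculus on the overlap. -/
def transQ' : H →ₗ[ℂ] S.Q i j := S.embQ i j ∘ₗ S.τ' i j

theorem transQ_mem (h : H) : S.transQ i j h ∈ S.Γm i j := S.embQ_mem i j _

theorem parQ_comp_transQ : S.parQ i j ∘ₗ S.transQ i j = S.transQ i j :=
  LinearMap.ext fun _ => S.parQ_embQ i j _

theorem parQ_comp_transQ' : S.parQ i j ∘ₗ S.transQ' i j = S.transQ' i j :=
  LinearMap.ext fun _ => S.parQ_embQ i j _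

theorem dQ_one_conv : toConv (S.dQ i j ∘ₗ ofConv (1 : WithConv (H →ₗ[ℂ] S.Q i j))) = 0 := by
  ext h
  change S.dQ i j (algebraMap ℂ _ (Coalgebra.counit (R := ℂ) h)) = 0
  rw [Algebra.algebraMap_eq_smul_one, map_smul, dQ_one, smul_zero]

variable [Finite I]

/-- A lift p in P of 1 ⊗ h from chart i has one class on the overlap. Chart i computes it as w_i(h),
chart j as ∑ τ_ij(h₁) w_j(h₂), by `χRestrict_sect`. -/
theorem fibreLeft_eq : toConv (S.fibreLeft i j).toLinearMap =
    toConv (S.transQ i j) * toConv (S.fibreRight i j).toLinearMap := by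
  rw [← toConv_conv]
  refine congrArg toConv (LinearMap.ext fun h => ?_)
  have h1 : S.fibreLeft i j h = S.projLeft i j (S.totalMap i (X.sect i (1 ⊗ₜ h))) := by
    rw [totalMap_sect]; rfl
  rw [AlgHom.toLinearMap_apply, h1, projLeft_totalMap, projRight_totalMap,
    X.χRestrict_sect _ le_sup_left le_sup_right, mul'_map_rTensor_comul]
  rfl

theorem fibreRight_eq : toConv (S.fibreRight i j).toLinearMap =
    toConv (S.transQ' i j) * toConv (S.fibreLeft i j).toLinearMap := by
  rw [← toConv_conv]
  refine congrArg toConv (LinearMap.ext fun h => ?_)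
  have h1 : S.fibreRight i j h = S.projRight i j (S.totalMap j (X.sect j (1 ⊗ₜ h))) := by
    rw [totalMap_sect]; rfl
  rw [AlgHom.toLinearMap_apply, h1, ← projLeft_totalMap, projLeft_totalMap',
    X.χRestrict_sect _ le_sup_right le_sup_left, mul'_map_rTensor_comul]
  rfl

theorem transQ_eq : toConv (S.transQ i j) = toConv (S.fibreLeft i j).toLinearMap *
    toConv ((S.fibreRight i j).toLinearMap ∘ₗ HopfAlgebra.antipode ℂ) := by
  rw [fibreLeft_eq, mul_assoc, algHom_mul_antipode, mul_one]

/-- Inserting one change of chart into the other gives w_i = τ_ij * τ_ji * w_i, and w_i is cancelled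
on the right. -/
theorem transQ_mul_transQ' : toConv (S.transQ i j) * toConv (S.transQ' i j) = 1 := by
  have h := S.fibreLeft_eq i j
  rw [fibreRight_eq, ← mul_assoc] at h
  have h2 := congrArg (· * toConv ((S.fibreLeft i j).toLinearMap ∘ₗ HopfAlgebra.antipode ℂ)) h
  simp only [mul_assoc, algHom_mul_antipode, mul_one] at h2
  exact h2.symm

theorem transQ'_mul_transQ : toConv (S.transQ' i j) * toConv (S.transQ i j) = 1 := by
  have h := S.fibreRight_eq i j
  rw [fibreLeft_eq, ← mul_assoc] at h
  have h2 := congrArg (· * toConv ((S.fibreRight i j).toLinearMap ∘ₗ HopfAlgebra.antipode ℂ)) h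
  simp only [mul_assoc, algHom_mul_antipode, mul_one] at h2
  exact h2.symm

/-- The transition functions take values in the centre of the calculus on the overlap. -/
theorem commute_transQ {x : S.Q i j} (hx : x ∈ S.Γm i j) (h : H) :
    Commute (S.transQ i j h) x := by
  have h1 : S.transQ i j h = conv (S.fibreLeft i j).toLinearMap
      ((S.fibreRight i j).toLinearMap ∘ₗ HopfAlgebra.antipode ℂ) h :=
    LinearMap.congr_fun (congrArg ofConv (S.transQ_eq i j)) h
  rw [h1, conv_apply]
  generalize (Coalgebra.comul h : H ⊗[ℂ] H) = s
  induction s using TensorProduct.induction_on with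
  | zero => simp
  | tmul a b =>
    exact (S.commute_fibreLeft i j hx a).symm.mul_left (S.commute_fibreRight i j hx _).symm
  | add x y hx hy => rw [map_add, map_add]; exact hx.add_left hy

/-- Differentiate τ_ji * τ_ij = 1; there is no sign because τ_ji has degree zero. -/
theorem d_transQ'_mul_transQ : toConv (S.dQ i j ∘ₗ S.transQ' i j) * toConv (S.transQ i j) =
    -(toConv (S.transQ' i j) * toConv (S.dQ i j ∘ₗ S.transQ i j)) := by
  have h := congrArg toConv (leibniz_conv (S.parQ i j) (S.dQ i j) (S.dQ_mul i j)
    (S.transQ' i j) (S.transQ i j))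
  rw [parQ_comp_transQ'] at h
  have h0 : conv (S.transQ' i j) (S.transQ i j) =
    ofConv (1 : WithConv (H →ₗ[ℂ] S.Q i j)) := congrArg ofConv (S.transQ'_mul_transQ i j)
  rw [h0, dQ_one_conv] at h
  exact eq_neg_of_add_eq_zero_left h.symm

theorem d_transQ_mul_transQ' : toConv (S.dQ i j ∘ₗ S.transQ i j) * toConv (S.transQ' i j) =
    -(toConv (S.transQ i j) * toConv (S.dQ i j ∘ₗ S.transQ' i j)) := by
  have h := congrArg toConv (leibniz_conv (S.parQ i j) (S.dQ i j) (S.dQ_mul i j)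
    (S.transQ i j) (S.transQ' i j))
  rw [parQ_comp_transQ] at h
  have h0 : conv (S.transQ i j) (S.transQ' i j) =
    ofConv (1 : WithConv (H →ₗ[ℂ] S.Q i j)) := congrArg ofConv (S.transQ_mul_transQ' i j)
  rw [h0, dQ_one_conv] at h
  exact eq_neg_of_add_eq_zero_left h.symm

/-- The gauge transformation rule for `A i` and `A j` on the overlap, in a form in which the
transition function `τ_ji` does not occur. -/
theorem gauge_iff (A : S.LocalFamily) :
    (S.πLeft i j).toLinearMap ∘ₗ S.formOf A i =
      conv (conv (S.embM i j ∘ₗ S.τ i j) ((S.πRight i j).toLinearMap ∘ₗ S.formOf A j))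
        (S.embM i j ∘ₗ S.τ' i j) +
      conv (S.embM i j ∘ₗ S.τ i j) (S.dM i j ∘ₗ S.τ' i j) ↔
    toConv ((S.baseLeft i j).toLinearMap ∘ₗ S.formOf A i) *
        toConv (S.fibreLeft i j).toLinearMap =
      toConv (S.transQ i j) * toConv ((S.baseRight i j).toLinearMap ∘ₗ S.formOf A j) *
          toConv (S.fibreRight i j).toLinearMap -
        toConv (S.dQ i j ∘ₗ S.transQ i j) * toConv (S.fibreRight i j).toLinearMap := by
  -- The rule can be tested in the full overlap calculus, where products with w_i and w_j make
  -- sense.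
  have hinj : Function.Injective fun f : H →ₗ[ℂ] S.Γm i j => (S.Γm i j).val.toLinearMap ∘ₗ f :=
    fun f g hfg => LinearMap.ext fun h => Subtype.ext (LinearMap.congr_fun hfg h)
  have hd : (S.Γm i j).val.toLinearMap ∘ₗ S.dM i j ∘ₗ S.τ' i j = S.dQ i j ∘ₗ S.transQ' i j :=
    LinearMap.ext fun h => (S.dQ_embQ i j _).symm
  rw [← hinj.eq_iff]
  rw [LinearMap.comp_add, comp_conv, comp_conv, comp_conv, hd]
  rw [← toConv_injective.eq_iff]
  change toConv ((S.baseLeft i j).toLinearMap ∘ₗ S.formOf A i) =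
    toConv (S.transQ i j) * toConv ((S.baseRight i j).toLinearMap ∘ₗ S.formOf A j) *
      toConv (S.transQ' i j) + toConv (S.transQ i j) * toConv (S.dQ i j ∘ₗ S.transQ' i j) ↔ _
  constructor
  · intro h
    -- Multiply by w_i = τ_ij * w_j: in the first term τ_ji * τ_ij cancels, in the second dτ_ji *
    -- τ_ij becomes -τ_ji * dτ_ij.
    rw [h, add_mul, fibreLeft_eq]
    have h1 : ∀ x z : WithConv (H →ₗ[ℂ] S.Q i j),
        x * toConv (S.transQ' i j) * (toConv (S.transQ i j) * z) = x * z := fun x z => by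
      rw [mul_assoc, ← mul_assoc _ _ z, transQ'_mul_transQ, one_mul]
    rw [h1, mul_assoc (toConv _) (toConv (S.dQ i j ∘ₗ _)), ← mul_assoc (toConv (S.dQ i j ∘ₗ _)),
      d_transQ'_mul_transQ, neg_mul, mul_neg, mul_assoc (toConv (S.transQ' i j)),
      ← mul_assoc (toConv (S.transQ i j)) (toConv (S.transQ' i j)), transQ_mul_transQ', one_mul,
      sub_eq_add_neg]
  · intro h
    -- Writing w_j = τ_ji * w_i makes w_i the last factor on both sides, where w_i ∘ S removes it.
    rw [← sub_mul, fibreRight_eq, ← mul_assoc] at h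
    have h2 := congrArg (· * toConv ((S.fibreLeft i j).toLinearMap ∘ₗ HopfAlgebra.antipode ℂ)) h
    simp only [mul_assoc, algHom_mul_antipode, mul_one] at h2
    rw [h2, sub_mul, d_transQ_mul_transQ', sub_neg_eq_add, mul_assoc]

end DiffStructure

end Bundles

/-! ### Multiplication along the coproduct. -/

section Spread

variable {H : Type*} [Ring H] [HopfAlgebra ℂ H] {R : Type*} [Ring R] [Algebra ℂ R]
  {V : Type*} [AddCommGroup V] [Module ℂ V]

/-- The map `x ⊗ h ↦ ∑ p(x) f(h₁) ⊗ h₂`. -/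
def spread (p : V →ₗ[ℂ] R) (f : H →ₗ[ℂ] R) : V ⊗[ℂ] H →ₗ[ℂ] R ⊗[ℂ] H :=
  (LinearMap.mul' ℂ R).rTensor H ∘ₗ (TensorProduct.assoc ℂ R R H).symm.toLinearMap ∘ₗ
    TensorProduct.map p (f.rTensor H ∘ₗ Coalgebra.comul)

theorem spread_tmul (p : V →ₗ[ℂ] R) (f : H →ₗ[ℂ] R) (x : V) (h : H) :
    spread p f (x ⊗ₜ h) =
      (LinearMap.mulLeft ℂ (p x) ∘ₗ f).rTensor H (Coalgebra.comul h) := by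
  simp only [spread, LinearMap.comp_apply, TensorProduct.map_tmul]
  generalize (Coalgebra.comul h : H ⊗[ℂ] H) = s
  induction s using TensorProduct.induction_on with
  | zero => simp
  | tmul a b => simp
  | add x y hx hy => simp only [map_add, TensorProduct.tmul_add, hx, hy]

/-- Coassociativity: multiplying a further leg of the coproduct into R convolves the two maps. -/
theorem spread_rTensor_comul (f g : H →ₗ[ℂ] R) (h : H) :
    spread LinearMap.id g (f.rTensor H (Coalgebra.comul h)) =
      (conv f g).rTensor H (Coalgebra.comul h) := by
  have h1 : ∀ s : H ⊗[ℂ] H, spread LinearMap.id g (f.rTensor H s) =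
      ((LinearMap.mul' ℂ R).rTensor H ∘ₗ (TensorProduct.assoc ℂ R R H).symm.toLinearMap ∘ₗ
        TensorProduct.map f (g.rTensor H)) ((Coalgebra.comul : H →ₗ[ℂ] _).lTensor H s) := by
    intro s
    induction s using TensorProduct.induction_on with
    | zero => simp
    | tmul a b => rfl
    | add x y hx hy => simp only [map_add, hx, hy]
  rw [h1, ← Coalgebra.coassoc_apply]
  generalize (Coalgebra.comul h : H ⊗[ℂ] H) = s
  induction s using TensorProduct.induction_on with
  | zero => simp
  | tmul a b =>
    rw [LinearMap.rTensor_tmul, LinearMap.rTensor_tmul, conv_apply]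
    generalize (Coalgebra.comul a : H ⊗[ℂ] H) = s
    induction s using TensorProduct.induction_on with
    | zero => simp
    | tmul a b => rfl
    | add x y hx hy => simp only [map_add, TensorProduct.add_tmul, hx, hy]
  | add x y hx hy => simp only [map_add, hx, hy]

end Spread

section Bundles

variable {H : Type uH} {B : Type uB} {P : Type uP} {I : Type w} [Ring H] [HopfAlgebra ℂ H] [Ring B]
  [Algebra ℂ B] [Ring P] [Algebra ℂ P]

namespace DiffStructure

open GradedTensorProduct WithConv

variable {X : Bundle H B P I} (S : DiffStructure.{v, v'} X)

/-! ### The local covariant derivatives -/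

section Local

variable {i : I} {R : Type*} [Ring R] [Algebra ℂ R]

theorem localLeft_tmul (a : H →ₗ[ℂ] S.BForm i) (γ : S.BForm i) (h : H) :
    S.localLeft a (γ ⊗ₜ h) = (S.base i).d γ ⊗ₜ h -
      (LinearMap.mulLeft ℂ ((S.base i).parity γ) ∘ₗ a).rTensor H (Coalgebra.comul h) := by
  simp only [localLeft, LinearMap.sub_apply, LinearMap.comp_apply, TensorProduct.map_tmul,
    LinearMap.rTensor_tmul]
  congr 1
  generalize (Coalgebra.comul h : H ⊗[ℂ] H) = s
  induction s using TensorProduct.induction_on with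
  | zero => simp
  | tmul a b => simp
  | add x y hx hy => simp only [map_add, TensorProduct.tmul_add, hx, hy]

theorem localRight_tmul (a : H →ₗ[ℂ] S.BForm i) (γ : S.BForm i) (h : H) :
    S.localRight a (γ ⊗ₜ h) = (S.base i).d γ ⊗ₜ h -
      (LinearMap.mulRight ℂ γ ∘ₗ a).rTensor H (Coalgebra.comul h) := by
  simp only [localRight, LinearMap.sub_apply, LinearMap.comp_apply, LinearMap.lTensor_tmul,
    LinearMap.rTensor_tmul]
  congr 1
  generalize (Coalgebra.comul h : H ⊗[ℂ] H) = s
  induction s using TensorProduct.induction_on with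
  | zero => simp
  | tmul a b => simp
  | add x y hx hy => simp only [map_add, TensorProduct.tmul_add, hx, hy]

/-- Stated for any K of product form, so that one computation serves the projections to the overlap
from both charts. -/
theorem map_localLeft (K : S.BForm i ⊗[ℂ] H →ₐ[ℂ] R) (p : S.BForm i →ₐ[ℂ] R) (w : H →ₐ[ℂ] R)
    (hK : ∀ γ h, K (γ ⊗ₜ h) = p γ * w h) (a : H →ₗ[ℂ] S.BForm i) (γ : S.BForm i) (h : H) :
    K (S.localLeft a (γ ⊗ₜ h)) = p ((S.base i).d γ) * w h -
      p ((S.base i).parity γ) * conv (p.toLinearMap ∘ₗ a) w.toLinearMap h := by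
  rw [localLeft_tmul, map_sub, hK, conv_apply]
  congr 1
  generalize (Coalgebra.comul h : H ⊗[ℂ] H) = s
  induction s using TensorProduct.induction_on with
  | zero => simp
  | tmul a b => simp [hK, mul_assoc]
  | add x y hx hy => simp only [map_add, mul_add, hx, hy]

theorem map_localRight (K : S.BForm i ⊗[ℂ] H →ₐ[ℂ] R) (p : S.BForm i →ₐ[ℂ] R) (w : H →ₐ[ℂ] R)
    (hK : ∀ γ h, K (γ ⊗ₜ h) = p γ * w h) (hpw : ∀ γ h, Commute (p γ) (w h))
    (a : H →ₗ[ℂ] S.BForm i) (γ : S.BForm i) (h : H) :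
    K (S.localRight a (γ ⊗ₜ h)) = p ((S.base i).d γ) * w h -
      conv (p.toLinearMap ∘ₗ a) w.toLinearMap h * p γ := by
  rw [localRight_tmul, map_sub, hK, conv_apply]
  congr 1
  generalize (Coalgebra.comul h : H ⊗[ℂ] H) = s
  induction s using TensorProduct.induction_on with
  | zero => simp
  | tmul a b => simp [hK, mul_assoc, (hpw γ b).eq]
  | add x y hx hy => simp only [map_add, add_mul, hx, hy]

end Local

/-! ### Comparison of the local covariant derivatives on the overlaps -/

variable (i j : I)

/-- The map `γ ⊗ h ↦ ∑ γ τ_ij(h₁) ⊗ h₂` with values in the calculus on the overlap. -/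
def changeChart : S.BForm i ⊗[ℂ] H →ₗ[ℂ] S.Q i j ⊗[ℂ] H :=
  spread (S.baseLeft i j).toLinearMap (S.transQ i j)

theorem rTensor_projLeft_coE (γ : S.BForm i) (h : H) :
    (S.projLeft i j).toLinearMap.rTensor H (S.coE i (S.hIncl i (γ ⊗ₜ h))) =
      (LinearMap.mulLeft ℂ (S.baseLeft i j γ) ∘ₗ (S.fibreLeft i j).toLinearMap).rTensor H
        (Coalgebra.comul h) := by
  have h1 : S.coE i (S.hIncl i (γ ⊗ₜ h)) = _ := skewCoaction_horIncl (S.base i) S.fibre γ h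
  rw [h1, ← LinearMap.comp_apply, ← LinearMap.rTensor_comp]
  congr 2
  exact LinearMap.ext fun k => S.horLeft_tmul i j γ k

theorem rTensor_projRight_coE (γ : S.BForm j) (h : H) :
    (S.projRight i j).toLinearMap.rTensor H (S.coE j (S.hIncl j (γ ⊗ₜ h))) =
      (LinearMap.mulLeft ℂ (S.baseRight i j γ) ∘ₗ (S.fibreRight i j).toLinearMap).rTensor H
        (Coalgebra.comul h) := by
  have h1 : S.coE j (S.hIncl j (γ ⊗ₜ h)) = _ := skewCoaction_horIncl (S.base j) S.fibre γ h
  rw [h1, ← LinearMap.comp_apply, ← LinearMap.rTensor_comp]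
  congr 2
  exact LinearMap.ext fun k => S.horRight_tmul i j γ k

/-- The horizontal forms on the overlap are a tensor product of `Γ_m(B ij)` and `H`. -/
theorem changeChart_eq [Finite I] {x : S.BForm i ⊗[ℂ] H} {y : S.BForm j ⊗[ℂ] H}
    (hxy : S.horLeft i j x = S.horRight i j y) :
    S.changeChart i j x = (S.baseRight i j).toLinearMap.rTensor H y := by
  -- Applying the coaction and multiplying by w_j ∘ S turns γ w_j(h) into γ ⊗ h, since w_j * (w_j ∘
  -- S) = 1. The same recipe turns γ w_i(h) into ∑ γ τ_ij(h₁) ⊗ h₂, since w_i * (w_j ∘ S) = τ_ij.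
  let uS : H →ₗ[ℂ] S.Q i j := (S.fibreRight i j).toLinearMap ∘ₗ HopfAlgebra.antipode ℂ
  have hl : ∀ x, spread LinearMap.id uS
      ((S.projLeft i j).toLinearMap.rTensor H (S.coE i (S.hIncl i x))) = S.changeChart i j x := by
    intro x
    induction x using TensorProduct.induction_on with
    | zero => simp
    | tmul γ h =>
      rw [rTensor_projLeft_coE, spread_rTensor_comul, changeChart, spread_tmul]
      congr 2
      ext k
      rw [mulLeft_conv]
      exact congrArg (_ * ·) (LinearMap.congr_fun (congrArg ofConv (S.transQ_eq i j)) k).symm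
    | add x y hx hy => simp only [map_add, hx, hy]
  have hr : ∀ y, spread LinearMap.id uS
      ((S.projRight i j).toLinearMap.rTensor H (S.coE j (S.hIncl j y))) =
        (S.baseRight i j).toLinearMap.rTensor H y := by
    intro y
    induction y using TensorProduct.induction_on with
    | zero => simp
    | tmul γ h =>
      have h1 : conv (LinearMap.mulLeft ℂ (S.baseRight i j γ) ∘ₗ (S.fibreRight i j).toLinearMap) uS
          = LinearMap.toSpanSingleton ℂ _ (S.baseRight i j γ) ∘ₗ Coalgebra.counit := by
        ext k
        rw [mulLeft_conv]
        have h2 : conv (S.fibreRight i j).toLinearMap uS k =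
            algebraMap ℂ _ (Coalgebra.counit (R := ℂ) k) := LinearMap.congr_fun
          (congrArg ofConv (algHom_mul_antipode (S.fibreRight i j))) k
        rw [h2, ← Algebra.commutes, ← Algebra.smul_def]
        rfl
      rw [rTensor_projRight_coE, spread_rTensor_comul, h1, LinearMap.rTensor_comp,
        LinearMap.comp_apply, Coalgebra.rTensor_counit_comul]
      simp
    | add x y hx hy => simp only [map_add, hx, hy]
  rw [← hl, ← hr]
  exact congrArg _ (S.coE_overlap hxy)

variable (A : S.LocalFamily)

/-- The map `q ⊗ h ↦ dq h - (-1)ⁿ ∑ q A_j(h₁) h₂` on the overlap, where `H` is embedded by the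
`j`-th chart. -/
def overlapLeftDer : S.Q i j ⊗[ℂ] H →ₗ[ℂ] S.Q i j :=
  LinearMap.mul' ℂ _ ∘ₗ TensorProduct.map (S.dQ i j) (S.fibreRight i j).toLinearMap -
    LinearMap.mul' ℂ _ ∘ₗ TensorProduct.map (S.parQ i j)
      (conv ((S.baseRight i j).toLinearMap ∘ₗ S.formOf A j) (S.fibreRight i j).toLinearMap)

/-- The map `q ⊗ h ↦ dq h - ∑ A_j(h₁) h₂ q` on the overlap, where `H` is embedded by the
`j`-th chart. -/
def overlapRightDer : S.Q i j ⊗[ℂ] H →ₗ[ℂ] S.Q i j :=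
  LinearMap.mul' ℂ _ ∘ₗ TensorProduct.map (S.dQ i j) (S.fibreRight i j).toLinearMap -
    LinearMap.mul' ℂ _ ∘ₗ (TensorProduct.comm ℂ _ _).toLinearMap ∘ₗ
      TensorProduct.map LinearMap.id
        (conv ((S.baseRight i j).toLinearMap ∘ₗ S.formOf A j) (S.fibreRight i j).toLinearMap)

/-- The class of the chart-j derivative depends on y only through its image in `Q i j` ⊗ H, which
`changeChart_eq` expresses in chart i. -/
theorem horRight_localLeft (y : S.BForm j ⊗[ℂ] H) :
    S.horRight i j (S.localLeft (S.formOf A j) y) =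
      S.overlapLeftDer i j A ((S.baseRight i j).toLinearMap.rTensor H y) := by
  induction y using TensorProduct.induction_on with
  | zero => simp
  | tmul γ h =>
    rw [S.map_localLeft (S.horRight i j) (S.baseRight i j) (S.fibreRight i j)
      (S.horRight_tmul i j), ← dQ_baseRight, ← parQ_baseRight]
    rfl
  | add x y hx hy => simp only [map_add, hx, hy]

theorem horRight_localRight (y : S.BForm j ⊗[ℂ] H) :
    S.horRight i j (S.localRight (S.formOf A j) y) =
      S.overlapRightDer i j A ((S.baseRight i j).toLinearMap.rTensor H y) := by
  induction y using TensorProduct.induction_on with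
  | zero => simp
  | tmul γ h =>
    rw [S.map_localRight (S.horRight i j) (S.baseRight i j) (S.fibreRight i j)
      (S.horRight_tmul i j) (S.commute_baseRight i j), ← dQ_baseRight]
    rfl
  | add x y hx hy => simp only [map_add, hx, hy]

/-- The right hand side of the gauge transformation rule, convolved with the transition
function. -/
def gaugeTerm : H →ₗ[ℂ] S.Q i j :=
  conv (S.transQ i j) (conv ((S.baseRight i j).toLinearMap ∘ₗ S.formOf A j)
    (S.fibreRight i j).toLinearMap) -
    conv (S.dQ i j ∘ₗ S.transQ i j) (S.fibreRight i j).toLinearMap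

theorem gauge_iff_gaugeTerm [Finite I] :
    (S.πLeft i j).toLinearMap ∘ₗ S.formOf A i =
      conv (conv (S.embM i j ∘ₗ S.τ i j) ((S.πRight i j).toLinearMap ∘ₗ S.formOf A j))
        (S.embM i j ∘ₗ S.τ' i j) +
      conv (S.embM i j ∘ₗ S.τ i j) (S.dM i j ∘ₗ S.τ' i j) ↔
    conv ((S.baseLeft i j).toLinearMap ∘ₗ S.formOf A i) (S.fibreLeft i j).toLinearMap =
      S.gaugeTerm i j A := by
  rw [gauge_iff, mul_assoc]
  exact toConv_injective.eq_iff

theorem conv_fibreLeft [Finite I] (h : H) :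
    conv (S.transQ i j) (S.fibreRight i j).toLinearMap h = S.fibreLeft i j h :=
  (LinearMap.congr_fun (congrArg ofConv (S.fibreLeft_eq i j)) h).symm

/-- Expand d(γ τ_ij) by Leibniz. The terms in dγ recombine to dγ w_i(h); the terms in dτ_ij and A_j
make up the gauge term, behind the factor γ with its sign. -/
theorem overlapLeftDer_changeChart [Finite I] (γ : S.BForm i) (h : H) :
    S.overlapLeftDer i j A (S.changeChart i j (γ ⊗ₜ h)) =
      S.baseLeft i j ((S.base i).d γ) * S.fibreLeft i j h -
        S.baseLeft i j ((S.base i).parity γ) * S.gaugeTerm i j A h := by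
  have h1 : S.dQ i j ∘ₗ LinearMap.mulLeft ℂ (S.baseLeft i j γ) ∘ₗ S.transQ i j =
      LinearMap.mulLeft ℂ (S.baseLeft i j ((S.base i).d γ)) ∘ₗ S.transQ i j +
        LinearMap.mulLeft ℂ (S.baseLeft i j ((S.base i).parity γ)) ∘ₗ
          S.dQ i j ∘ₗ S.transQ i j := by
    ext k
    simp only [LinearMap.comp_apply, LinearMap.add_apply, LinearMap.mulLeft_apply, dQ_mul,
      dQ_baseLeft, parQ_baseLeft]
  have h2 : S.parQ i j ∘ₗ LinearMap.mulLeft ℂ (S.baseLeft i j γ) ∘ₗ S.transQ i j =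
      LinearMap.mulLeft ℂ (S.baseLeft i j ((S.base i).parity γ)) ∘ₗ S.transQ i j := by
    ext k
    simp only [LinearMap.comp_apply, LinearMap.mulLeft_apply, parQ_mul, parQ_baseLeft]
    congr 1
    exact (LinearMap.congr_fun (S.parQ_comp_transQ i j) _)
  have h3 : ∀ f g k : H →ₗ[ℂ] S.Q i j, conv (f + g) k h = conv f k h + conv g k h := fun f g k =>
    LinearMap.congr_fun (congrArg ofConv (add_mul (toConv f) (toConv g) (toConv k))) h
  rw [overlapLeftDer, changeChart, spread_tmul, LinearMap.sub_apply, LinearMap.comp_apply,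
    LinearMap.comp_apply, mul'_map_rTensor_comul, mul'_map_rTensor_comul]
  change conv (S.dQ i j ∘ₗ LinearMap.mulLeft ℂ (S.baseLeft i j γ) ∘ₗ S.transQ i j) _ h -
    conv (S.parQ i j ∘ₗ LinearMap.mulLeft ℂ (S.baseLeft i j γ) ∘ₗ S.transQ i j) _ h = _
  rw [h1, h2, h3, mulLeft_conv, mulLeft_conv, mulLeft_conv, conv_fibreLeft, gaugeTerm,
    LinearMap.sub_apply, mul_sub]
  abel

theorem conv_mem_commute {x : S.Q i j} (f : H →ₗ[ℂ] S.Q i j)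
    (hf : ∀ h, Commute (f h) x) (g : H →ₗ[ℂ] S.Q i j) (hg : ∀ h, Commute (g h) x) (h : H) :
    Commute (conv f g h) x := by
  rw [conv_apply]
  generalize (Coalgebra.comul h : H ⊗[ℂ] H) = s
  induction s using TensorProduct.induction_on with
  | zero => simp
  | tmul a b => exact (hf a).mul_left (hg b)
  | add x y hx hy => rw [map_add, map_add]; exact hx.add_left hy

theorem baseLeft_mem (γ : S.BForm i) : S.baseLeft i j γ ∈ S.Γm i j := S.projLeft_mem i j γ

theorem baseRight_mem (γ : S.BForm j) : S.baseRight i j γ ∈ S.Γm i j := S.projRight_mem i j γ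

/-- Here γ has to end up on the right of the gauge term. It is carried across τ_ij and w_j, which
commute with Γ_m, and across dτ_ij at the cost of a sign. -/
theorem overlapRightDer_changeChart [Finite I] (γ : S.BForm i) (h : H) :
    S.overlapRightDer i j A (S.changeChart i j (γ ⊗ₜ h)) =
      S.baseLeft i j ((S.base i).d γ) * S.fibreLeft i j h -
        S.gaugeTerm i j A h * S.baseLeft i j γ := by
  set c := S.baseLeft i j γ with hc
  have hcm : c ∈ S.Γm i j := S.baseLeft_mem i j γ
  -- Differentiate the relation that τ_ij commutes with γ, and cancel the terms in which τ_ij meets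
  -- dγ, with which it commutes as well.
  have hdt : ∀ k, S.baseLeft i j ((S.base i).parity γ) * S.dQ i j (S.transQ i j k) =
      S.dQ i j (S.transQ i j k) * c := fun k => by
    have h1 := congrArg (S.dQ i j) (S.commute_transQ i j hcm k).eq
    have h2 := (S.commute_transQ i j (S.baseLeft_mem i j ((S.base i).d γ)) k).eq
    have h3 : S.parQ i j (S.transQ i j k) = S.transQ i j k :=
      LinearMap.congr_fun (S.parQ_comp_transQ i j) k
    rw [dQ_mul, dQ_mul, h3, hc, dQ_baseLeft, parQ_baseLeft, h2,
      add_comm (S.baseLeft i j ((S.base i).d γ) * _)] at h1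
    exact (add_right_cancel h1).symm
  have h1 : ∀ s : H ⊗[ℂ] H, LinearMap.mul' ℂ _ (TensorProduct.map
      (S.dQ i j) (S.fibreRight i j).toLinearMap
        ((LinearMap.mulLeft ℂ c ∘ₗ S.transQ i j).rTensor H s)) =
      S.baseLeft i j ((S.base i).d γ) * LinearMap.mul' ℂ _ (TensorProduct.map
        (S.transQ i j) (S.fibreRight i j).toLinearMap s) +
      LinearMap.mul' ℂ _ (TensorProduct.map
        (S.dQ i j ∘ₗ S.transQ i j) (S.fibreRight i j).toLinearMap s) * c := by
    intro s
    induction s using TensorProduct.induction_on with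
    | zero => simp
    | tmul a b =>
      simp only [LinearMap.rTensor_tmul, TensorProduct.map_tmul, LinearMap.mul'_apply,
        LinearMap.comp_apply, LinearMap.mulLeft_apply, AlgHom.toLinearMap_apply, dQ_mul, add_mul]
      rw [hc, parQ_baseLeft, hdt, dQ_baseLeft, mul_assoc, mul_assoc, mul_assoc, ← hc,
        (S.commute_fibreRight i j hcm b).eq]
    | add x y hx hy => simp only [map_add, hx, hy, mul_add, add_mul]; abel
  have h2 : ∀ f : H →ₗ[ℂ] S.Q i j, (∀ a b, Commute (S.transQ i j a) (f b)) → ∀ s : H ⊗[ℂ] H,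
      LinearMap.mul' ℂ _ (TensorProduct.comm ℂ _ _ (TensorProduct.map
      (LinearMap.id : S.Q i j →ₗ[ℂ] S.Q i j) f
        ((LinearMap.mulLeft ℂ c ∘ₗ S.transQ i j).rTensor H s))) =
      LinearMap.mul' ℂ _ (TensorProduct.map (S.transQ i j) f s) * c := by
    intro f hf s
    induction s using TensorProduct.induction_on with
    | zero => simp
    | tmul a b =>
      simp only [LinearMap.rTensor_tmul, TensorProduct.map_tmul, LinearMap.mul'_apply,
        LinearMap.comp_apply, LinearMap.mulLeft_apply, TensorProduct.comm_tmul, LinearMap.id_apply]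
      rw [← (S.commute_transQ i j hcm a).eq, ← mul_assoc, (hf a b).eq]
    | add x y hx hy => simp only [map_add, hx, hy, add_mul]
  rw [overlapRightDer, changeChart, spread_tmul, LinearMap.sub_apply, LinearMap.comp_apply,
    LinearMap.comp_apply, LinearMap.comp_apply]
  refine (congrArg₂ (· - ·) (h1 _) (h2 _ (fun a b => ?_) _)).trans ?_
  -- The values of A_j lie in Γ_m, with which τ_ij commutes; τ_ij itself has values in Γ_m, with
  -- which w_j commutes.
  · refine (S.conv_mem_commute i j _ (fun k => ?_) _ (fun k => ?_) b).symm
    · exact (S.commute_transQ i j (S.baseRight_mem i j _) a).symm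
    · exact (S.commute_fibreRight i j (S.transQ_mem i j a) k).symm
  · rw [← conv_apply, ← conv_apply, ← conv_apply, conv_fibreLeft, gaugeTerm, LinearMap.sub_apply,
      sub_mul]
    abel

end DiffStructure

end Bundles

/-! ### Degrees of horizontal forms. -/

section Degree

open GradedTensorProduct

variable {A : Type u} [Ring A] [Algebra ℂ A] (Γ : DiffCalculus.{u, v} A)
variable {H : Type uH} [Ring H]

/-- The subspace `Γⁿ ⊗ H` of `Γ ⊗ H`. -/
def horDegree [Algebra ℂ H] (n : ℕ) : Submodule ℂ (Γ.Form ⊗[ℂ] H) :=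
  LinearMap.range ((Γ.gr n).subtype.rTensor H)

theorem tmul_mem_horDegree [Algebra ℂ H] {n : ℕ} {γ : Γ.Form} (hγ : γ ∈ Γ.gr n) (h : H) :
    γ ⊗ₜ h ∈ horDegree Γ (H := H) n := ⟨⟨γ, hγ⟩ ⊗ₜ h, rfl⟩

theorem horDegree_induction [Algebra ℂ H] {n : ℕ} {p : Γ.Form ⊗[ℂ] H → Prop} (h0 : p 0)
    (ht : ∀ γ ∈ Γ.gr n, ∀ h, p (γ ⊗ₜ h)) (ha : ∀ x y, p x → p y → p (x + y))
    {x : Γ.Form ⊗[ℂ] H} (hx : x ∈ horDegree Γ n) : p x := by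
  obtain ⟨t, rfl⟩ := hx
  induction t using TensorProduct.induction_on with
  | zero => simpa using h0
  | tmul γ h => exact ht γ γ.2 h
  | add x y hx hy => rw [map_add]; exact ha _ _ hx hy

theorem rTensor_mem_horDegree [Algebra ℂ H] {n : ℕ} {W : Type*} [AddCommGroup W] [Module ℂ W]
    (f : W →ₗ[ℂ] Γ.Form)
    (hf : ∀ w, f w ∈ Γ.gr n) (t : W ⊗[ℂ] H) : f.rTensor H t ∈ horDegree Γ n := by
  induction t using TensorProduct.induction_on with
  | zero => simp
  | tmul w h => exact tmul_mem_horDegree Γ (hf w) h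
  | add x y hx hy => rw [map_add]; exact add_mem hx hy

variable [Algebra ℂ H] (Θ : DiffCalculus.{uH, v'} H)

/-- The projection of the skew tensor product to the forms of fibre degree zero. -/
def fibreZero : Skew Γ Θ →ₗ[ℂ] Skew Γ Θ :=
  (of ℂ Γ.gr Θ.gr).toLinearMap ∘ₗ
    ((Θ.gr 0).subtype ∘ₗ DirectSum.component ℂ ℕ (fun n => Θ.gr n) 0 ∘ₗ
      (DirectSum.decomposeLinearEquiv Θ.gr).toLinearMap).lTensor Γ.Form ∘ₗ
      (of ℂ Γ.gr Θ.gr).symm.toLinearMap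

theorem fibreZero_tmul_of_mem (γ : Γ.Form) {ρ : Θ.Form} (hρ : ρ ∈ Θ.gr 0) :
    fibreZero Γ Θ (γ ᵍ⊗ₜ[ℂ] ρ) = γ ᵍ⊗ₜ[ℂ] ρ :=
  congrArg (fun x => (γ ᵍ⊗ₜ[ℂ] x : Skew Γ Θ)) (DirectSum.decompose_of_mem_same Θ.gr hρ)

theorem fibreZero_tmul_of_ne (γ : Γ.Form) {n : ℕ} (hn : n ≠ 0) {ρ : Θ.Form} (hρ : ρ ∈ Θ.gr n) :
    fibreZero Γ Θ (γ ᵍ⊗ₜ[ℂ] ρ) = 0 := by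
  refine (congrArg (fun x => (γ ᵍ⊗ₜ[ℂ] x : Skew Γ Θ))
    (DirectSum.decompose_of_mem_ne Θ.gr hρ hn)).trans ?_
  simp [tmul]

/-- The projection to fibre degree zero fixes horizontal forms and maps total degree n into Γⁿ ⊗ H;
injectivity of `horIncl` brings the result back to Γ ⊗ H. -/
theorem horIncl_mem_skewDegree_iff {n : ℕ} {x : Γ.Form ⊗[ℂ] H} :
    horIncl Γ Θ x ∈ skewDegree Γ Θ n ↔ x ∈ horDegree Γ n := by
  constructor
  · intro hx
    have h1 : fibreZero Γ Θ (horIncl Γ Θ x) = horIncl Γ Θ x := by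
      clear hx
      induction x using TensorProduct.induction_on with
      | zero => simp
      | tmul γ h => rw [horIncl_tmul, fibreZero_tmul_of_mem Γ Θ γ (Θ.emb_mem h)]
      | add x y hx hy => rw [map_add, map_add, hx, hy]
    have h2 : skewDegree Γ Θ n ≤
        ((horDegree Γ n).map (horIncl Γ Θ).toLinearMap).comap (fibreZero Γ Θ) := by
      refine iSup₂_le fun p hp => ?_
      rw [Submodule.map_le_iff_le_comap, Submodule.map₂_le]
      intro γ hγ ρ hρ
      rw [Submodule.mem_comap, Submodule.mem_comap]
      change fibreZero Γ Θ (γ ᵍ⊗ₜ[ℂ] ρ) ∈ _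
      have hpn : p.1 + p.2 = n := Finset.HasAntidiagonal.mem_antidiagonal.1 hp
      by_cases h0 : p.2 = 0
      · rw [h0] at hρ hpn
        rw [fibreZero_tmul_of_mem Γ Θ γ hρ]
        rw [← Θ.range_emb] at hρ
        obtain ⟨h, rfl⟩ := hρ
        exact ⟨γ ⊗ₜ h, tmul_mem_horDegree Γ (by rwa [← hpn]) h, horIncl_tmul Γ Θ γ h⟩
      · rw [fibreZero_tmul_of_ne Γ Θ γ h0 hρ]
        exact Submodule.zero_mem _
    have h3 := h2 hx
    rw [Submodule.mem_comap, h1] at h3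
    obtain ⟨y, hy, hyx⟩ := h3
    rwa [← horIncl_injective Γ Θ hyx]
  · intro hx
    refine horDegree_induction Γ (p := fun x => horIncl Γ Θ x ∈ skewDegree Γ Θ n) ?_ ?_ ?_ hx
    · rw [map_zero]; exact Submodule.zero_mem _
    · intro γ hγ h
      rw [horIncl_tmul]
      refine Submodule.mem_iSup_of_mem (n, 0) (Submodule.mem_iSup_of_mem
        (Finset.HasAntidiagonal.mem_antidiagonal.2 (add_zero n)) ?_)
      exact ⟨γ ⊗ₜ Θ.emb h, Submodule.apply_mem_map₂ _ hγ (Θ.emb_mem h), rfl⟩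
    · intro x y hx hy
      rw [map_add]; exact add_mem hx hy

end Degree

/-! ### The coaction on `V ⊗ H` -/

section FreeCoaction

variable {H : Type uH} [Ring H] [HopfAlgebra ℂ H] {V : Type*} [AddCommGroup V] [Module ℂ V]

/-- The coaction `id ⊗ Δ` on `V ⊗ H`. -/
def freeCoaction (V H : Type*) [Ring H] [HopfAlgebra ℂ H] [AddCommGroup V] [Module ℂ V] :
    V ⊗[ℂ] H →ₗ[ℂ] (V ⊗[ℂ] H) ⊗[ℂ] H :=
  (TensorProduct.assoc ℂ V H H).symm.toLinearMap ∘ₗ Coalgebra.comul.lTensor V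

theorem freeCoaction_tmul (x : V) (h : H) : freeCoaction V H (x ⊗ₜ h) =
    (TensorProduct.mk ℂ V H x).rTensor H (Coalgebra.comul h) := by
  rw [freeCoaction, LinearMap.comp_apply, LinearMap.lTensor_tmul]
  generalize (Coalgebra.comul h : H ⊗[ℂ] H) = s
  induction s using TensorProduct.induction_on with
  | zero => simp
  | tmul a b => rfl
  | add x y hx hy => simp only [TensorProduct.tmul_add, map_add, hx, hy]

/-- Coassociativity makes h ↦ ∑ f(h₁) ⊗ h₂ colinear for every f; it is the source of the covariance
of the local derivatives. -/
theorem freeCoaction_rTensor_comul (f : H →ₗ[ℂ] V) (h : H) :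
    freeCoaction V H (f.rTensor H (Coalgebra.comul h)) =
      (f.rTensor H ∘ₗ Coalgebra.comul).rTensor H (Coalgebra.comul h) := by
  have h1 : ∀ s : H ⊗[ℂ] H, freeCoaction V H (f.rTensor H s) = (f.rTensor H).rTensor H
      ((TensorProduct.assoc ℂ H H H).symm ((Coalgebra.comul : H →ₗ[ℂ] _).lTensor H s)) := by
    intro s
    induction s using TensorProduct.induction_on with
    | zero => simp
    | tmul a b =>
      rw [LinearMap.rTensor_tmul, freeCoaction_tmul, LinearMap.lTensor_tmul]
      generalize (Coalgebra.comul b : H ⊗[ℂ] H) = s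
      induction s using TensorProduct.induction_on with
      | zero => simp
      | tmul a b => rfl
      | add x y hx hy => simp only [TensorProduct.tmul_add, map_add, hx, hy]
    | add x y hx hy => simp only [map_add, hx, hy]
  rw [h1, Coalgebra.coassoc_symm_apply, LinearMap.rTensor_comp]
  rfl

theorem rTensor_counit_freeCoaction (y : V ⊗[ℂ] H) :
    (slice V (Coalgebra.counit : H →ₗ[ℂ] ℂ)).rTensor H (freeCoaction V H y) = y := by
  induction y using TensorProduct.induction_on with
  | zero => simp
  | tmul x h =>
    have h1 : slice V (Coalgebra.counit : H →ₗ[ℂ] ℂ) ∘ₗ TensorProduct.mk ℂ V H x =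
        LinearMap.toSpanSingleton ℂ V x ∘ₗ Coalgebra.counit := LinearMap.ext fun k => rfl
    rw [freeCoaction_tmul, ← LinearMap.comp_apply, ← LinearMap.rTensor_comp, h1,
      LinearMap.rTensor_comp, LinearMap.comp_apply, Coalgebra.rTensor_counit_comul]
    simp
  | add x y hx hy => rw [map_add, map_add, hx, hy]

theorem slice_freeCoaction (φ : H →ₗ[ℂ] ℂ) (y : V ⊗[ℂ] H) :
    slice _ φ (freeCoaction V H y) = (hit φ).lTensor V y :=
  slice_assoc_symm_lTensor_comul φ y

end FreeCoaction

section Bundles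

variable {H : Type uH} {B : Type uB} {P : Type uP} {I : Type w} [Ring H] [HopfAlgebra ℂ H] [Ring B]
  [Algebra ℂ B] [Ring P] [Algebra ℂ P]

namespace DiffStructure

open GradedTensorProduct WithConv

variable {X : Bundle H B P I} (S : DiffStructure.{v, v'} X)

/-! ### Components of horizontal forms -/

theorem hIncl_injective (i : I) : Function.Injective (S.hIncl i) := horIncl_injective _ _

theorem exists_comp (i : I) : ∃ c : S.hor →ₗ[ℂ] S.BForm i ⊗[ℂ] H,
    ∀ α, S.hIncl i (c α) = S.horProj i α := by
  obtain ⟨g, hg⟩ := (S.hIncl i).toLinearMap.exists_leftInverse_of_injective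
    (LinearMap.ker_eq_bot.2 (S.hIncl_injective i))
  refine ⟨g ∘ₗ S.horProj i, fun α => ?_⟩
  obtain ⟨x, hx⟩ := (S.mem_hor.1 α.2).2 i
  have h1 : S.horProj i α = (S.hIncl i).toLinearMap x := hx.symm
  rw [LinearMap.comp_apply, h1, ← LinearMap.comp_apply g, hg]
  rfl

/-- The `i`-th component of a horizontal form. -/
def comp (i : I) : S.hor →ₗ[ℂ] S.BForm i ⊗[ℂ] H := (S.exists_comp i).choose

theorem hIncl_comp (i : I) (α : S.hor) : S.hIncl i (S.comp i α) = S.horProj i α :=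
  (S.exists_comp i).choose_spec α

theorem comp_eq_iff {i : I} {α : S.hor} {x : S.BForm i ⊗[ℂ] H} :
    S.comp i α = x ↔ S.horProj i α = S.hIncl i x := by
  rw [← hIncl_comp, (S.hIncl_injective i).eq_iff]

theorem hor_ext {α β : S.hor} (h : ∀ i, S.comp i α = S.comp i β) : α = β := by
  refine Subtype.ext (funext fun i => ?_)
  have := congrArg (S.hIncl i) (h i)
  rwa [hIncl_comp, hIncl_comp] at this

theorem comp_mul (i : I) (α β : S.hor) : S.comp i (α * β) = S.comp i α * S.comp i β := by
  rw [comp_eq_iff, map_mul (S.hIncl i), hIncl_comp, hIncl_comp]; rfl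

theorem comp_one (i : I) : S.comp i 1 = 1 := by
  rw [comp_eq_iff, map_one (S.hIncl i)]; rfl

theorem comp_ιc (i : I) (γ : S.ΓcB) : S.comp i (S.ιc γ) = γ.1 i ⊗ₜ 1 := by
  rw [comp_eq_iff, hIncl_tmul_one]; rfl

theorem horLeft_comp (i j : I) (α : S.hor) :
    S.horLeft i j (S.comp i α) = S.horRight i j (S.comp j α) := by
  have h := (mem_completion_iff S.total_surjective).1 (S.mem_hor.1 α.2).1 i j
  change S.projLeft i j (S.hIncl i _) = S.projRight i j (S.hIncl j _)
  rw [hIncl_comp, hIncl_comp]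
  exact h

/-- Together with `hor_ext` this identifies horizontal forms with families in Γ(B_i) ⊗ H that agree
on the overlaps. -/
theorem exists_of_comp (x : ∀ i, S.BForm i ⊗[ℂ] H)
    (hx : ∀ i j, S.horLeft i j (x i) = S.horRight i j (x j)) :
    ∃ α : S.hor, ∀ i, S.comp i α = x i := by
  refine ⟨⟨fun i => S.hIncl i (x i), S.mem_hor.2 ⟨?_, fun i => ⟨x i, rfl⟩⟩⟩, fun i => ?_⟩
  · exact (mem_completion_iff S.total_surjective).2 hx
  · rw [comp_eq_iff]; rfl

theorem horDegree_iff {n : ℕ} {α : S.hor} :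
    S.HorDegree n α ↔ ∀ i, S.comp i α ∈ horDegree (S.base i) n := by
  refine forall_congr' fun i => ?_
  rw [← hIncl_comp]
  exact horIncl_mem_skewDegree_iff _ _

/-! ### Lifting local forms -/

/-- Γ(B) is spanned by monomials in b and db, each of the same degree in all charts, so taking the
degree n part componentwise preserves it. The homogeneous lift is needed because the left Leibniz
rule speaks of homogeneous γ. -/
theorem exists_homogeneous_lift (i : I) {n : ℕ} {γ : S.BForm i} (hγ : γ ∈ (S.base i).gr n) :
    ∃ γ' : S.ΓcB, S.BaseDegree n γ' ∧ γ'.1 i = γ := by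
  let pr : ∀ n k, S.BForm k →ₗ[ℂ] S.BForm k := fun n k =>
    ((S.base k).gr n).subtype ∘ₗ DirectSum.component ℂ ℕ (fun n => (S.base k).gr n) n ∘ₗ
      (DirectSum.decomposeLinearEquiv (S.base k).gr).toLinearMap
  have pr_same : ∀ n k (x : S.BForm k), x ∈ (S.base k).gr n → pr n k x = x :=
    fun n k x hx => DirectSum.decompose_of_mem_same _ hx
  have pr_ne : ∀ m n k (x : S.BForm k), m ≠ n → x ∈ (S.base k).gr m → pr n k x = 0 :=
    fun m n k x hmn hx => DirectSum.decompose_of_mem_ne _ hx hmn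
  have hmon : ∀ y ∈ Submonoid.closure ((Set.range fun (b : B) k => S.baseMap k b) ∪
      Set.range fun (b : B) k => S.dB k (S.baseMap k b)),
      ∃ m, ∀ k, y k ∈ (S.base k).gr m := by
    intro y hy
    induction hy using Submonoid.closure_induction with
    | mem y hy =>
      obtain (⟨b, rfl⟩ | ⟨b, rfl⟩) := hy
      · exact ⟨0, fun k => (S.base k).emb_mem _⟩
      · exact ⟨1, fun k => (S.base k).d_mem ((S.base k).emb_mem _)⟩
    | one => exact ⟨0, fun k => (S.base k).one_mem⟩
    | mul x y _ _ hx hy =>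
      obtain ⟨m, hm⟩ := hx
      obtain ⟨l, hl⟩ := hy
      exact ⟨m + l, fun k => SetLike.mul_mem_graded (hm k) (hl k)⟩
  have hpr : ∀ y ∈ S.ΓB, (fun k => pr n k (y k)) ∈ S.ΓB := by
    intro y hy
    have hy' : y ∈ Submodule.span ℂ (Submonoid.closure
        ((Set.range fun (b : B) k => S.baseMap k b) ∪
          Set.range fun (b : B) k => S.dB k (S.baseMap k b)) : Set (∀ k, S.BForm k)) := by
      rw [← Algebra.adjoin_eq_span]; exact hy
    clear hy
    induction hy' using Submodule.span_induction with
    | mem y hy =>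
      obtain ⟨m, hm⟩ := hmon y hy
      by_cases hmn : m = n
      · subst hmn
        have : (fun k => pr m k (y k)) = y := funext fun k => pr_same m k _ (hm k)
        rw [this]
        have hy2 : y ∈ Subalgebra.toSubmodule S.ΓB := by
          change y ∈ Subalgebra.toSubmodule (Algebra.adjoin ℂ _)
          rw [Algebra.adjoin_eq_span]; exact Submodule.subset_span hy
        exact hy2
      · have : (fun k => pr n k (y k)) = 0 := funext fun k => pr_ne m n k _ hmn (hm k)
        rw [this]
        exact S.ΓB.zero_mem
    | zero => simp only [Pi.zero_apply, map_zero]; exact S.ΓB.zero_mem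
    | add x y _ _ hx hy => simp only [Pi.add_apply, map_add]; exact S.ΓB.add_mem hx hy
    | smul c x _ hx => simp only [Pi.smul_apply, map_smul]; exact S.ΓB.smul_mem hx c
  obtain ⟨y, hy⟩ := S.base_surjective i γ
  refine ⟨⟨fun k => pr n k (y.1 k), ?_⟩, fun k => Submodule.coe_mem _, ?_⟩
  · rw [mem_completion_iff_exists]
    exact fun k l => ⟨⟨_, hpr y.1 y.2⟩, rfl, rfl⟩
  · change pr n i (adaptedProj _ _ i y) = γ
    rw [hy]
    exact pr_same n i γ hγ

theorem exists_lift (i : I) (γ : S.BForm i) : ∃ γ' : S.ΓcB, γ'.1 i = γ := by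
  obtain ⟨y, hy⟩ := S.base_surjective i γ
  exact ⟨⟨y.1, by rw [mem_completion_iff_exists]; exact fun k l => ⟨y, rfl, rfl⟩⟩, hy⟩

/-- The image of an element of `P` in the horizontal forms. -/
theorem exists_ofTotal (p : P) : ∃ α : S.hor,
    ∀ i, S.comp i α = Algebra.TensorProduct.map (S.base i).emb (AlgHom.id ℂ H) (X.χ i p) :=
  S.exists_of_comp (fun i => Algebra.TensorProduct.map (S.base i).emb (AlgHom.id ℂ H) (X.χ i p))
    fun i j => S.projLeft_totalMap i j p

/-- The lift is taken from P, so it has degree zero in every chart and not only in the i-th. -/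
theorem exists_fibre_lift (i : I) (h : H) :
    ∃ α : S.hor, S.HorDegree 0 α ∧ S.comp i α = 1 ⊗ₜ h := by
  obtain ⟨α, hα⟩ := S.exists_ofTotal (X.sect i (1 ⊗ₜ h))
  refine ⟨α, S.horDegree_iff.2 fun k => ?_, ?_⟩
  · rw [hα]
    exact rTensor_mem_horDegree (S.base k) (S.base k).emb.toLinearMap (S.base k).emb_mem _
  · rw [hα, X.χ_sect]; simp

theorem comp_surjective (i : I) : Function.Surjective (S.comp i) := by
  intro x
  induction x using TensorProduct.induction_on with
  | zero => exact ⟨0, map_zero _⟩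
  | tmul γ h =>
    obtain ⟨γ', hγ'⟩ := S.exists_lift i γ
    obtain ⟨α, -, hα⟩ := S.exists_fibre_lift i h
    refine ⟨S.ιc γ' * α, ?_⟩
    rw [comp_mul, comp_ιc, hγ', hα, Algebra.TensorProduct.tmul_mul_tmul, one_mul, mul_one]
  | add x y hx hy =>
    obtain ⟨α, rfl⟩ := hx
    obtain ⟨β, rfl⟩ := hy
    exact ⟨α + β, map_add _ _ _⟩

/-! ### The coaction on horizontal forms -/

theorem coE_hIncl (i : I) (x : S.BForm i ⊗[ℂ] H) : S.coE i (S.hIncl i x) =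
    (S.hIncl i).toLinearMap.rTensor H (freeCoaction _ H x) := by
  induction x using TensorProduct.induction_on with
  | zero => simp
  | tmul γ h =>
    have h1 : S.coE i (S.hIncl i (γ ⊗ₜ h)) = _ := skewCoaction_horIncl (S.base i) S.fibre γ h
    rw [h1, freeCoaction_tmul, LinearMap.rTensor_comp]
    rfl
  | add x y hx hy => simp only [map_add, hx, hy]

theorem isCoactionOf_iff {α : S.hor} {t : S.hor ⊗[ℂ] H} : S.IsCoactionOf α t ↔
    ∀ i, (S.comp i).rTensor H t = freeCoaction _ H (S.comp i α) := by
  have h1 : ∀ i, (S.horProj i).rTensor H t =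
      (S.hIncl i).toLinearMap.rTensor H ((S.comp i).rTensor H t) := fun i => by
    rw [← LinearMap.comp_apply, ← LinearMap.rTensor_comp]
    congr 2
    exact LinearMap.ext fun α => (S.hIncl_comp i α).symm
  refine forall_congr' fun i => ?_
  rw [h1, ← hIncl_comp, coE_hIncl]
  exact (Module.Flat.rTensor_preserves_injective_linearMap (M := H) (S.hIncl i).toLinearMap
    (S.hIncl_injective i)).eq_iff

/-- The coaction descends to the overlaps, so its slices by φ in the various charts fit together. -/
theorem exists_hit (φ : H →ₗ[ℂ] ℂ) (α : S.hor) :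
    ∃ β : S.hor, ∀ i, S.comp i β = (hit φ).lTensor _ (S.comp i α) := by
  refine S.exists_of_comp _ fun i j => ?_
  have h2 := (mem_completion_iff S.total_surjective).1 (S.mem_hor.1 α.2).1 i j
  have h3 := congrArg (slice _ φ) (S.coE_overlap (a := S.horProj i α) (b := S.horProj j α) h2)
  rw [← hIncl_comp, ← hIncl_comp, coE_hIncl, coE_hIncl, slice_rTensor, slice_rTensor, slice_rTensor, slice_rTensor, slice_freeCoaction,
    slice_freeCoaction] at h3
  exact h3

/-- The coefficients along a basis of H are global horizontal forms by `exists_hit`. Since there are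
finitely many charts, finitely many basis vectors suffice for all components together, and the sum
is a genuine tensor. -/
theorem exists_coaction [Finite I] (α : S.hor) : ∃ t, S.IsCoactionOf α t := by
  classical
  have := Fintype.ofFinite I
  let 𝒞 := Module.Basis.ofVectorSpace ℂ H
  let x : ∀ i, (S.BForm i ⊗[ℂ] H) ⊗[ℂ] H := fun i => freeCoaction _ H (S.comp i α)
  let supp : Finset (Module.Basis.ofVectorSpaceIndex ℂ H) :=
    Finset.univ.biUnion fun i => (TensorProduct.equivFinsuppOfBasisRight 𝒞 (x i)).support
  choose β hβ using fun k => S.exists_hit (𝒞.coord k) α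
  refine ⟨∑ k ∈ supp, β k ⊗ₜ 𝒞 k, S.isCoactionOf_iff.2 fun i => ?_⟩
  apply (TensorProduct.equivFinsuppOfBasisRight 𝒞).injective
  ext k
  have h1 : ∀ k, TensorProduct.equivFinsuppOfBasisRight 𝒞 (x i) k = S.comp i (β k) := fun k => by
    rw [TensorProduct.equivFinsuppOfBasisRight_apply, hβ, ← slice_freeCoaction]
    rfl
  change _ = TensorProduct.equivFinsuppOfBasisRight 𝒞 (x i) k
  rw [map_sum, map_sum, Finsupp.finsetSum_apply]
  simp only [LinearMap.rTensor_tmul, TensorProduct.equivFinsuppOfBasisRight_apply_tmul_apply,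
    Module.Basis.repr_self, Finsupp.single_apply, ite_smul, one_smul, zero_smul]
  rw [Finset.sum_ite_eq']
  split_ifs with hk
  · exact (h1 k).symm
  · have : k ∉ (TensorProduct.equivFinsuppOfBasisRight 𝒞 (x i)).support := fun hk' =>
      hk (Finset.mem_biUnion.2 ⟨i, Finset.mem_univ i, hk'⟩)
    exact (Finsupp.notMem_support_iff.1 this).symm

end DiffStructure

end Bundles

section Bundles

variable {H : Type uH} {B : Type uB} {P : Type uP} {I : Type w} [Ring H] [HopfAlgebra ℂ H] [Ring B]
  [Algebra ℂ B] [Ring P] [Algebra ℂ P]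

namespace DiffStructure

open GradedTensorProduct WithConv

variable {X : Bundle H B P I} (S : DiffStructure.{v, v'} X)

/-! ### Properties of the local covariant derivatives -/

section Local

variable {i : I} (a : H →ₗ[ℂ] S.BForm i)

theorem localLeft_mul {n : ℕ} {γ : S.BForm i} (hγ : γ ∈ (S.base i).gr n) (x : S.BForm i ⊗[ℂ] H) :
    S.localLeft a ((γ ⊗ₜ 1) * x) =
      ((S.base i).d γ ⊗ₜ 1) * x + (-1 : ℂ) ^ n • ((γ ⊗ₜ 1) * S.localLeft a x) := by
  induction x using TensorProduct.induction_on with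
  | zero => simp
  | tmul ω h =>
    rw [Algebra.TensorProduct.tmul_mul_tmul, one_mul, localLeft_tmul, localLeft_tmul,
      Algebra.TensorProduct.tmul_mul_tmul, one_mul, (S.base i).d_mul, (S.base i).parity_mul,
      (S.base i).parity_apply hγ, mul_sub, Algebra.TensorProduct.tmul_mul_tmul, one_mul,
      TensorProduct.add_tmul, add_sub_assoc, smul_sub, smul_mul_assoc, TensorProduct.smul_tmul']
    congr 2
    generalize (Coalgebra.comul h : H ⊗[ℂ] H) = s
    induction s using TensorProduct.induction_on with
    | zero => simp
    | tmul a b => simp [mul_assoc, TensorProduct.smul_tmul']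
    | add x y hx hy => simp only [map_add, hx, hy, mul_add, smul_add]
  | add x y hx hy => simp only [mul_add, map_add, hx, hy, smul_add]; abel

theorem localRight_mul {n : ℕ} {x : S.BForm i ⊗[ℂ] H} (hx : x ∈ horDegree (S.base i) n)
    (γ : S.BForm i) :
    S.localRight a (x * (γ ⊗ₜ 1)) =
      S.localRight a x * (γ ⊗ₜ 1) + (-1 : ℂ) ^ n • (x * ((S.base i).d γ ⊗ₜ 1)) := by
  refine horDegree_induction (S.base i) (p := fun x => S.localRight a (x * (γ ⊗ₜ 1)) =
      S.localRight a x * (γ ⊗ₜ 1) + (-1 : ℂ) ^ n • (x * ((S.base i).d γ ⊗ₜ 1))) ?_ ?_ ?_ hx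
  · simp
  · intro ω hω h
    rw [Algebra.TensorProduct.tmul_mul_tmul, mul_one, localRight_tmul, localRight_tmul,
      Algebra.TensorProduct.tmul_mul_tmul, mul_one, (S.base i).d_mul,
      (S.base i).parity_apply hω, sub_mul, Algebra.TensorProduct.tmul_mul_tmul, mul_one,
      TensorProduct.add_tmul, smul_mul_assoc, TensorProduct.smul_tmul', sub_add_eq_add_sub]
    congr 1
    generalize (Coalgebra.comul h : H ⊗[ℂ] H) = s
    induction s using TensorProduct.induction_on with
    | zero => simp
    | tmul a b => simp [mul_assoc]
    | add x y hx hy => simp only [map_add, hx, hy, add_mul]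
  · intro x y hx hy
    simp only [add_mul, map_add, hx, hy, smul_add]; abel

theorem localLeft_mem {n : ℕ} (ha : ∀ h, a h ∈ (S.base i).gr 1) {x : S.BForm i ⊗[ℂ] H}
    (hx : x ∈ horDegree (S.base i) n) : S.localLeft a x ∈ horDegree (S.base i) (n + 1) := by
  refine horDegree_induction (S.base i)
    (p := fun x => S.localLeft a x ∈ horDegree (S.base i) (n + 1)) ?_ ?_ ?_ hx
  · rw [map_zero]; exact Submodule.zero_mem _
  · intro γ hγ h
    rw [localLeft_tmul]
    refine sub_mem (tmul_mem_horDegree _ ((S.base i).d_mem hγ) h)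
      (rTensor_mem_horDegree _ _ (fun k => ?_) _)
    exact SetLike.mul_mem_graded ((S.base i).parity_mem hγ) (ha k)
  · intro x y hx hy
    rw [map_add]; exact add_mem hx hy

theorem localRight_mem {n : ℕ} (ha : ∀ h, a h ∈ (S.base i).gr 1) {x : S.BForm i ⊗[ℂ] H}
    (hx : x ∈ horDegree (S.base i) n) : S.localRight a x ∈ horDegree (S.base i) (n + 1) := by
  refine horDegree_induction (S.base i)
    (p := fun x => S.localRight a x ∈ horDegree (S.base i) (n + 1)) ?_ ?_ ?_ hx
  · rw [map_zero]; exact Submodule.zero_mem _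
  · intro γ hγ h
    rw [localRight_tmul]
    refine sub_mem (tmul_mem_horDegree _ ((S.base i).d_mem hγ) h)
      (rTensor_mem_horDegree _ _ (fun k => ?_) _)
    -- The one-form stands to the left of γ, so the product has degree 1 + n.
    rw [add_comm n 1]
    exact SetLike.mul_mem_graded (ha k) hγ
  · intro x y hx hy
    rw [map_add]; exact add_mem hx hy

theorem localLeft_one_tmul (h : H) :
    S.localLeft a (1 ⊗ₜ h) = -a.rTensor H (Coalgebra.comul h) := by
  rw [localLeft_tmul, (S.base i).d_one, (S.base i).parity_one, LinearMap.mulLeft_one,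
    LinearMap.id_comp, TensorProduct.zero_tmul, zero_sub]

theorem localRight_one_tmul (h : H) :
    S.localRight a (1 ⊗ₜ h) = -a.rTensor H (Coalgebra.comul h) := by
  rw [localRight_tmul, (S.base i).d_one, LinearMap.mulRight_one,
    LinearMap.id_comp, TensorProduct.zero_tmul, zero_sub]

theorem evalCounit_rTensor_comul (h : H) :
    S.evalCounit i (a.rTensor H (Coalgebra.comul h)) = a h := by
  change slice _ Coalgebra.counit _ = _
  rw [slice_rTensor, slice, LinearMap.comp_apply, Coalgebra.lTensor_counit_comul]
  simp

/-- Each of the two terms affects H by the identity or by splitting it with the coproduct, so the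
operator is colinear. The form of `hD` covers the left and the right derivative. -/
theorem freeCoaction_of_tmul (D : S.BForm i ⊗[ℂ] H →ₗ[ℂ] S.BForm i ⊗[ℂ] H)
    (c : S.BForm i → S.BForm i) (f : S.BForm i → H →ₗ[ℂ] S.BForm i)
    (hD : ∀ γ h, D (γ ⊗ₜ h) = c γ ⊗ₜ h - (f γ).rTensor H (Coalgebra.comul h))
    (x : S.BForm i ⊗[ℂ] H) :
    D.rTensor H (freeCoaction _ H x) = freeCoaction _ H (D x) := by
  induction x using TensorProduct.induction_on with
  | zero => simp
  | tmul γ h =>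
    have h1 : D ∘ₗ TensorProduct.mk ℂ (S.BForm i) H γ =
        TensorProduct.mk ℂ (S.BForm i) H (c γ) - (f γ).rTensor H ∘ₗ Coalgebra.comul :=
      LinearMap.ext fun k => hD γ k
    rw [hD, map_sub, freeCoaction_rTensor_comul, freeCoaction_tmul, freeCoaction_tmul,
      ← LinearMap.comp_apply, ← LinearMap.rTensor_comp, h1, LinearMap.rTensor_sub]
    rfl
  | add x y hx hy => simp only [map_add, hx, hy]

end Local

/-! ### From local to global -/

theorem isGluedFrom_iff {D : S.hor →ₗ[ℂ] S.hor}
    {Dloc : ∀ i, S.BForm i ⊗[ℂ] H →ₗ[ℂ] S.BForm i ⊗[ℂ] H} :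
    S.IsGluedFrom D Dloc ↔ ∀ i α, S.comp i (D α) = Dloc i (S.comp i α) := by
  refine forall_congr' fun i => forall_congr' fun α => ⟨fun h => ?_, fun h x hx => ?_⟩
  · exact S.comp_eq_iff.2 (h _ (S.hIncl_comp i α).symm)
  · rw [← S.comp_eq_iff] at hx ⊢
    rw [h, hx]

theorem exists_isGluedFrom (Dloc : ∀ i, S.BForm i ⊗[ℂ] H →ₗ[ℂ] S.BForm i ⊗[ℂ] H)
    (h : ∀ i j x y, S.horLeft i j x = S.horRight i j y →
      S.horLeft i j (Dloc i x) = S.horRight i j (Dloc j y)) :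
    ∃ D : S.hor →ₗ[ℂ] S.hor, S.IsGluedFrom D Dloc := by
  choose D hD using fun α : S.hor => S.exists_of_comp (fun i => Dloc i (S.comp i α))
    fun i j => h i j _ _ (S.horLeft_comp i j α)
  refine ⟨{ toFun := D, map_add' := fun α β => ?_, map_smul' := fun c α => ?_ },
    S.isGluedFrom_iff.2 fun i α => hD α i⟩
  · exact S.hor_ext fun i => by simp only [hD, map_add]
  · exact S.hor_ext fun i => by simp only [hD, map_smul, RingHom.id_apply]

section Glued

variable {S} {D : S.hor →ₗ[ℂ] S.hor}
  {Dloc : ∀ i, S.BForm i ⊗[ℂ] H →ₗ[ℂ] S.BForm i ⊗[ℂ] H}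

theorem IsGluedFrom.raisesDegree (hD : S.IsGluedFrom D Dloc)
    (h : ∀ i n x, x ∈ horDegree (S.base i) n →
    Dloc i x ∈ horDegree (S.base i) (n + 1)) : S.RaisesDegree D := fun n α hα => by
  rw [horDegree_iff] at hα ⊢
  intro i
  rw [S.isGluedFrom_iff.1 hD]
  exact h i n _ (hα i)

theorem IsGluedFrom.killsOne (hD : S.IsGluedFrom D Dloc) (h : ∀ i, Dloc i (1 ⊗ₜ 1) = 0) : S.KillsOne D :=
  S.hor_ext fun i => by
    rw [S.isGluedFrom_iff.1 hD, comp_one, map_zero]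
    exact h i

theorem IsGluedFrom.preservesKernels (hD : S.IsGluedFrom D Dloc) : S.PreservesKernels D := fun i α hα => by
  have h : S.comp i α = 0 := S.comp_eq_iff.2 (by rw [hα, map_zero])
  rw [← hIncl_comp, S.isGluedFrom_iff.1 hD, h, map_zero, map_zero]

theorem IsGluedFrom.isCovariant [Finite I] (hD : S.IsGluedFrom D Dloc)
    (h : ∀ i x, (Dloc i).rTensor H (freeCoaction _ H x) = freeCoaction _ H (Dloc i x)) :
    S.IsCovariant D := fun α => by
  obtain ⟨t, ht⟩ := S.exists_coaction α
  refine ⟨t, ht, S.isCoactionOf_iff.2 fun i => ?_⟩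
  have h1 : S.comp i ∘ₗ D = Dloc i ∘ₗ S.comp i := LinearMap.ext (S.isGluedFrom_iff.1 hD i)
  rw [← LinearMap.comp_apply, ← LinearMap.rTensor_comp, h1, LinearMap.rTensor_comp,
    LinearMap.comp_apply, S.isCoactionOf_iff.1 ht, h, S.isGluedFrom_iff.1 hD]

end Glued

theorem leftLeibniz_iff {D : S.hor →ₗ[ℂ] S.hor} : S.LeftLeibniz D ↔
    ∀ n (γ : S.ΓcB), S.BaseDegree n γ → ∀ α i, S.comp i (D (S.ιc γ * α)) =
      ((S.base i).d (γ.1 i) ⊗ₜ 1) * S.comp i α +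
        (-1 : ℂ) ^ n • ((γ.1 i ⊗ₜ 1) * S.comp i (D α)) := by
  refine forall_congr' fun n => forall_congr' fun γ => forall_congr' fun hγ =>
    forall_congr' fun α => ?_
  rw [funext_iff]
  refine forall_congr' fun i => ?_
  rw [comp_eq_iff, map_add (S.hIncl i), map_mul (S.hIncl i), map_smul (S.hIncl i),
    map_mul (S.hIncl i), hIncl_tmul_one, hIncl_tmul_one, hIncl_comp, hIncl_comp, ← dE_left]
  rfl

theorem rightLeibniz_iff {D : S.hor →ₗ[ℂ] S.hor} : S.RightLeibniz D ↔
    ∀ n (α : S.hor), S.HorDegree n α → ∀ (γ : S.ΓcB) i, S.comp i (D (α * S.ιc γ)) =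
      S.comp i (D α) * (γ.1 i ⊗ₜ 1) +
        (-1 : ℂ) ^ n • (S.comp i α * ((S.base i).d (γ.1 i) ⊗ₜ 1)) := by
  refine forall_congr' fun n => forall_congr' fun α => forall_congr' fun hα =>
    forall_congr' fun γ => ?_
  rw [funext_iff]
  refine forall_congr' fun i => ?_
  rw [comp_eq_iff, map_add (S.hIncl i), map_mul (S.hIncl i), map_smul (S.hIncl i),
    map_mul (S.hIncl i), hIncl_tmul_one, hIncl_tmul_one, hIncl_comp, hIncl_comp, ← dE_left]
  rfl

-- `changeChart_eq` turns the chart-j side into a function of x, which is evaluated on γ ⊗ h; there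
-- the gauge rule is exactly what is missing for equality with the chart-i side.
variable {S} in
theorem IsCompatible.horLeft_localLeft [Finite I] {A : S.LocalFamily} (hA : S.IsCompatible A)
    {i j : I} {x : S.BForm i ⊗[ℂ] H} {y : S.BForm j ⊗[ℂ] H}
    (h : S.horLeft i j x = S.horRight i j y) :
    S.horLeft i j (S.localLeft (S.formOf A i) x) =
      S.horRight i j (S.localLeft (S.formOf A j) y) := by
  rw [horRight_localLeft, ← S.changeChart_eq i j h]
  clear h
  induction x using TensorProduct.induction_on with
  | zero => simp
  | tmul γ h =>
    rw [S.map_localLeft (S.horLeft i j) (S.baseLeft i j) (S.fibreLeft i j)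
      (S.horLeft_tmul i j), overlapLeftDer_changeChart,
      (S.gauge_iff_gaugeTerm i j A).1 (hA.gauge i j)]
  | add x y hx hy => simp only [map_add, hx, hy]

variable {S} in
theorem IsCompatible.horLeft_localRight [Finite I] {A : S.LocalFamily} (hA : S.IsCompatible A)
    {i j : I} {x : S.BForm i ⊗[ℂ] H} {y : S.BForm j ⊗[ℂ] H}
    (h : S.horLeft i j x = S.horRight i j y) :
    S.horLeft i j (S.localRight (S.formOf A i) x) =
      S.horRight i j (S.localRight (S.formOf A j) y) := by
  rw [horRight_localRight, ← S.changeChart_eq i j h]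
  clear h
  induction x using TensorProduct.induction_on with
  | zero => simp
  | tmul γ h =>
    rw [S.map_localRight (S.horLeft i j) (S.baseLeft i j) (S.fibreLeft i j)
      (S.horLeft_tmul i j) (S.commute_baseLeft i j), overlapRightDer_changeChart,
      (S.gauge_iff_gaugeTerm i j A).1 (hA.gauge i j)]
  | add x y hx hy => simp only [map_add, hx, hy]

theorem formOf_mem (A : S.LocalFamily) (i : I) (h : H) : S.formOf A i h ∈ (S.base i).gr 1 :=
  (A i h).2

variable {S} in
theorem IsCompatible.rTensor_comul_one {A : S.LocalFamily} (hA : S.IsCompatible A) (i : I) :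
    -(S.formOf A i).rTensor H (Coalgebra.comul (1 : H)) = 0 := by
  have : S.formOf A i 1 = 0 := congrArg Subtype.val (hA.map_one i)
  rw [Bialgebra.comul_one, Algebra.TensorProduct.one_def, LinearMap.rTensor_tmul, this,
    TensorProduct.zero_tmul, neg_zero]

variable {S} in
theorem IsCompatible.exists_isLeftCovDer [Finite I] {A : S.LocalFamily} (hA : S.IsCompatible A) :
    ∃ D, S.IsLeftCovDer D ∧ S.IsGluedFrom D fun i => S.localLeft (S.formOf A i) := by
  obtain ⟨D, hD⟩ := S.exists_isGluedFrom (fun i => S.localLeft (S.formOf A i))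
    fun i j x y h => hA.horLeft_localLeft h
  refine ⟨D, ⟨?_, ?_, ?_, ?_, hD.preservesKernels⟩, hD⟩
  · exact hD.raisesDegree fun i n x hx => S.localLeft_mem _ (S.formOf_mem A i) hx
  · exact hD.killsOne fun i => by rw [localLeft_one_tmul]; exact hA.rTensor_comul_one i
  · refine S.leftLeibniz_iff.2 fun n γ hγ α i => ?_
    rw [S.isGluedFrom_iff.1 hD, S.isGluedFrom_iff.1 hD, comp_mul, comp_ιc]
    exact S.localLeft_mul _ (hγ i) _
  · exact hD.isCovariant fun i x => S.freeCoaction_of_tmul _ _ _ (S.localLeft_tmul _) x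

variable {S} in
theorem IsCompatible.exists_isRightCovDer [Finite I] {A : S.LocalFamily} (hA : S.IsCompatible A) :
    ∃ D, S.IsRightCovDer D ∧ S.IsGluedFrom D fun i => S.localRight (S.formOf A i) := by
  obtain ⟨D, hD⟩ := S.exists_isGluedFrom (fun i => S.localRight (S.formOf A i))
    fun i j x y h => hA.horLeft_localRight h
  refine ⟨D, ⟨?_, ?_, ?_, ?_, hD.preservesKernels⟩, hD⟩
  · exact hD.raisesDegree fun i n x hx => S.localRight_mem _ (S.formOf_mem A i) hx
  · exact hD.killsOne fun i => by rw [localRight_one_tmul]; exact hA.rTensor_comul_one i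
  · refine S.rightLeibniz_iff.2 fun n α hα γ i => ?_
    rw [S.isGluedFrom_iff.1 hD, S.isGluedFrom_iff.1 hD, comp_mul, comp_ιc]
    exact S.localRight_mul _ (S.horDegree_iff.1 hα i) _
  · exact hD.isCovariant fun i x => S.freeCoaction_of_tmul _ _ _ (S.localRight_tmul _) x

/-! ### From global to local -/

/-- Preservation of kernels gives D_i, since the component maps are onto. Covariance makes D_i
colinear on 1 ⊗ h, so these values are recovered from their counit slices, and the degree condition
puts the slices in Γ¹(B_i). -/
theorem exists_local {D : S.hor →ₗ[ℂ] S.hor} (hdeg : S.RaisesDegree D) (hone : S.KillsOne D)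
    (hcov : S.IsCovariant D) (hker : S.PreservesKernels D) :
    ∃ (Dloc : ∀ i, S.BForm i ⊗[ℂ] H →ₗ[ℂ] S.BForm i ⊗[ℂ] H) (A : S.LocalFamily),
      S.IsGluedFrom D Dloc ∧ (∀ i, A i 1 = 0) ∧
        ∀ i h, Dloc i (1 ⊗ₜ h) = -(S.formOf A i).rTensor H (Coalgebra.comul h) := by
  choose Dloc hDloc using fun i => exists_factor (S.comp i) (S.comp_surjective i) (S.comp i ∘ₗ D)
    fun α hα => S.comp_eq_iff.2 <| by
      rw [map_zero]
      refine hker i α ?_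
      rw [← hIncl_comp, hα, map_zero]
  have hmem : ∀ i h, -S.evalCounit i (Dloc i (1 ⊗ₜ h)) ∈ (S.base i).gr 1 := fun i h => by
    obtain ⟨α, hα, hαi⟩ := S.exists_fibre_lift i h
    rw [← hαi, hDloc]
    refine neg_mem (horDegree_induction (S.base i) (p := fun x => S.evalCounit i x ∈ _) ?_ ?_ ?_
      (S.horDegree_iff.1 (hdeg 0 α hα) i))
    · rw [map_zero]; exact Submodule.zero_mem _
    · exact fun γ hγ k => Submodule.smul_mem _ _ hγ
    · intro x y hx hy
      rw [map_add]; exact add_mem hx hy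
  let A : S.LocalFamily := fun i => LinearMap.codRestrict _
    (-(S.evalCounit i ∘ₗ Dloc i ∘ₗ TensorProduct.mk ℂ (S.BForm i) H 1)) (hmem i)
  have hA : ∀ i, -S.formOf A i =
      S.evalCounit i ∘ₗ Dloc i ∘ₗ TensorProduct.mk ℂ (S.BForm i) H 1 := fun i => neg_neg _
  refine ⟨Dloc, A, S.isGluedFrom_iff.2 fun i α => (hDloc i α).symm, fun i => Subtype.ext ?_,
    fun i h => ?_⟩
  · change -S.evalCounit i (Dloc i (1 ⊗ₜ 1)) = 0
    have h1 : (1 : S.BForm i) ⊗ₜ[ℂ] (1 : H) = S.comp i 1 := (S.comp_one i).symm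
    have h2 : D 1 = 0 := hone
    rw [h1, hDloc, LinearMap.comp_apply, h2, map_zero, map_zero, neg_zero]
  · obtain ⟨α, -, hα⟩ := S.exists_fibre_lift i h
    obtain ⟨t, ht, ht'⟩ := hcov α
    have h1 : S.comp i ∘ₗ D = Dloc i ∘ₗ S.comp i := LinearMap.ext fun α => (hDloc i α).symm
    have h2 := S.isCoactionOf_iff.1 ht' i
    rw [← LinearMap.comp_apply, ← LinearMap.rTensor_comp, h1, LinearMap.rTensor_comp,
      LinearMap.comp_apply, S.isCoactionOf_iff.1 ht, hα, freeCoaction_tmul] at h2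
    -- Applying the counit to the middle leg restores D_i(1 ⊗ h) on one side and leaves ∑ -A_i(h₁) ⊗
    -- h₂ on the other.
    have h3 := congrArg ((slice _ (Coalgebra.counit : H →ₗ[ℂ] ℂ)).rTensor H) h2
    rw [rTensor_counit_freeCoaction, ← LinearMap.comp_apply, ← LinearMap.comp_apply,
      ← LinearMap.rTensor_comp, ← LinearMap.rTensor_comp] at h3
    rw [← LinearMap.neg_apply, ← LinearMap.rTensor_neg, hA, ← hα, hDloc]
    exact h3.symm

/-- A family of local one-forms whose local derivatives glue on the horizontal forms satisfies
the gauge transformation rule. -/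
theorem gauge_of_glued [Finite I] (A : S.LocalFamily) {D : S.hor →ₗ[ℂ] S.hor}
    {Dloc : ∀ i, S.BForm i ⊗[ℂ] H →ₗ[ℂ] S.BForm i ⊗[ℂ] H} (hD : S.IsGluedFrom D Dloc) (i j : I)
    (Ψ : S.Q i j ⊗[ℂ] H →ₗ[ℂ] S.Q i j)
    (hr : ∀ y, S.horRight i j (Dloc j y) = Ψ ((S.baseRight i j).toLinearMap.rTensor H y))
    (hone : ∀ h, Dloc i (1 ⊗ₜ h) = -(S.formOf A i).rTensor H (Coalgebra.comul h))
    (hΨ : ∀ h, Ψ (S.changeChart i j (1 ⊗ₜ h)) = -S.gaugeTerm i j A h) :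
    (S.πLeft i j).toLinearMap ∘ₗ S.formOf A i =
      conv (conv (S.embM i j ∘ₗ S.τ i j) ((S.πRight i j).toLinearMap ∘ₗ S.formOf A j))
        (S.embM i j ∘ₗ S.τ' i j) +
      conv (S.embM i j ∘ₗ S.τ i j) (S.dM i j ∘ₗ S.τ' i j) := by
  refine (S.gauge_iff_gaugeTerm i j A).2 (LinearMap.ext fun h => neg_injective ?_)
  -- For a global lift α of 1 ⊗ h, both α and D α have matching components on the overlap; this is
  -- the comparison of the charts i and j.
  obtain ⟨α, -, hα⟩ := S.exists_fibre_lift i h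
  have h1 := S.horLeft_comp i j α
  have h2 := S.horLeft_comp i j (D α)
  rw [S.isGluedFrom_iff.1 hD, S.isGluedFrom_iff.1 hD, hr, ← S.changeChart_eq i j h1, hα, hΨ,
    hone, map_neg] at h2
  rw [← h2, conv_apply]
  congr 1
  generalize (Coalgebra.comul h : H ⊗[ℂ] H) = s
  induction s using TensorProduct.induction_on with
  | zero => simp
  | tmul a b => rw [LinearMap.rTensor_tmul, horLeft_tmul]; rfl
  | add x y hx hy => simp only [map_add, hx, hy]

variable {S} in
theorem IsLeftCovDer.exists_isCompatible [Finite I] {D : S.hor →ₗ[ℂ] S.hor}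
    (hD : S.IsLeftCovDer D) :
    ∃ A, S.IsCompatible A ∧ S.IsGluedFrom D fun i => S.localLeft (S.formOf A i) := by
  obtain ⟨Dloc, A, hDl, hA1, hA⟩ := S.exists_local hD.degree hD.map_one hD.covariant hD.map_ker
  have key : Dloc = fun i => S.localLeft (S.formOf A i) := funext fun i => by
    refine TensorProduct.ext' fun γ h => ?_
    induction γ using DirectSum.Decomposition.inductionOn (S.base i).gr with
    | zero => simp
    | @homogeneous n γ =>
      -- Write γ ⊗ h = (γ ⊗ 1)(1 ⊗ h), lift both factors globally and compare the Leibniz rules of D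
      -- and of the local formula.
      obtain ⟨γ', hγ', hγi⟩ := S.exists_homogeneous_lift i γ.2
      obtain ⟨α, -, hα⟩ := S.exists_fibre_lift i h
      have h1 := S.leftLeibniz_iff.1 hD.leibniz n γ' hγ' α i
      rw [S.isGluedFrom_iff.1 hDl, S.isGluedFrom_iff.1 hDl, comp_mul, comp_ιc, hγi, hα, hA,
        ← localLeft_one_tmul, ← S.localLeft_mul _ γ.2, Algebra.TensorProduct.tmul_mul_tmul,
        mul_one, one_mul] at h1
      exact h1
    | add a b ha hb => simp only [TensorProduct.add_tmul, map_add, ha, hb]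
  subst key
  refine ⟨A, ⟨hA1, fun i j => ?_⟩, hDl⟩
  refine S.gauge_of_glued A hDl i j (S.overlapLeftDer i j A) (S.horRight_localLeft i j A) (hA i)
    fun h => ?_
  rw [overlapLeftDer_changeChart, (S.base i).d_one, (S.base i).parity_one, map_zero,
    _root_.map_one (S.baseLeft i j), zero_mul, zero_sub, one_mul]

variable {S} in
theorem IsRightCovDer.exists_isCompatible [Finite I] {D : S.hor →ₗ[ℂ] S.hor}
    (hD : S.IsRightCovDer D) :
    ∃ A, S.IsCompatible A ∧ S.IsGluedFrom D fun i => S.localRight (S.formOf A i) := by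
  obtain ⟨Dloc, A, hDl, hA1, hA⟩ := S.exists_local hD.degree hD.map_one hD.covariant hD.map_ker
  have key : Dloc = fun i => S.localRight (S.formOf A i) := funext fun i => by
    refine TensorProduct.ext' fun γ h => ?_
    -- Now γ ⊗ h = (1 ⊗ h)(γ ⊗ 1), and the sign is governed by the lift of 1 ⊗ h, of degree zero; so
    -- γ need not be homogeneous.
    obtain ⟨γ', hγi⟩ := S.exists_lift i γ
    obtain ⟨α, hα0, hα⟩ := S.exists_fibre_lift i h
    have h1 := S.rightLeibniz_iff.1 hD.leibniz 0 α hα0 γ' i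
    have h2 : (1 : S.BForm i) ⊗ₜ[ℂ] h ∈ horDegree (S.base i) 0 :=
      tmul_mem_horDegree _ (S.base i).one_mem h
    rw [S.isGluedFrom_iff.1 hDl, S.isGluedFrom_iff.1 hDl, comp_mul, comp_ιc, hγi, hα, hA,
      ← localRight_one_tmul, ← S.localRight_mul _ h2, Algebra.TensorProduct.tmul_mul_tmul,
      mul_one, one_mul] at h1
    exact h1
  subst key
  refine ⟨A, ⟨hA1, fun i j => ?_⟩, hDl⟩
  refine S.gauge_of_glued A hDl i j (S.overlapRightDer i j A) (S.horRight_localRight i j A) (hA i)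
    fun h => ?_
  rw [overlapRightDer_changeChart, (S.base i).d_one, map_zero,
    _root_.map_one (S.baseLeft i j), zero_mul, zero_sub, mul_one]

/-! ### The correspondence -/

/-- The bijection is formal, whichever side the Leibniz rule is on: D is determined by its local
formulas, hence by A, and A by the counit slices of D on lifts of 1 ⊗ h. -/
theorem exists_correspondence {p : (S.hor →ₗ[ℂ] S.hor) → Prop}
    (Dloc : ∀ i, (H →ₗ[ℂ] S.BForm i) → S.BForm i ⊗[ℂ] H →ₗ[ℂ] S.BForm i ⊗[ℂ] H)
    (hone : ∀ i a h, Dloc i a (1 ⊗ₜ h) = -a.rTensor H (Coalgebra.comul h))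
    (h1 : ∀ D, p D → ∃ A, S.IsCompatible A ∧ S.IsGluedFrom D fun i => Dloc i (S.formOf A i))
    (h2 : ∀ A, S.IsCompatible A →
      ∃ D, p D ∧ S.IsGluedFrom D fun i => Dloc i (S.formOf A i)) :
    ∃ e : {D : S.hor →ₗ[ℂ] S.hor // p D} ≃ {A : S.LocalFamily // S.IsCompatible A},
      ∀ D, S.IsFamilyOf D.1 (e D).1 ∧
        S.IsGluedFrom D.1 (fun i => Dloc i (S.formOf (e D).1 i)) := by
  have hfam : ∀ D A, (S.IsGluedFrom D fun i => Dloc i (S.formOf A i)) → S.IsFamilyOf D A := by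
    intro D A hD i h α y hα hy
    have h3 := hD i α _ hα
    rw [hy, (S.hIncl_injective i).eq_iff] at h3
    rw [h3, hone, map_neg, evalCounit_rTensor_comul, neg_neg]
  -- `IsFamilyOf` quantifies over lifts of 1 ⊗ h; it determines A because such lifts exist.
  have huniq : ∀ D A A', S.IsFamilyOf D A → S.IsFamilyOf D A' → A = A' := by
    intro D A A' hA hA'
    refine funext fun i => LinearMap.ext fun h => Subtype.ext ?_
    obtain ⟨α, -, hα⟩ := S.exists_fibre_lift i h
    have h3 := hA i h α _ (S.comp_eq_iff.1 hα) (S.hIncl_comp i (D α)).symm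
    have h4 := hA' i h α _ (S.comp_eq_iff.1 hα) (S.hIncl_comp i (D α)).symm
    exact h3.trans h4.symm
  choose f hf using h1
  let F : {D : S.hor →ₗ[ℂ] S.hor // p D} → {A : S.LocalFamily // S.IsCompatible A} :=
    fun D => ⟨f D.1 D.2, (hf D.1 D.2).1⟩
  have hF : Function.Bijective F := by
    constructor
    · intro D D' hDD'
      refine Subtype.ext (LinearMap.ext fun α => S.hor_ext fun i => ?_)
      have h3 : f D.1 D.2 = f D'.1 D'.2 := congrArg Subtype.val hDD'
      rw [S.isGluedFrom_iff.1 (hf D.1 D.2).2, S.isGluedFrom_iff.1 (hf D'.1 D'.2).2, h3]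
    · intro A
      obtain ⟨D, hD, hDA⟩ := h2 A.1 A.2
      exact ⟨⟨D, hD⟩, Subtype.ext
        (huniq D _ _ (hfam _ _ (hf D hD).2) (hfam _ _ hDA))⟩
  exact ⟨Equiv.ofBijective F hF, fun D => ⟨hfam _ _ (hf D.1 D.2).2, (hf D.1 D.2).2⟩⟩

end DiffStructure

end Bundles

end QuantumBundle

end

theorem proposition10 {H B P I : Type*} [Finite I] [Ring H] [HopfAlgebra ℂ H]
    [Ring B] [Algebra ℂ B] [Ring P] [Algebra ℂ P]
    (X : QuantumBundle.Bundle H B P I) (S : QuantumBundle.DiffStructure X) :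
    (∃ e : {D : S.hor →ₗ[ℂ] S.hor // S.IsLeftCovDer D} ≃
        {A : S.LocalFamily // S.IsCompatible A},
      ∀ D, S.IsFamilyOf D.1 (e D).1 ∧
        S.IsGluedFrom D.1 (fun i => S.localLeft (S.formOf (e D).1 i))) ∧
    (∃ e : {D : S.hor →ₗ[ℂ] S.hor // S.IsRightCovDer D} ≃
        {A : S.LocalFamily // S.IsCompatible A},
      ∀ D, S.IsFamilyOf D.1 (e D).1 ∧
        S.IsGluedFrom D.1 (fun i => S.localRight (S.formOf (e D).1 i))) :=
  ⟨S.exists_correspondence (fun _ a => S.localLeft a) (fun _ a h => S.localLeft_one_tmul a h)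
      (fun _ hD => hD.exists_isCompatible) (fun _ hA => hA.exists_isLeftCovDer),
    S.exists_correspondence (fun _ a => S.localRight a) (fun _ a h => S.localRight_one_tmul a h)
      (fun _ hD => hD.exists_isCompatible) (fun _ hA => hA.exists_isRightCovDer)⟩
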